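/- **Setting.** There are $Q\ge1$ users and $N\ge1$ subcarriers. Put $\mathcal Q(x)=\frac1{\sqrt{2\pi}}\int_x^\infty e^{-s^2/2}\,ds$. The data are, for users $q,r$ and subcarriers $k$: channels $H_{qr}(k)\in\mathbb C$ with $H_{qq}(k)\ne0$; noise powers $\sigma_{q,k}^2>0$; real $\mu_{q,k|0},\mu_{q,k|1}$ and $\sigma_{q,k|0},\sigma_{q,k|1}>0$; $f_q>0$; $0<\tau_q^{\min}<\tau_q^{\max}<T_q$; $\alpha_{q,k},\beta_q\in(0,\tfrac12]$; $P_q,\,p^{\max}_{q,k},\,w_{q,k},\,I_q^{\max}>0$; $I^{\max}\in\mathbb R$; and a weight $c\ge0$. Put $\hat\sigma^2_{q,k}=\sigma^2_{q,k}/|H_{qq}(k)|^2$, $\hat H_{qr}(k)=H_{qr}(k)/H_{qq}(k)$, $\hat\alpha_{q,k}=\mathcal Q^{-1}(1-\alpha_{q,k})$. **Game.** A strategy of user $q$ is $x_q=(\hat\tau_q,p_q,P_q^{\rm fa})\in\mathbb R\times\mathbb R^N\times\mathbb R$, a profile is $x=(x_q)_{q}$. Let $$r_{q,k}(p)=\log\Bigl(1+\frac{p_{q,k}}{\hat\sigma^2_{q,k}+\sum_{r\ne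 q}|\hat H_{qr}(k)|^2p_{r,k}}\Bigr),\qquad z_{q,k}(x_q)=\frac{\sigma_{q,k|0}\mathcal Q^{-1}(P_q^{\rm fa})-(\mu_{q,k|1}-\mu_{q,k|0})\hat\tau_q}{\sigma_{q,k|1}},\qquad P^{\rm miss}_{q,k}(x_q)=1-\mathcal Q(z_{q,k}(x_q)),$$ $$\theta_q(x)=\log\Bigl(\bigl(1-\tfrac{\hat\tau_q^2}{f_qT_q}\bigr)\sum_k(1-P_q^{\rm fa})r_{q,k}(p)\Bigr)-\frac c2\Bigl(\frac{\hat\tau_q}{\sqrt{f_q}}-\frac1Q\sum_r\frac{\hat\tau_r}{\sqrt{f_r}}\Bigr)^2\quad(\log 0=-\infty),$$ $$I_q(x_q)=\sum_kP^{\rm miss}_{q,k}(x_q)w_{q,k}p_{q,k}-I_q^{\max},\qquad I(x)=\sum_{q,k}P^{\rm miss}_{q,k}(x_q)w_{q,k}p_{q,k}-I^{\max}.$$ Let $\mathcal P_q=\{p_q:\sum_kp_{q,k}\le P_q,\ 0\le p_{q,k}\le p^{\max}_{q,k}\}$, let $\mathcal Y_q$ be the set of $x_q$ with $0<P_q^{\rm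 fa}\le\beta_q$, $z_{q,k}(x_q)\le\hat\alpha_{q,k}$ for all $k$, $p_q\in\mathcal P_q$ and $\sqrt{\tau_q^{\min}f_q}\le\hat\tau_q\le\sqrt{\tau_q^{\max}f_q}$, and let $\mathcal X_q=\{x_q\in\mathcal Y_q: I_q(x_q)\le0\}$, $\mathcal Y=\prod_q\mathcal Y_q$. All $\mathcal Y_q$ are assumed nonempty. For a fixed price $\pi\ge0$, in the game $\mathcal G_\pi$ user $q$ maximizes $\theta_q(x_q,x_{-q})-\pi I(x_q,x_{-q})$ over $x_q\in\mathcal X_q$; a Nash equilibrium (NE) is a profile each of whose components is such a maximizer given the others. **The matrix $\Gamma(t)$.** Fix $t>0$ with $t\ge\pi$, and nonzero reference powers $p_q^{\rm ref}\in\mathcal P_q$ with $\sum_kw_{q,k}p^{\rm ref}_{q,k}\le2I_q^{\max}$. Put $$\lambda^{\max}=\sum_q\frac{1/\min_{q'}\min\{I_{q'}^{\max},\min_kp^{\max}_{q',k}\}}{\min_k\Bigl\{\frac1{p_{q,k}^{\max}}\log\Bigl(1+\frac{p^{\max}_{q,k}}{\hat\sigma^2_{q,k}+\sum_{r\ne q}|\hat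 H_{qr}(k)|^2p^{\max}_{r,k}}\Bigr)\Bigr\}\cdot\min_k\hat\sigma^2_{q,k}},$$ $$P_q^{\rm fa,ref}=\max_k\mathcal Q\Bigl(\tfrac{\sigma_{q,k|1}\hat\alpha_{q,k}+(\mu_{q,k|1}-\mu_{q,k|0})\sqrt{f_q\tau_q^{\min}}}{\sigma_{q,k|0}}\Bigr),$$ $$\eta_q^{\rm ref}(t)=\log\bigl(1-\tfrac{\tau_q^{\min}}{T_q}\bigr)+\log(1-P_q^{\rm fa,ref})+\log\sum_kr_{q,k}(p_q^{\rm ref},p_{-q}^{\max})-\tfrac t2\sum_kw_{q,k}p^{\rm ref}_{q,k},$$ $$\hat{\mathcal Y}_q^t=\Bigl\{x_q\in\mathcal Y_q:\ \sum_kp_{q,k}\ge(\min_k\hat\sigma^2_{q,k})\,e^{\eta_q^{\rm ref}(t)}\Bigr\}.$$ Let $\mathcal L_q(x,\lambda_q,\pi')=-\theta_q(x)+\lambda_qI_q(x_q)+\pi'I(x)$. With $\|\cdot\|$ the spectral norm and $\lambda_{\rm least}$ the least eigenvalue, let $$B_q(x,\lambda_q,\pi')=\begin{bmatrix}\nabla^2_{\hat\tau_q}\mathcal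 L_q&-\|\nabla^2_{\hat\tau_q(p_q,P_q^{\rm fa})}\mathcal L_q\|\\-\|\nabla^2_{(p_q,P_q^{\rm fa})\hat\tau_q}\mathcal L_q\|&\lambda_{\rm least}(\nabla^2_{(p_q,P_q^{\rm fa})}\mathcal L_q)\end{bmatrix}_{c=0},$$ let $\rho_q(t)$ be the positive part of the minimum of $\lambda_{\rm least}(B_q(x,\lambda_q,\pi'))$ over $x_q\in\hat{\mathcal Y}_q^t$, $x_{-q}\in\prod_{r\ne q}\mathcal Y_r$, $\lambda_q\in[0,\lambda^{\max}]$, $\pi'\in[0,t]$, and let $$D_q(t,c)=\operatorname{diag}\Bigl(\rho_q(t)+c\bigl(\tfrac{1-1/Q}{\sqrt{f_q}}\bigr)^2,\ \rho_q(t)\Bigr)^{1/2},\quad E_{qr}(x)=\operatorname{diag}\bigl(|\nabla^2_{\hat\tau_q\hat\tau_r}\theta_q(x)|,\ \|\nabla^2_{p_qp_r}\theta_q(x)\|\bigr),$$ $$\beta_{qr}(t,c)=\max_{x_q\in\hat{\mathcal Y}_q^t,\ x_{-q}\in\prod_{r\ne q}\mathcal Y_r}\|D_q(t,c)^{-1}E_{qr}(x)D_r(t,c)^{-1}\|\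 (q\ne r),\qquad[\Gamma(t)]_{qq}=1,\quad[\Gamma(t)]_{qr}=-\beta_{qr}(t,c)\ (q\ne r).$$ **Theorem.** Suppose that every $D_q(t,c)$ is invertible (so that $\Gamma(t)$ is defined) and that $\Gamma(t)$ is a P-matrix (all its principal minors are positive). Then for every $q$ and every $x_{-q}\in\prod_{r\ne q}\mathcal Y_r$ the problem of user $q$ has exactly one optimal solution $\overline{\mathcal B}_q(x_{-q})$; the game $\mathcal G_\pi$ has exactly one NE $x^\star$; and every sequence generated by a totally asynchronous best-response algorithm from any $x^{(0)}\in\mathcal Y$ converges to $x^\star$. That is, $x^{(n)}\to x^\star$ whenever there are sets of update times $\mathcal T_q\subseteq\mathbb N$ and read times $\tau^q_r(n)$ such that $x_q^{(n+1)}=\overline{\mathcal B}_q\bigl((x_r^{(\tau^q_r(n))})_{r\ne q}\bigr)$ if $n\in\mathcal T_q$ and $x_q^{(n+1)}=x_q^{(n)}$ otherwise, where every $\mathcal T_q$ is infinite and, for all $r\ne q$, $0\le\tau^q_r(n)\le n$ for $n\in\mathcal T_q$ and $\tau^q_r(n)\to\infty$ as $n\to\infty$ in $\mathcal T_q$. In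 particular the Jacobi scheme (all users update at every step) and the Gauss–Seidel scheme (users update one at a time, in cyclic order), both with current information, converge to $x^\star$ from any point of $\mathcal Y$. -/

import Mathlib

open scoped Matrix.Norms.L2Operator

noncomputable section

/-! ### Matrices -/

/-- The spectral norm `ρ(AᵀA)^{1/2}`: the operator norm for the Euclidean vector norms. -/
def specNorm {m n : Type*} [Fintype m] [Fintype n] [DecidableEq n] (A : Matrix m n ℝ) : ℝ := ‖A‖

/-- The least eigenvalue of a real symmetric matrix. -/
def leastEig {n : Type*} [Fintype n] [DecidableEq n] (A : Matrix n n ℝ) : ℝ :=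
  sInf (spectrum ℝ A)

/-- A P-matrix: all principal minors are positive. -/
def IsPMatrix {n : Type*} [DecidableEq n] (A : Matrix n n ℝ) : Prop :=
  ∀ s : Finset n, s.Nonempty →
    0 < (A.submatrix (Subtype.val : s → n) (Subtype.val : s → n)).det

/-- The block `∇²_{x_q x_r} F (x)` of second partial derivatives of a function `F` of a profile
`x = (x_1, …, x_Q)`, with `x_q ∈ ℝ^d`; rows are indexed by the coordinates of `x_q`, columns by
those of `x_r`. -/
def hessBlock {Q d : ℕ} (F : (Fin Q → Fin d → ℝ) → ℝ) (x : Fin Q → Fin d → ℝ) (q r : Fin Q) :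
    Matrix (Fin d) (Fin d) ℝ :=
  Matrix.of fun i j =>
    fderiv ℝ (fderiv ℝ F) x (Pi.single q (Pi.single i 1)) (Pi.single r (Pi.single j 1))

/-! ### The Gaussian tail function -/

/-- `𝒬(x) = (1/√(2π)) ∫_x^∞ e^{-s²/2} ds`, a decreasing bijection from `ℝ` onto `(0,1)`. -/
def gaussQ (x : ℝ) : ℝ := (1 / √(2 * Real.pi)) * ∫ s in Set.Ioi x, Real.exp (-s ^ 2 / 2)

/-- The inverse of `𝒬`; it is only ever applied to arguments in `(0,1)`. -/
def gaussQInv : ℝ → ℝ := Function.invFun gaussQ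

/-! ### Strategies -/

/-- The strategy `x_q = (τ̂_q, p_{q,1}, …, p_{q,N}, P_q^fa) ∈ ℝ^{N+2}` of one user. -/
abbrev Strat (N : ℕ) := Fin (N + 2) → ℝ

/-- A strategy profile `x = (x_q)_q`. -/
abbrev Profile (Q N : ℕ) := Fin Q → Strat N

/-- Position of the `k`-th power in a strategy vector. -/
def pIdx {N : ℕ} (k : Fin N) : Fin (N + 2) := k.castSucc.succ

/-- Normalized sensing time `τ̂`. -/
def Strat.tau {N : ℕ} (y : Strat N) : ℝ := y 0

/-- Power on the `k`-th subcarrier. -/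
def Strat.pow {N : ℕ} (y : Strat N) (k : Fin N) : ℝ := y (pIdx k)

/-- False alarm rate. -/
def Strat.pfa {N : ℕ} (y : Strat N) : ℝ := y (Fin.last (N + 1))

/-! ### The sensing / power control game -/

/-- The data of the system with `Q` secondary users and `N` subcarriers. -/
structure CRGame (Q N : ℕ) where
  Q_pos : 0 < Q
  N_pos : 0 < N
  /-- `H q r k = H_{qr}(k)`: channel from transmitter `r` to receiver `q` on subcarrier `k`. -/
  H : Fin Q → Fin Q → Fin N → ℂ
  H_self_ne : ∀ q k, H q q k ≠ 0
  /-- Noise power `σ²_{q,k}`. -/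
  noise : Fin Q → Fin N → ℝ
  noise_pos : ∀ q k, 0 < noise q k
  /-- Means `μ_{q,k|0}`, `μ_{q,k|1}` and deviations `σ_{q,k|0}`, `σ_{q,k|1}` of the detector. -/
  mu0 : Fin Q → Fin N → ℝ
  mu1 : Fin Q → Fin N → ℝ
  sd0 : Fin Q → Fin N → ℝ
  sd1 : Fin Q → Fin N → ℝ
  sd0_pos : ∀ q k, 0 < sd0 q k
  sd1_pos : ∀ q k, 0 < sd1 q k
  /-- Sampling frequency `f_q`. -/
  f : Fin Q → ℝ
  f_pos : ∀ q, 0 < f q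
  /-- Frame duration `T_q` and bounds `0 < τ_q^min < τ_q^max < T_q` on the sensing time. -/
  T : Fin Q → ℝ
  tauMin : Fin Q → ℝ
  tauMax : Fin Q → ℝ
  tauMin_pos : ∀ q, 0 < tauMin q
  tauMin_lt_tauMax : ∀ q, tauMin q < tauMax q
  tauMax_lt_T : ∀ q, tauMax q < T q
  /-- Bounds `α_{q,k}` on the missed detection and `β_q` on the false alarm probabilities. -/
  alpha : Fin Q → Fin N → ℝ
  alpha_pos : ∀ q k, 0 < alpha q k
  alpha_le : ∀ q k, alpha q k ≤ 1 / 2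
  beta : Fin Q → ℝ
  beta_pos : ∀ q, 0 < beta q
  beta_le : ∀ q, beta q ≤ 1 / 2
  /-- Power budget `P_q` and spectral mask `p_{q,k}^max`. -/
  budget : Fin Q → ℝ
  budget_pos : ∀ q, 0 < budget q
  pmax : Fin Q → Fin N → ℝ
  pmax_pos : ∀ q k, 0 < pmax q k
  /-- Interference weights `w_{q,k}`, local limits `I_q^max` and global limit `I^max`. -/
  w : Fin Q → Fin N → ℝ
  w_pos : ∀ q k, 0 < w q k
  locLim : Fin Q → ℝ
  locLim_pos : ∀ q, 0 < locLim q
  globLim : ℝ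

namespace CRGame

variable {Q N : ℕ} (G : CRGame Q N)

/-- `σ̂²_{q,k} = σ²_{q,k} / |H_{qq}(k)|²`. -/
def nnoise (q : Fin Q) (k : Fin N) : ℝ := G.noise q k / ‖G.H q q k‖ ^ 2

/-- `|Ĥ_{qr}(k)|² = |H_{qr}(k)|² / |H_{qq}(k)|²`. -/
def gain (q r : Fin Q) (k : Fin N) : ℝ := ‖G.H q r k / G.H q q k‖ ^ 2

/-- The rate `r_{q,k}`, as a function of the powers of all users. -/
def rate (q : Fin Q) (k : Fin N) (p : Fin Q → Fin N → ℝ) : ℝ :=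
  Real.log (1 + p q k / (G.nnoise q k + ∑ r ∈ Finset.univ.erase q, G.gain q r k * p r k))

/-- The argument `(σ_{q,k|0} 𝒬⁻¹(P_q^fa) - (μ_{q,k|1} - μ_{q,k|0}) τ̂_q) / σ_{q,k|1}` whose
`𝒬`-value is the detection probability. -/
def detArg (q : Fin Q) (k : Fin N) (y : Strat N) : ℝ :=
  G.sd0 q k / G.sd1 q k * gaussQInv y.pfa - y.tau * ((G.mu1 q k - G.mu0 q k) / G.sd1 q k)

/-- Missed detection probability: one minus the detection probability. -/
def pmiss (q : Fin Q) (k : Fin N) (y : Strat N) : ℝ := 1 - gaussQ (G.detArg q k y)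

/-- Opportunistic throughput (the argument of the logarithm in the payoff). -/
def throughput (q : Fin Q) (x : Profile Q N) : ℝ :=
  (1 - (x q).tau ^ 2 / (G.f q * G.T q)) *
    ∑ k, (1 - (x q).pfa) * G.rate q k (fun r => (x r).pow)

/-- Payoff `θ_q` with the equi-sensing penalty of weight `c`, where the throughput is positive. -/
def theta (c : ℝ) (q : Fin Q) (x : Profile Q N) : ℝ :=
  Real.log (G.throughput q x) -
    c / 2 * ((x q).tau / √(G.f q) - 1 / (Q : ℝ) * ∑ r, (x r).tau / √(G.f r)) ^ 2

/-- Local interference violation `I_q`. -/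
def locI (q : Fin Q) (y : Strat N) : ℝ := ∑ k, G.pmiss q k y * G.w q k * y.pow k - G.locLim q

/-- Global interference violation `I`. -/
def globI (x : Profile Q N) : ℝ :=
  ∑ k, ∑ q, G.pmiss q k (x q) * G.w q k * (x q).pow k - G.globLim

/-- The power set `𝒫_q`. -/
def powerSet (q : Fin Q) : Set (Fin N → ℝ) :=
  {p | ∑ k, p k ≤ G.budget q ∧ ∀ k, 0 ≤ p k ∧ p k ≤ G.pmax q k}

/-- `α̂_{q,k} = 𝒬⁻¹(1 - α_{q,k})`. -/
def alphaHat (q : Fin Q) (k : Fin N) : ℝ := gaussQInv (1 - G.alpha q k)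

/-- The convex part `𝒴_q` of the constraints (`0 < P_q^fa` is the domain of `𝒬⁻¹`). -/
def Y (q : Fin Q) : Set (Strat N) :=
  {y | 0 < y.pfa ∧ y.pfa ≤ G.beta q ∧ (∀ k, G.detArg q k y ≤ G.alphaHat q k) ∧
    y.pow ∈ G.powerSet q ∧ √(G.tauMin q * G.f q) ≤ y.tau ∧ y.tau ≤ √(G.tauMax q * G.f q)}

/-- The feasible set `𝒳_q`. -/
def X (q : Fin Q) : Set (Strat N) := {y | y ∈ G.Y q ∧ G.locI q y ≤ 0}

/-- The objective `θ_q(x) - π I(x)` of user `q`, with value `-∞` where the throughput vanishes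
(`log 0 = -∞`). -/
def objective (c price : ℝ) (q : Fin Q) (x : Profile Q N) : EReal :=
  if 0 < G.throughput q x then ((G.theta c q x - price * G.globI x : ℝ) : EReal) else ⊥

/-- `y` is an optimal solution of the problem of user `q`, given the strategies `x_{-q}`. -/
def IsBestResponse (c price : ℝ) (q : Fin Q) (x : Profile Q N) (y : Strat N) : Prop :=
  y ∈ G.X q ∧ ∀ z ∈ G.X q,
    G.objective c price q (Function.update x q z) ≤ G.objective c price q (Function.update x q y)

/-- Nash equilibria of the game with fixed exogenous price. -/
def IsNash (c price : ℝ) (x : Profile Q N) : Prop := ∀ q, G.IsBestResponse c price q x (x q)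

/-! ### The matrix `Γ(t)` -/

/-- Lagrangian `ℒ_q`, in which only the nonconvex constraint is dualized. -/
def lagr (c : ℝ) (q : Fin Q) (lam price : ℝ) (x : Profile Q N) : ℝ :=
  -G.theta c q x + lam * G.locI q (x q) + price * G.globI x

/-- Upper bound `λ^max` on the multipliers of the local interference constraints. -/
def lamMax : ℝ :=
  ∑ q, (1 / ⨅ q', min (G.locLim q') (⨅ k, G.pmax q' k)) /
    ((⨅ k, G.rate q k G.pmax / G.pmax q k) * ⨅ k, G.nnoise q k)

/-- The reference false alarm rate. -/
def pfaRef (q : Fin Q) : ℝ :=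
  ⨆ k, gaussQ ((G.sd1 q k * G.alphaHat q k +
    (G.mu1 q k - G.mu0 q k) * √(G.f q * G.tauMin q)) / G.sd0 q k)

/-- Admissible reference powers: nonzero and feasible, with `∑_k w_{q,k} p_{q,k} ≤ 2 I_q^max`. -/
def IsRefPower (pref : Fin Q → Fin N → ℝ) : Prop :=
  ∀ q, pref q ∈ G.powerSet q ∧ pref q ≠ 0 ∧ ∑ k, G.w q k * pref q k ≤ 2 * G.locLim q

/-- The constant `η_q^ref(t)`. -/
def etaRef (pref : Fin Q → Fin N → ℝ) (t : ℝ) (q : Fin Q) : ℝ :=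
  Real.log (1 - G.tauMin q / G.T q) + Real.log (1 - G.pfaRef q) +
    Real.log (∑ k, G.rate q k (Function.update G.pmax q (pref q))) -
    t / 2 * ∑ k, G.w q k * pref q k

/-- The restriction `𝒴̂_q^t` of `𝒴_q` to power vectors with a lower bound on the total power. -/
def Yhat (pref : Fin Q → Fin N → ℝ) (t : ℝ) (q : Fin Q) : Set (Strat N) :=
  {y | y ∈ G.Y q ∧ (⨅ k, G.nnoise q k) * Real.exp (G.etaRef pref t q) ≤ ∑ k, y.pow k}

/-- Profiles with `x_q ∈ 𝒴̂_q^t` and `x_{-q} ∈ 𝒴_{-q}`. -/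
def dom (pref : Fin Q → Fin N → ℝ) (t : ℝ) (q : Fin Q) : Set (Profile Q N) :=
  {x | x q ∈ G.Yhat pref t q ∧ ∀ r, r ≠ q → x r ∈ G.Y r}

/-- The `2 × 2` matrix `B_q(x, λ_q, π)`, built from the Hessian of `ℒ_q` at `c = 0` split into the
blocks of `τ̂_q` and of `(p_q, P_q^fa)`. -/
def Bmat (q : Fin Q) (x : Profile Q N) (lam price : ℝ) : Matrix (Fin 2) (Fin 2) ℝ :=
  let h := hessBlock (G.lagr 0 q lam price) x q q
  !![h 0 0, -specNorm (h.submatrix (fun _ : Fin 1 => 0) Fin.succ);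
     -specNorm (h.submatrix Fin.succ (fun _ : Fin 1 => 0)), leastEig (h.submatrix Fin.succ Fin.succ)]

/-- `ρ_q(t)`: the positive part of the minimum of the least eigenvalue of `B_q`. -/
def rho (pref : Fin Q → Fin N → ℝ) (t : ℝ) (q : Fin Q) : ℝ :=
  max 0 (sInf {e | ∃ x ∈ G.dom pref t q, ∃ lam ∈ Set.Icc 0 G.lamMax, ∃ price ∈ Set.Icc 0 t,
    e = leastEig (G.Bmat q x lam price)})

/-- The diagonal matrix `D_q(t, c)`. -/
def Dmat (pref : Fin Q → Fin N → ℝ) (t c : ℝ) (q : Fin Q) : Matrix (Fin 2) (Fin 2) ℝ :=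
  Matrix.diagonal ![√(G.rho pref t q + c * ((1 - 1 / (Q : ℝ)) / √(G.f q)) ^ 2),
    √(G.rho pref t q)]

/-- The diagonal matrix `E_{qr}(x)`. -/
def Emat (c : ℝ) (q r : Fin Q) (x : Profile Q N) : Matrix (Fin 2) (Fin 2) ℝ :=
  let h := hessBlock (G.theta c q) x q r
  Matrix.diagonal ![|h 0 0|, specNorm (h.submatrix pIdx pIdx)]

/-- The coefficients `β_{qr}(t, c)`. -/
def betaCoef (pref : Fin Q → Fin N → ℝ) (t c : ℝ) (q r : Fin Q) : ℝ :=
  sSup {e | ∃ x ∈ G.dom pref t q,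
    e = specNorm ((G.Dmat pref t c q)⁻¹ * G.Emat c q r x * (G.Dmat pref t c r)⁻¹)}

/-- The matrix `Γ(t)`. -/
def Gam (pref : Fin Q → Fin N → ℝ) (t c : ℝ) : Matrix (Fin Q) (Fin Q) ℝ :=
  Matrix.of fun q r => if r = q then 1 else -G.betaCoef pref t c q r

end CRGame

/-! ### Totally asynchronous iterations -/

/-- A feasible schedule: `updates q` is the set of times at which user `q` updates, and at such a
time `n` user `q` reads the strategy that user `r` had at time `readTime q r n`. Every user updates
infinitely often, and outdated information is eventually purged. -/
structure AsyncSchedule (Q : ℕ) where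
  updates : Fin Q → Set ℕ
  readTime : Fin Q → Fin Q → ℕ → ℕ
  updates_infinite : ∀ q, (updates q).Infinite
  readTime_le : ∀ q r n, n ∈ updates q → r ≠ q → readTime q r n ≤ n
  readTime_large : ∀ q r, r ≠ q → ∀ M, ∃ n₀, ∀ n ∈ updates q, n₀ ≤ n → M ≤ readTime q r n

namespace CRGame

variable {Q N : ℕ} (G : CRGame Q N)

/-- `x` is generated by the asynchronous best-response algorithm with schedule `s`. -/
def IsAsyncSeq (c price : ℝ) (s : AsyncSchedule Q) (x : ℕ → Profile Q N) : Prop :=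
  ∀ n q, (n ∈ s.updates q →
      G.IsBestResponse c price q (fun r => x (s.readTime q r n) r) (x (n + 1) q)) ∧
    (n ∉ s.updates q → x (n + 1) q = x n q)

/-- Jacobi scheme: all users update simultaneously, with current information. -/
def IsJacobiSeq (c price : ℝ) (x : ℕ → Profile Q N) : Prop :=
  ∀ n q, G.IsBestResponse c price q (x n) (x (n + 1) q)

/-- Gauss-Seidel scheme: the users update one at a time, in cyclic order, with current
information. -/
def IsGaussSeidelSeq (c price : ℝ) (x : ℕ → Profile Q N) : Prop :=
  ∀ n (q : Fin Q), ((q : ℕ) = n % Q → G.IsBestResponse c price q (x n) (x (n + 1) q)) ∧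
    ((q : ℕ) ≠ n % Q → x (n + 1) q = x n q)

end CRGame

end

noncomputable section

/-! ### The Gaussian tail function -/

/-! The best-response map is a contraction in a weighted maximum norm, although the feasible sets `X
q` need not be convex and the payoffs are not finite everywhere.

Localization. Replacing the powers of a best response by the reference powers, with sensing time and
false alarm rate kept, gives a feasible competitor with positive throughput. Comparing payoffs puts
every best response into the convex compact set `Yhat` (`IsBestResponse.mem_Yhat`), where the
throughput is positive and the payoff is smooth.

Strong optimality. A best response satisfies a variational inequality on the convex set `Y q` for
the Lagrangian of the single nonconvex constraint, with a multiplier in `[0, lamMax]`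
(`IsBestResponse.exists_multiplier`). The constraint qualification and the bound on the multiplier
both come from shrinking the powers to zero. For such multipliers the Hessian of the Lagrangian in
the user's own variables is at least `D_q²` (`leastEig_block_le` and the penalty), so the payoff at
a feasible point `z` of `Yhat` lies at least `‖z - y‖²/2` below its value at the best response `y`,
in the norm `wnorm` weighted by `D_q` (`IsBestResponse.growth`).

Contraction. Let `y`, `y'` be best responses to `x`, `x'`. Adding the two growth inequalities bounds
`‖y - y'‖²` by a mixed difference of `θ_q`; the price drops out because the global interference is a
sum over users. The mixed difference is the exact bilinear contribution of the penalty plus a mixed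
second derivative of the log sum rate in the powers. The coefficients `β_qr` bound both, whence `‖y
- y'‖ ≤ ∑ β_qr ‖x_r - x'_r‖` (`IsBestResponse.wnorm_sub_le`).

Conclusion. A P-matrix with nonpositive off-diagonal entries maps some positive vector `v` to a
positive vector (`IsPMatrix.exists_pos_mulVec_pos`). With the weights `v` the estimate becomes a
contraction. It gives uniqueness of best responses at once, an equilibrium as the limit of Jacobi
iterates, and asynchronous convergence through a shrinking family of boxes
(`AsyncSchedule.tendsto_zero`). -/

lemma integrable_exp_neg_sq_half : MeasureTheory.Integrable (fun s : ℝ => Real.exp (-s ^ 2 / 2)) := by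
  have h := integrable_exp_neg_mul_sq (b := 1 / 2) (by norm_num)
  refine h.congr (Filter.Eventually.of_forall fun s => ?_)
  simp only
  ring_nf

lemma continuous_exp_neg_sq_half : Continuous fun s : ℝ => Real.exp (-s ^ 2 / 2) := by fun_prop

lemma integral_exp_neg_sq_half_Ioi :
    ∫ s in Set.Ioi (0 : ℝ), Real.exp (-s ^ 2 / 2) = √(2 * Real.pi) / 2 := by
  have h := integral_gaussian_Ioi (1 / 2)
  rw [show Real.pi / (1 / 2) = 2 * Real.pi by ring] at h
  rw [← h]
  congr 1
  ext s
  ring_nf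

lemma sqrt_two_pi_pos : 0 < √(2 * Real.pi) := Real.sqrt_pos.2 (by positivity)

/-- Trades the tail integral for one with a variable endpoint, to which the fundamental theorem of
calculus applies; `1 / 2` is the mass of the half-line. -/
lemma gaussQ_eq (x : ℝ) :
    gaussQ x = 1 / 2 - (1 / √(2 * Real.pi)) * ∫ s in (0 : ℝ)..x, Real.exp (-s ^ 2 / 2) := by
  have hi := integrable_exp_neg_sq_half
  have h := intervalIntegral.integral_Ioi_sub_Ioi' (a := 0) (b := x) (μ := MeasureTheory.volume)
    (f := fun s : ℝ => Real.exp (-s ^ 2 / 2)) hi.integrableOn hi.integrableOn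
  rw [integral_exp_neg_sq_half_Ioi] at h
  have h0 := sqrt_two_pi_pos
  rw [gaussQ, ← h]
  field_simp
  ring

lemma hasDerivAt_gaussQ (x : ℝ) :
    HasDerivAt gaussQ (-(1 / √(2 * Real.pi)) * Real.exp (-x ^ 2 / 2)) x := by
  have h : HasDerivAt (fun u => ∫ s in (0 : ℝ)..u, Real.exp (-s ^ 2 / 2)) (Real.exp (-x ^ 2 / 2)) x :=
    intervalIntegral.integral_hasDerivAt_right (continuous_exp_neg_sq_half.intervalIntegrable _ _)
      (continuous_exp_neg_sq_half.stronglyMeasurableAtFilter _ _)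
      continuous_exp_neg_sq_half.continuousAt
  have h2 := (h.const_mul (1 / √(2 * Real.pi))).const_sub (1 / 2)
  rw [show gaussQ = _ from funext gaussQ_eq]
  simpa using h2

lemma deriv_gaussQ : deriv gaussQ = fun x => -(1 / √(2 * Real.pi)) * Real.exp (-x ^ 2 / 2) :=
  funext fun x => (hasDerivAt_gaussQ x).deriv

lemma contDiff_gaussQ : ContDiff ℝ 2 gaussQ := by
  rw [show (2 : WithTop ℕ∞) = 1 + 1 by norm_num, contDiff_succ_iff_deriv]
  refine ⟨fun x => (hasDerivAt_gaussQ x).differentiableAt, by simp, ?_⟩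
  rw [deriv_gaussQ]
  fun_prop

lemma continuous_gaussQ : Continuous gaussQ := contDiff_gaussQ.continuous

lemma strictAnti_gaussQ : StrictAnti gaussQ := by
  refine strictAnti_of_deriv_neg fun x => ?_
  rw [deriv_gaussQ]
  have := sqrt_two_pi_pos
  have := Real.exp_pos (-x ^ 2 / 2)
  simp only [neg_mul, Left.neg_neg_iff]
  positivity

lemma gaussQ_zero : gaussQ 0 = 1 / 2 := by simp [gaussQ_eq]

lemma gaussQ_neg (x : ℝ) : gaussQ (-x) = 1 - gaussQ x := by
  have h : ∫ s in (0 : ℝ)..(-x), Real.exp (-s ^ 2 / 2) =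
      -∫ s in (0 : ℝ)..x, Real.exp (-s ^ 2 / 2) := by
    have h1 := intervalIntegral.integral_comp_neg (a := 0) (b := x)
      (f := fun s : ℝ => Real.exp (-s ^ 2 / 2))
    simp only [neg_zero, even_two.neg_pow] at h1
    rw [h1, intervalIntegral.integral_symm]
  rw [gaussQ_eq, gaussQ_eq, h]
  ring

lemma tendsto_gaussQ_atTop : Filter.Tendsto gaussQ Filter.atTop (nhds 0) := by
  have h := MeasureTheory.intervalIntegral_tendsto_integral_Ioi 0
    integrable_exp_neg_sq_half.integrableOn Filter.tendsto_id
  rw [integral_exp_neg_sq_half_Ioi] at h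
  have h2 := (h.const_mul (1 / √(2 * Real.pi))).const_sub (1 / 2)
  rw [show gaussQ = _ from funext gaussQ_eq]
  have e : (0 : ℝ) = 1 / 2 - 1 / √(2 * Real.pi) * (√(2 * Real.pi) / 2) := by
    have := sqrt_two_pi_pos
    field_simp
    norm_num
  have h3 := h2.trans (le_of_eq (congrArg nhds e.symm))
  exact h3

lemma gaussQ_pos (x : ℝ) : 0 < gaussQ x := by
  have h1 : gaussQ (x + 1) < gaussQ x := strictAnti_gaussQ (by linarith)
  have h2 : 0 ≤ gaussQ (x + 1) :=
    strictAnti_gaussQ.antitone.le_of_tendsto tendsto_gaussQ_atTop _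
  linarith

lemma gaussQ_lt_one (x : ℝ) : gaussQ x < 1 := by
  have := gaussQ_pos (-x)
  rw [gaussQ_neg] at this
  linarith

lemma exists_gaussQ_lt {y : ℝ} (hy : 0 < y) : ∃ a, gaussQ a < y :=
  (tendsto_gaussQ_atTop.eventually (gt_mem_nhds hy)).exists

lemma exists_gaussQ_eq {y : ℝ} (h0 : 0 < y) (h1 : y < 1) : ∃ a, gaussQ a = y := by
  obtain ⟨a, ha⟩ := exists_gaussQ_lt h0
  obtain ⟨b, hb⟩ := exists_gaussQ_lt (y := 1 - y) (by linarith)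
  have hb' : y < gaussQ (-b) := by rw [gaussQ_neg]; linarith
  exact mem_range_of_exists_le_of_exists_ge continuous_gaussQ ⟨a, ha.le⟩ ⟨-b, hb'.le⟩

lemma gaussQ_gaussQInv {y : ℝ} (h0 : 0 < y) (h1 : y < 1) : gaussQ (gaussQInv y) = y :=
  Function.invFun_eq (exists_gaussQ_eq h0 h1)

lemma gaussQInv_gaussQ (x : ℝ) : gaussQInv (gaussQ x) = x :=
  Function.leftInverse_invFun strictAnti_gaussQ.injective x

lemma gaussQInv_le_iff {y a : ℝ} (h0 : 0 < y) (h1 : y < 1) : gaussQInv y ≤ a ↔ gaussQ a ≤ y := by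
  conv_rhs => rw [← gaussQ_gaussQInv h0 h1]
  exact strictAnti_gaussQ.le_iff_ge.symm

/-- Inverse function theorem: the derivative of `gaussQ` never vanishes. Since `gaussQInv` is a
global left inverse, it agrees with the local inverse near the point. -/
lemma contDiffAt_gaussQInv {y : ℝ} (h0 : 0 < y) (h1 : y < 1) : ContDiffAt ℝ 2 gaussQInv y := by
  obtain ⟨a, rfl⟩ := exists_gaussQ_eq h0 h1
  have hne : -(1 / √(2 * Real.pi)) * Real.exp (-a ^ 2 / 2) ≠ 0 := by
    have := sqrt_two_pi_pos
    have := Real.exp_pos (-a ^ 2 / 2)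
    rw [neg_mul]
    refine neg_ne_zero.2 (ne_of_gt (by positivity))
  have hc : ContDiffAt ℝ 2 gaussQ a := contDiff_gaussQ.contDiffAt
  have hd := (hasDerivAt_gaussQ a).hasFDerivAt_equiv hne
  have h := hc.to_localInverse hd (by norm_num)
  refine h.congr_of_eventuallyEq ?_
  exact (hc.hasStrictFDerivAt' hd (by norm_num)).localInverse_unique
    (Filter.Eventually.of_forall gaussQInv_gaussQ)

/-- The derivative `-exp(-x²/2)/√(2π)` increases only on the right half-line; `convex_Y` stays there
because the false alarm rates are at most `1/2`. -/
lemma convexOn_gaussQ : ConvexOn ℝ (Set.Ici 0) gaussQ := by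
  refine MonotoneOn.convexOn_of_deriv (convex_Ici 0) continuous_gaussQ.continuousOn
    (contDiff_gaussQ.differentiable (by norm_num)).differentiableOn ?_
  intro x hx y hy hxy
  rw [interior_Ici, Set.mem_Ioi] at hx hy
  rw [deriv_gaussQ]
  have h0 : 0 < 1 / √(2 * Real.pi) := by have := sqrt_two_pi_pos; positivity
  have h1 : Real.exp (-y ^ 2 / 2) ≤ Real.exp (-x ^ 2 / 2) := by
    apply Real.exp_le_exp.2
    nlinarith
  simp only
  nlinarith

/-! ### Calculus along segments and rectangles -/

section Calculus

variable {E : Type*} [NormedAddCommGroup E] [NormedSpace ℝ E]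

lemma hasDerivAt_line (b d : E) (s : ℝ) : HasDerivAt (fun s : ℝ => b + s • d) d s := by
  simpa using ((hasDerivAt_id s).smul_const d).const_add b

lemma ContDiffAt.hasDerivAt_line {F : E → ℝ} {b d : E} {s : ℝ}
    (h : ContDiffAt ℝ 2 F (b + s • d)) :
    HasDerivAt (fun s : ℝ => F (b + s • d)) (fderiv ℝ F (b + s • d) d) s :=
  (h.differentiableAt (by norm_num)).hasFDerivAt.comp_hasDerivAt s (_root_.hasDerivAt_line b d s)

lemma ContDiffAt.hasDerivAt_fderiv_line {F : E → ℝ} {b d : E} (v : E) {s : ℝ}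
    (h : ContDiffAt ℝ 2 F (b + s • d)) :
    HasDerivAt (fun s : ℝ => fderiv ℝ F (b + s • d) v)
      (fderiv ℝ (fderiv ℝ F) (b + s • d) d v) s := by
  have h1 : ContDiffAt ℝ 1 (fderiv ℝ F) (b + s • d) := h.fderiv_right (by norm_num)
  have h2 := (h1.differentiableAt (by norm_num)).hasFDerivAt.comp_hasDerivAt s
    (_root_.hasDerivAt_line b d s)
  have h3 := h2.clm_apply (hasDerivAt_const s v)
  simpa using h3

/-- Second order lower bound from a lower bound on the second derivative. -/
lemma second_order_lower_bound {φ φ' φ'' : ℝ → ℝ} {m : ℝ}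
    (h1 : ∀ s ∈ Set.Icc (0 : ℝ) 1, HasDerivAt φ (φ' s) s)
    (h2 : ∀ s ∈ Set.Icc (0 : ℝ) 1, HasDerivAt φ' (φ'' s) s)
    (hm : ∀ s ∈ Set.Icc (0 : ℝ) 1, m ≤ φ'' s) : φ 0 + φ' 0 + m / 2 ≤ φ 1 := by
  have hmono : ∀ s ∈ Set.Icc (0 : ℝ) 1, φ' 0 + m * s ≤ φ' s := by
    intro s hs
    have hd : ∀ u ∈ Set.Icc (0 : ℝ) 1, HasDerivAt (fun u => φ' u - m * u) (φ'' u - m) u := by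
      intro u hu
      have e := (h2 u hu).sub ((hasDerivAt_id u).const_mul m)
      rw [mul_one] at e
      exact e
    have := monotoneOn_of_hasDerivWithinAt_nonneg (convex_Icc (0 : ℝ) 1)
      (fun u hu => (hd u hu).continuousAt.continuousWithinAt)
      (fun u hu => (hd u (interior_subset hu)).hasDerivWithinAt)
      (fun u hu => sub_nonneg.2 (hm u (interior_subset hu)))
      (Set.left_mem_Icc.2 zero_le_one) hs hs.1
    simp only [mul_zero, sub_zero] at this
    linarith
  have hd : ∀ u ∈ Set.Icc (0 : ℝ) 1, HasDerivAt (fun u => φ u - (φ' 0 * u + m / 2 * u ^ 2))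
      (φ' u - (φ' 0 + m * u)) u := by
    intro u hu
    have e := (h1 u hu).sub (((hasDerivAt_id u).const_mul (φ' 0)).add
      (((hasDerivAt_id u).pow 2).const_mul (m / 2)))
    have e' : φ' u - (φ' 0 + m * u) =
        φ' u - (φ' 0 * 1 + m / 2 * (((2 : ℕ) : ℝ) * id u ^ (2 - 1) * 1)) := by
      simp only [id_eq, Nat.cast_ofNat]
      ring
    rw [e']
    exact e
  have := monotoneOn_of_hasDerivWithinAt_nonneg (convex_Icc (0 : ℝ) 1)
    (fun u hu => (hd u hu).continuousAt.continuousWithinAt)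
    (fun u hu => (hd u (interior_subset hu)).hasDerivWithinAt)
    (fun u hu => sub_nonneg.2 (hmono u (interior_subset hu)))
    (Set.left_mem_Icc.2 zero_le_one) (Set.right_mem_Icc.2 zero_le_one) zero_le_one
  simp only [mul_zero, mul_one, one_pow] at this
  linarith

/-- Mean value theorem for the mixed second difference over a rectangle. -/
lemma exists_mixed_difference_eq {F : E → ℝ} {b U V : E}
    (h : ∀ s ∈ Set.Icc (0 : ℝ) 1, ∀ u ∈ Set.Icc (0 : ℝ) 1, ContDiffAt ℝ 2 F (b + s • U + u • V)) :
    ∃ s ∈ Set.Icc (0 : ℝ) 1, ∃ u ∈ Set.Icc (0 : ℝ) 1,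
      F (b + U + V) - F (b + V) - F (b + U) + F b =
        fderiv ℝ (fderiv ℝ F) (b + s • U + u • V) U V := by
  have m0 : (0 : ℝ) ∈ Set.Icc (0 : ℝ) 1 := by simp
  have m1 : (1 : ℝ) ∈ Set.Icc (0 : ℝ) 1 := by simp
  have hd : ∀ u ∈ Set.Icc (0 : ℝ) 1, HasDerivAt (fun u : ℝ => F (b + U + u • V) - F (b + u • V))
      (fderiv ℝ F (b + U + u • V) V - fderiv ℝ F (b + u • V) V) u := by
    intro u hu
    have e1 : ContDiffAt ℝ 2 F (b + U + u • V) := by simpa using h 1 m1 u hu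
    have e0 : ContDiffAt ℝ 2 F (b + u • V) := by simpa using h 0 m0 u hu
    exact e1.hasDerivAt_line.sub e0.hasDerivAt_line
  -- The mean value theorem is used first in `u`, for the difference of `F` across `U`, and then in
  -- `s`, for the derivative in direction `V` at the `u` just found.
  obtain ⟨u, hu, hue⟩ := exists_hasDerivAt_eq_slope _ _ (zero_lt_one' ℝ)
    (fun u hu => (hd u hu).continuousAt.continuousWithinAt)
    (fun u hu => hd u (Set.Ioo_subset_Icc_self hu))
  have hu' := Set.Ioo_subset_Icc_self hu
  have hc : ∀ s ∈ Set.Icc (0 : ℝ) 1, HasDerivAt (fun s : ℝ => fderiv ℝ F (b + u • V + s • U) V)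
      (fderiv ℝ (fderiv ℝ F) (b + u • V + s • U) U V) s := by
    intro s hs
    refine ContDiffAt.hasDerivAt_fderiv_line V ?_
    rw [add_right_comm]
    exact h s hs u hu'
  obtain ⟨s, hs, hse⟩ := exists_hasDerivAt_eq_slope _ _ (zero_lt_one' ℝ)
    (fun u hu => (hc u hu).continuousAt.continuousWithinAt)
    (fun u hu => hc u (Set.Ioo_subset_Icc_self hu))
  refine ⟨s, Set.Ioo_subset_Icc_self hs, u, hu', ?_⟩
  rw [add_right_comm b (s • U), hse]
  simp only [one_smul, zero_smul, add_zero, sub_zero, div_one] at hue ⊢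
  rw [add_right_comm b (u • V) U, hue]
  ring

/-- A pair of linear functionals on a convex set, the first nonnegative where the second is
negative, has a multiplier. -/
lemma exists_multiplier {C : Set E} (hC : Convex ℝ C) (F g : E →ₗ[ℝ] ℝ)
    (h : ∀ z ∈ C, g z < 0 → 0 ≤ F z) {z₀ : E} (hz₀ : z₀ ∈ C) (hg : g z₀ < 0) :
    ∃ l, 0 ≤ l ∧ l ≤ F z₀ / -g z₀ ∧ ∀ z ∈ C, 0 ≤ F z + l * g z := by
  set S : Set ℝ := {a | ∃ z ∈ C, g z < 0 ∧ a = F z / -g z} with hS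
  have hbdd : BddBelow S := ⟨0, by
    rintro a ⟨z, hz, hgz, rfl⟩
    exact div_nonneg (h z hz hgz) (by linarith)⟩
  have hne : S.Nonempty := ⟨_, z₀, hz₀, hg, rfl⟩
  have hcross : ∀ z ∈ C, 0 ≤ g z → ∀ z₁ ∈ C, g z₁ < 0 → 0 ≤ -g z₁ * F z + g z * F z₁ := by
    intro z hz hgz z₁ hz₁ hgz₁
    -- With weights proportional to `-g z₁` at `z` and `g z + e` at `z₁`, the functional `g` takes a
    -- negative value proportional to `e * g z₁`, so `h` applies. Then `e` tends to `0`.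
    have hlim : ∀ e : ℝ, 0 < e → 0 ≤ -g z₁ * F z + (g z + e) * F z₁ := by
      intro e he
      have hpos : 0 < -g z₁ + (g z + e) := by linarith
      have hmem := hC hz hz₁ (a := -g z₁ / (-g z₁ + (g z + e)))
        (b := (g z + e) / (-g z₁ + (g z + e)))
        (div_nonneg (by linarith) hpos.le) (div_nonneg (by linarith) hpos.le)
        (by field_simp)
      have h1 := h _ hmem
      simp only [map_add, map_smul, smul_eq_mul] at h1
      have h2 := h1 (by
        have : -g z₁ / (-g z₁ + (g z + e)) * g z + (g z + e) / (-g z₁ + (g z + e)) * g z₁ =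
          e * g z₁ / (-g z₁ + (g z + e)) := by
            field_simp
            ring
        rw [this]
        exact div_neg_of_neg_of_pos (mul_neg_of_pos_of_neg he hgz₁) hpos)
      have h3 : -g z₁ / (-g z₁ + (g z + e)) * F z + (g z + e) / (-g z₁ + (g z + e)) * F z₁ =
        (-g z₁ * F z + (g z + e) * F z₁) / (-g z₁ + (g z + e)) := by
          field_simp
      rw [h3] at h2
      by_contra hcon
      exact absurd h2 (not_le.2 (div_neg_of_neg_of_pos (not_le.1 hcon) hpos))
    have ht : Filter.Tendsto (fun e : ℝ => -g z₁ * F z + (g z + e) * F z₁)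
        (nhdsWithin 0 (Set.Ioi 0)) (nhds (-g z₁ * F z + (g z + 0) * F z₁)) := by
      apply Filter.Tendsto.mono_left _ nhdsWithin_le_nhds
      apply Continuous.tendsto
      fun_prop
    rw [add_zero] at ht
    exact ge_of_tendsto ht (eventually_nhdsWithin_of_forall hlim)
  -- The infimum is the largest multiplier allowed by the points with `g z < 0`; `hcross` shows that
  -- it is large enough for the points with `g z > 0`.
  refine ⟨sInf S, Real.sInf_nonneg ?_, csInf_le hbdd ⟨z₀, hz₀, hg, rfl⟩, fun z hz => ?_⟩
  · rintro a ⟨z, hz, hgz, rfl⟩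
    exact div_nonneg (h z hz hgz) (by linarith)
  · rcases lt_or_ge (g z) 0 with hgz | hgz
    · have h1 : sInf S ≤ F z / -g z := csInf_le hbdd ⟨z, hz, hgz, rfl⟩
      rw [le_div_iff₀ (by linarith)] at h1
      linarith
    · rcases hgz.eq_or_lt with h0 | h0
      · have := hcross z hz hgz z₀ hz₀ hg
        rw [← h0] at this ⊢
        simp only [zero_mul, add_zero, mul_zero] at this ⊢
        exact nonneg_of_mul_nonneg_right this (by linarith)
      · have : -F z / g z ≤ sInf S := by
          refine le_csInf hne ?_
          rintro a ⟨z₁, hz₁, hg₁, rfl⟩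
          have := hcross z hz hgz z₁ hz₁ hg₁
          rw [div_le_div_iff₀ h0 (by linarith)]
          linarith
        rw [div_le_iff₀ h0] at this
        linarith

end Calculus

/-! ### Quadratic forms -/

/-- Euclidean norm of a coordinate vector. -/
def eNorm {n : Type*} [Fintype n] (v : n → ℝ) : ℝ := √(v ⬝ᵥ v)

section

variable {n m : Type*} [Fintype n] [Fintype m]

lemma eNorm_nonneg (v : n → ℝ) : 0 ≤ eNorm v := Real.sqrt_nonneg _

lemma eNorm_sq (v : n → ℝ) : eNorm v ^ 2 = v ⬝ᵥ v :=
  Real.sq_sqrt (Finset.sum_nonneg fun i _ => mul_self_nonneg (v i))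

lemma eNorm_eq_norm (v : n → ℝ) : eNorm v = ‖WithLp.toLp 2 v‖ := by
  rw [EuclideanSpace.norm_eq, eNorm]
  congr 1
  exact Finset.sum_congr rfl fun i _ => by simp [sq]

lemma eNorm_neg (v : n → ℝ) : eNorm (-v) = eNorm v := by simp [eNorm]

lemma abs_dotProduct_mulVec_le [DecidableEq n] (A : Matrix m n ℝ) (u : m → ℝ) (v : n → ℝ) :
    |u ⬝ᵥ A.mulVec v| ≤ specNorm A * eNorm u * eNorm v := by
  have h1 := A.l2_opNorm_mulVec (WithLp.toLp 2 v)
  have h2 := abs_real_inner_le_norm (WithLp.toLp 2 (A.mulVec v)) (WithLp.toLp 2 u)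
  have h3 : inner ℝ (WithLp.toLp 2 (A.mulVec v)) (WithLp.toLp 2 u) = u ⬝ᵥ A.mulVec v := by
    simp [EuclideanSpace.inner_eq_star_dotProduct]
  rw [h3, ← eNorm_eq_norm u] at h2
  rw [← eNorm_eq_norm v] at h1
  calc _ ≤ _ := h2
    _ ≤ (specNorm A * eNorm v) * eNorm u := by
      refine mul_le_mul_of_nonneg_right ?_ (eNorm_nonneg u)
      exact h1
    _ = _ := by ring

lemma specNorm_nonneg [DecidableEq n] (A : Matrix m n ℝ) : 0 ≤ specNorm A := norm_nonneg _

lemma specNorm_transpose [DecidableEq n] [DecidableEq m] (A : Matrix m n ℝ) : specNorm A.transpose = specNorm A := by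
  rw [← Matrix.conjTranspose_eq_transpose_of_trivial]
  exact Matrix.l2_opNorm_conjTranspose A

lemma le_specNorm_diagonal [DecidableEq n] (v : n → ℝ) (i : n) : |v i| ≤ specNorm (Matrix.diagonal v) := by
  rw [specNorm, Matrix.l2_opNorm_diagonal]
  exact norm_le_pi_norm v i

/-- Subtracting the least eigenvalue times the identity shifts the spectrum into `[0, ∞)`, so the
difference is positive semidefinite. -/
lemma leastEig_mul_le [DecidableEq n] {A : Matrix n n ℝ} (hA : A.IsSymm) (v : n → ℝ) :
    leastEig A * (v ⬝ᵥ v) ≤ v ⬝ᵥ A.mulVec v := by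
  have hH : A.IsHermitian := by
    rw [Matrix.IsHermitian, Matrix.conjTranspose_eq_transpose_of_trivial]; exact hA
  have hB : (A - algebraMap ℝ (Matrix n n ℝ) (leastEig A)).PosSemidef := by
    rw [Matrix.posSemidef_iff_isHermitian_and_spectrum_nonneg]
    refine ⟨hH.sub ?_, ?_⟩
    · rw [Matrix.IsHermitian, Matrix.conjTranspose_eq_transpose_of_trivial,
        Matrix.algebraMap_eq_diagonal, Matrix.diagonal_transpose]
    · intro a ha
      have : a + leastEig A ∈ spectrum ℝ A := by
        have := spectrum.add_mem_iff (s := leastEig A) (r := a) (a := A)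
        rw [this, neg_add_eq_sub]
        exact ha
      have hle : leastEig A ≤ a + leastEig A :=
        csInf_le (A.finite_real_spectrum.bddBelow) this
      simp only [Set.mem_ofPred_eq]
      linarith
  have h := hB.dotProduct_mulVec_nonneg v
  simp only [star_trivial, Matrix.sub_mulVec, dotProduct_sub, Matrix.algebraMap_eq_diagonal] at h
  have e : v ⬝ᵥ (Matrix.diagonal (algebraMap ℝ (n → ℝ) (leastEig A))).mulVec v =
      leastEig A * (v ⬝ᵥ v) := by
    simp only [dotProduct, Matrix.mulVec_diagonal, Finset.mul_sum]
    refine Finset.sum_congr rfl fun i _ => ?_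
    simp
    ring
  rw [e] at h
  linarith

end

/-- Lower bound of a quadratic form by the least eigenvalue of the `2 × 2` comparison matrix of the
splitting into the first and the remaining coordinates. -/
lemma leastEig_block_le {n : ℕ} {h : Matrix (Fin (n + 1)) (Fin (n + 1)) ℝ} (hs : h.IsSymm)
    (v : Fin (n + 1) → ℝ) :
    leastEig !![h 0 0, -specNorm (h.submatrix (fun _ : Fin 1 => 0) Fin.succ);
      -specNorm (h.submatrix Fin.succ (fun _ : Fin 1 => 0)),
      leastEig (h.submatrix Fin.succ Fin.succ)] * (v 0 ^ 2 + eNorm (fun i : Fin n => v i.succ) ^ 2)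
      ≤ v ⬝ᵥ h.mulVec v := by
  set w : Fin n → ℝ := fun i => v i.succ with hw
  set R := h.submatrix (fun _ : Fin 1 => 0) Fin.succ with hR
  set C := h.submatrix Fin.succ (fun _ : Fin 1 => 0) with hC
  set S := h.submatrix Fin.succ Fin.succ with hS
  -- By symmetry the two off-diagonal blocks have the same norm. This makes the `2 × 2` comparison
  -- matrix symmetric, and it can be tested on the vector of the norms of the two parts of `v`.
  have hCR : C = R.transpose := by
    ext i j
    exact hs.apply _ _
  have hSs : S.IsSymm := by
    ext i j
    exact hs.apply _ _
  set B : Matrix (Fin 2) (Fin 2) ℝ := !![h 0 0, -specNorm R; -specNorm C, leastEig S] with hB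
  have hBs : B.IsSymm := by
    ext i j
    rw [hB, hCR, specNorm_transpose]
    fin_cases i <;> fin_cases j <;> rfl
  have h1 := leastEig_mul_le hBs ![|v 0|, eNorm w]
  have e1 : ![|v 0|, eNorm w] ⬝ᵥ ![|v 0|, eNorm w] = v 0 ^ 2 + eNorm w ^ 2 := by
    simp [dotProduct, Fin.sum_univ_two, sq]
  have e2 : ![|v 0|, eNorm w] ⬝ᵥ B.mulVec ![|v 0|, eNorm w] =
      h 0 0 * v 0 ^ 2 - 2 * specNorm R * |v 0| * eNorm w + leastEig S * eNorm w ^ 2 := by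
    rw [hB, hCR, specNorm_transpose, ← sq_abs (v 0)]
    simp only [dotProduct, Fin.sum_univ_two, Matrix.mulVec, Matrix.of_apply, Matrix.cons_val_zero,
      Matrix.cons_val_one, Matrix.cons_val', Matrix.cons_val_fin_one]
    ring
  rw [e1, e2] at h1
  refine h1.trans ?_
  have h2 := abs_dotProduct_mulVec_le R (fun _ => v 0) w
  have h3 := leastEig_mul_le hSs w
  rw [← eNorm_sq] at h3
  have e3 : eNorm (fun _ : Fin 1 => v 0) = |v 0| := by
    simp [eNorm, dotProduct, Real.sqrt_mul_self_eq_abs]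
  rw [e3] at h2
  have h4 := (abs_le.1 h2).1
  have e4 : v ⬝ᵥ h.mulVec v =
      h 0 0 * v 0 ^ 2 + 2 * ((fun _ : Fin 1 => v 0) ⬝ᵥ R.mulVec w) + w ⬝ᵥ S.mulVec w := by
    simp only [dotProduct, Matrix.mulVec, Fin.sum_univ_succ, hR, hS, hw, Matrix.submatrix_apply,
      Finset.univ_eq_empty, Finset.sum_empty, add_zero, mul_add, Finset.sum_add_distrib]
    have e5 : ∑ i : Fin n, v i.succ * (h i.succ 0 * v 0) = v 0 * ∑ i : Fin n, h 0 i.succ * v i.succ := by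
      rw [Finset.mul_sum]
      refine Finset.sum_congr rfl fun i _ => ?_
      rw [hs.apply 0 i.succ]
      ring
    rw [e5]
    ring
  rw [e4]
  nlinarith

/-! ### P-matrices with nonpositive off-diagonal entries -/

/-- Subtracting multiples of row `0` clears the rest of column `0` and leaves the Schur complement
as the remaining block. -/
lemma Matrix.det_eq_mul_det_schur {n : ℕ} (M : Matrix (Fin (n + 1)) (Fin (n + 1)) ℝ)
    (h : M 0 0 ≠ 0) :
    M.det = M 0 0 * (Matrix.of fun i j : Fin n =>
      M i.succ j.succ - M i.succ 0 * M 0 j.succ / M 0 0).det := by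
  set B : Matrix (Fin (n + 1)) (Fin (n + 1)) ℝ := Matrix.of fun i j =>
    M i j - (if i = 0 then 0 else M i 0 / M 0 0) * M 0 j with hB
  have h1 : M.det = B.det := by
    refine Matrix.det_eq_of_forall_row_eq_smul_add_const
      (fun i => if i = 0 then 0 else M i 0 / M 0 0) 0 (by simp) fun i j => ?_
    simp [hB]
  rw [h1, Matrix.det_succ_column_zero, Fin.sum_univ_succ]
  have h2 : ∀ i : Fin n, B i.succ 0 = 0 := by
    intro i
    simp [hB, Fin.succ_ne_zero]
    field_simp
    ring
  simp only [h2, Fin.val_zero, pow_zero, one_mul, mul_zero, zero_mul, Finset.sum_const_zero,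
    add_zero]
  congr 1
  · simp [hB]
  · congr 1
    ext i j
    simp [hB, Fin.succ_ne_zero]
    ring

/-- Induction through the Schur complement of the entry `A 0 0`. It keeps nonpositive off-diagonal
entries, and each of its principal minors times `A 0 0` is a principal minor of `A` containing the
index `0`. Indexing minors by injections `Fin m → Fin n` lets one prepend that index. -/
lemma exists_pos_mulVec_pos_of_minors_pos : ∀ {n : ℕ} (A : Matrix (Fin n) (Fin n) ℝ),
    (∀ i j, i ≠ j → A i j ≤ 0) →
    (∀ (m : ℕ) (f : Fin m → Fin n), Function.Injective f → 0 < (A.submatrix f f).det) →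
    ∃ v : Fin n → ℝ, (∀ i, 0 < v i) ∧ ∀ i, 0 < ∑ j, A i j * v j
  | 0, _, _, _ => ⟨0, fun i => i.elim0, fun i => i.elim0⟩
  | n + 1, A, hZ, hP => by
    have hA0 : 0 < A 0 0 := by
      have := hP 1 (fun _ => 0) (Function.injective_of_subsingleton _)
      simpa using this
    set S : Matrix (Fin n) (Fin n) ℝ := Matrix.of fun i j =>
      A i.succ j.succ - A i.succ 0 * A 0 j.succ / A 0 0 with hS
    obtain ⟨v, hv, hSv⟩ := exists_pos_mulVec_pos_of_minors_pos S
      (by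
        intro i j hij
        have h1 := hZ i.succ j.succ (fun h => hij (Fin.succ_injective _ h))
        have h2 := mul_nonneg_of_nonpos_of_nonpos (hZ i.succ 0 (Fin.succ_ne_zero i))
          (hZ 0 j.succ (Fin.succ_ne_zero j).symm)
        have h3 := div_nonneg h2 hA0.le
        simp only [hS, Matrix.of_apply]
        linarith)
      (by
        intro m f hf
        have h1 := hP (m + 1) (Fin.cons 0 fun i => (f i).succ) (by
          rw [Fin.cons_injective_iff]
          refine ⟨?_, (Fin.succ_injective n).comp hf⟩
          rintro ⟨i, hi⟩
          exact Fin.succ_ne_zero _ hi)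
        rw [Matrix.det_eq_mul_det_schur _ (by simpa using hA0.ne')] at h1
        simp only [Matrix.submatrix_apply, Fin.cons_zero, Fin.cons_succ] at h1
        exact pos_of_mul_pos_right h1 hA0.le)
    have hev : ∀ i : Fin n, ∀ᶠ e : ℝ in nhdsWithin 0 (Set.Ioi 0),
        0 < ∑ j, S i j * v j + A i.succ 0 * e := by
      intro i
      refine Filter.Eventually.filter_mono nhdsWithin_le_nhds ?_
      have : ContinuousAt (fun e : ℝ => ∑ j, S i j * v j + A i.succ 0 * e) 0 := by fun_prop
      exact this.eventually (lt_mem_nhds (by simpa using hSv i))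
    obtain ⟨e, he, he0⟩ := ((Filter.eventually_all.2 hev).and self_mem_nhdsWithin).exists
    replace he0 : 0 < e := he0
    -- With `e = 0` this choice would make row `0` vanish. The perturbation makes that row equal to
    -- `A 0 0 * e` and changes row `i` of `S v` by `A i.succ 0 * e`, which is harmless for small
    -- `e`.
    set v0 : ℝ := e - (∑ j, A 0 j.succ * v j) / A 0 0 with hv0
    have hsum : ∑ j, A 0 j.succ * v j ≤ 0 := Finset.sum_nonpos fun j _ =>
      mul_nonpos_of_nonpos_of_nonneg (hZ 0 j.succ (Fin.succ_ne_zero j).symm) (hv j).le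
    refine ⟨Fin.cons v0 v, fun i => ?_, fun i => ?_⟩
    · refine Fin.cases ?_ (fun i => ?_) i
      · have := div_nonpos_of_nonpos_of_nonneg hsum hA0.le
        simp only [Fin.cons_zero, hv0]
        linarith
      · simpa using hv i
    · rw [Fin.sum_univ_succ]
      simp only [Fin.cons_zero, Fin.cons_succ]
      refine Fin.cases ?_ (fun i => ?_) i
      · have : A 0 0 * v0 + ∑ j, A 0 j.succ * v j = A 0 0 * e := by
          rw [hv0]
          field_simp
          ring
        rw [this]
        positivity
      · have h1 := he i
        have : A i.succ 0 * v0 + ∑ j, A i.succ j.succ * v j =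
            ∑ j, S i j * v j + A i.succ 0 * e := by
          simp only [hS, Matrix.of_apply, sub_mul, Finset.sum_sub_distrib, hv0]
          have : ∑ j, A i.succ 0 * A 0 j.succ / A 0 0 * v j =
              A i.succ 0 * ((∑ j, A 0 j.succ * v j) / A 0 0) := by
            rw [Finset.sum_div, Finset.mul_sum]
            refine Finset.sum_congr rfl fun j _ => ?_
            ring
          rw [this]
          ring
        rw [this]
        exact h1

lemma IsPMatrix.exists_pos_mulVec_pos {n : ℕ} {A : Matrix (Fin n) (Fin n) ℝ} (hA : IsPMatrix A)
    (hZ : ∀ i j, i ≠ j → A i j ≤ 0) :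
    ∃ v : Fin n → ℝ, (∀ i, 0 < v i) ∧ ∀ i, 0 < ∑ j, A i j * v j := by
  refine exists_pos_mulVec_pos_of_minors_pos A hZ fun m f hf => ?_
  rcases Nat.eq_zero_or_pos m with rfl | hm
  · simp
  · have : Nonempty (Fin m) := ⟨⟨0, hm⟩⟩
    have h := hA (Finset.univ.image f) (Finset.univ_nonempty.image f)
    let e : Fin m ≃ (Finset.univ.image f : Finset (Fin n)) :=
      Equiv.ofBijective (fun i => ⟨f i, by simp⟩) ⟨fun i j hij => hf (by simpa using hij), by
        rintro ⟨j, hj⟩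
        obtain ⟨i, -, rfl⟩ := Finset.mem_image.1 hj
        exact ⟨i, rfl⟩⟩
    rw [← Matrix.det_submatrix_equiv_self e] at h
    exact h

/-! ### Coordinates of strategies -/

namespace Strat

variable {N : ℕ}

/-- The strategy with prescribed sensing time, powers and false alarm rate. -/
def ofParts (a : ℝ) (p : Fin N → ℝ) (e : ℝ) : Strat N :=
  Fin.cons (α := fun _ => ℝ) a (Fin.snoc (α := fun _ => ℝ) p e)

@[simp] lemma tau_ofParts (a : ℝ) (p : Fin N → ℝ) (e : ℝ) : (ofParts a p e).tau = a := rfl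

@[simp] lemma pow_ofParts (a : ℝ) (p : Fin N → ℝ) (e : ℝ) : (ofParts a p e).pow = p := by
  ext k
  simp [pow, ofParts, pIdx]

@[simp] lemma pfa_ofParts (a : ℝ) (p : Fin N → ℝ) (e : ℝ) : (ofParts a p e).pfa = e := by
  simp [pfa, ofParts, ← Fin.succ_last]

lemma forall_coord {P : Fin (N + 2) → Prop} :
    (∀ i, P i) ↔ P 0 ∧ (∀ k, P (pIdx k)) ∧ P (Fin.last (N + 1)) := by
  refine ⟨fun h => ⟨h _, fun _ => h _, h _⟩, fun ⟨h0, h1, h2⟩ i => ?_⟩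
  refine Fin.cases h0 (fun j => ?_) i
  refine Fin.lastCases ?_ (fun k => h1 k) j
  rw [Fin.succ_last]
  exact h2

lemma sum_coord (g : Fin (N + 2) → ℝ) :
    ∑ i, g i = g 0 + (∑ k, g (pIdx k) + g (Fin.last (N + 1))) := by
  rw [Fin.sum_univ_succ, Fin.sum_univ_castSucc, Fin.succ_last]
  rfl

lemma ext_parts {y z : Strat N} (h0 : y.tau = z.tau) (h1 : y.pow = z.pow) (h2 : y.pfa = z.pfa) :
    y = z :=
  funext (forall_coord.2 ⟨h0, fun k => congrFun h1 k, h2⟩)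

@[simp] lemma tau_add (y z : Strat N) : (y + z).tau = y.tau + z.tau := rfl
@[simp] lemma pow_add (y z : Strat N) : (y + z).pow = y.pow + z.pow := rfl
@[simp] lemma pfa_add (y z : Strat N) : (y + z).pfa = y.pfa + z.pfa := rfl
@[simp] lemma tau_sub (y z : Strat N) : (y - z).tau = y.tau - z.tau := rfl
@[simp] lemma pow_sub (y z : Strat N) : (y - z).pow = y.pow - z.pow := rfl
@[simp] lemma pfa_sub (y z : Strat N) : (y - z).pfa = y.pfa - z.pfa := rfl
@[simp] lemma tau_smul (s : ℝ) (y : Strat N) : (s • y).tau = s * y.tau := rfl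
@[simp] lemma pow_smul (s : ℝ) (y : Strat N) : (s • y).pow = s • y.pow := rfl
@[simp] lemma pfa_smul (s : ℝ) (y : Strat N) : (s • y).pfa = s * y.pfa := rfl

lemma continuous_tau : Continuous (tau : Strat N → ℝ) := continuous_apply _
lemma continuous_pow (k : Fin N) : Continuous fun y : Strat N => y.pow k := continuous_apply _
lemma continuous_pfa : Continuous (pfa : Strat N → ℝ) := continuous_apply _

end Strat

lemma update_add_smul_single {Q N : ℕ} (x : Profile Q N) (q : Fin Q) (y d : Strat N) (s : ℝ) :
    Function.update x q (y + s • d) =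
      Function.update x q y + s • (Pi.single q d : Profile Q N) := by
  ext r i
  rcases eq_or_ne r q with rfl | h
  · simp
  · simp [h]

namespace CRGame

variable {Q N : ℕ} (G : CRGame Q N)

/-! ### The sets `𝒴_q` -/

lemma nnoise_pos (q : Fin Q) (k : Fin N) : 0 < G.nnoise q k :=
  div_pos (G.noise_pos q k) (pow_pos (norm_pos_iff.2 (G.H_self_ne q k)) 2)

lemma gain_nonneg (q r : Fin Q) (k : Fin N) : 0 ≤ G.gain q r k := sq_nonneg _

/-- The least argument of `𝒬` compatible with the detection constraint at sensing time `a`. -/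
def faArg (q : Fin Q) (k : Fin N) (a : ℝ) : ℝ :=
  (G.sd1 q k * G.alphaHat q k + (G.mu1 q k - G.mu0 q k) * a) / G.sd0 q k

lemma detArg_le_iff {q : Fin Q} {k : Fin N} {y : Strat N} (h0 : 0 < y.pfa) (h1 : y.pfa < 1) :
    G.detArg q k y ≤ G.alphaHat q k ↔ gaussQ (G.faArg q k y.tau) ≤ y.pfa := by
  rw [← gaussQInv_le_iff h0 h1, detArg, faArg, le_div_iff₀ (G.sd0_pos q k)]
  have := G.sd1_pos q k
  rw [show G.sd0 q k / G.sd1 q k * gaussQInv y.pfa - y.tau * ((G.mu1 q k - G.mu0 q k) / G.sd1 q k) =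
    (G.sd0 q k * gaussQInv y.pfa - y.tau * (G.mu1 q k - G.mu0 q k)) / G.sd1 q k by ring,
    div_le_iff₀ this]
  constructor <;> intro h <;> linarith

/-- Removes `gaussQInv` from the constraints. The strict inequality `0 < y.pfa` disappears too,
since the detection constraint of any subcarrier implies it; this is what makes `Y q` closed. -/
lemma mem_Y_iff {q : Fin Q} {y : Strat N} : y ∈ G.Y q ↔
    y.pfa ≤ G.beta q ∧ (∀ k, gaussQ (G.faArg q k y.tau) ≤ y.pfa) ∧ y.pow ∈ G.powerSet q ∧
      √(G.tauMin q * G.f q) ≤ y.tau ∧ y.tau ≤ √(G.tauMax q * G.f q) := by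
  have hb := G.beta_le q
  constructor
  · rintro ⟨h0, h1, h2, h3⟩
    exact ⟨h1, fun k => (G.detArg_le_iff h0 (by linarith)).1 (h2 k), h3⟩
  · rintro ⟨h1, h2, h3⟩
    have h0 : 0 < y.pfa := (gaussQ_pos _).trans_le (h2 ⟨0, G.N_pos⟩)
    exact ⟨h0, h1, fun k => (G.detArg_le_iff h0 (by linarith)).2 (h2 k), h3⟩

variable {G} in
lemma pfa_pos_of_mem {q : Fin Q} {y : Strat N} (hy : y ∈ G.Y q) : 0 < y.pfa := hy.1

variable {G} in
lemma pfa_lt_one_of_mem {q : Fin Q} {y : Strat N} (hy : y ∈ G.Y q) : y.pfa < 1 := by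
  have := G.beta_le q
  have := hy.2.1
  linarith

variable {G} in
lemma pow_nonneg_of_mem {q : Fin Q} {y : Strat N} (hy : y ∈ G.Y q) (k : Fin N) : 0 ≤ y.pow k :=
  (hy.2.2.2.1.2 k).1

variable {G} in
lemma pow_le_of_mem {q : Fin Q} {y : Strat N} (hy : y ∈ G.Y q) (k : Fin N) :
    y.pow k ≤ G.pmax q k := (hy.2.2.2.1.2 k).2

variable {G} in
lemma tau_nonneg_of_mem {q : Fin Q} {y : Strat N} (hy : y ∈ G.Y q) : 0 ≤ y.tau :=
  (Real.sqrt_nonneg _).trans hy.2.2.2.2.1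

variable {G} in
lemma timeFactor_pos {q : Fin Q} {y : Strat N} (hy : y ∈ G.Y q) :
    0 < 1 - y.tau ^ 2 / (G.f q * G.T q) := by
  have hf := G.f_pos q
  have h1 := G.tauMin_pos q
  have h2 := G.tauMin_lt_tauMax q
  have h3 := G.tauMax_lt_T q
  have h4 : y.tau ^ 2 ≤ G.tauMax q * G.f q :=
    (Real.le_sqrt (tau_nonneg_of_mem hy) (by nlinarith)).1 hy.2.2.2.2.2
  have : 0 < G.f q * G.T q := mul_pos hf (by linarith)
  rw [sub_pos, div_lt_one this]
  nlinarith

variable {G} in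
lemma ofParts_mem_Y {q : Fin Q} {y : Strat N} (hy : y ∈ G.Y q) {p : Fin N → ℝ}
    (hp : p ∈ G.powerSet q) : Strat.ofParts y.tau p y.pfa ∈ G.Y q := by
  rw [mem_Y_iff] at hy ⊢
  simp only [Strat.tau_ofParts, Strat.pow_ofParts, Strat.pfa_ofParts]
  exact ⟨hy.1, hy.2.1, hp, hy.2.2.2⟩

lemma convex_powerSet (q : Fin Q) : Convex ℝ (G.powerSet q) := by
  intro p hp p' hp' a b ha hb hab
  refine ⟨?_, fun k => ⟨?_, ?_⟩⟩
  · simp only [Pi.add_apply, Pi.smul_apply, smul_eq_mul, Finset.sum_add_distrib, ← Finset.mul_sum]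
    calc _ ≤ a * G.budget q + b * G.budget q :=
          add_le_add (mul_le_mul_of_nonneg_left hp.1 ha) (mul_le_mul_of_nonneg_left hp'.1 hb)
      _ = G.budget q := by rw [← add_mul, hab, one_mul]
  · exact add_nonneg (mul_nonneg ha (hp.2 k).1) (mul_nonneg hb (hp'.2 k).1)
  · simp only [Pi.add_apply, Pi.smul_apply, smul_eq_mul]
    calc _ ≤ a * G.pmax q k + b * G.pmax q k :=
          add_le_add (mul_le_mul_of_nonneg_left (hp.2 k).2 ha)
            (mul_le_mul_of_nonneg_left (hp'.2 k).2 hb)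
      _ = G.pmax q k := by rw [← add_mul, hab, one_mul]

lemma zero_mem_powerSet (q : Fin Q) : (0 : Fin N → ℝ) ∈ G.powerSet q :=
  ⟨by simpa using (G.budget_pos q).le, fun k => ⟨le_rfl, (G.pmax_pos q k).le⟩⟩

/-- The detection constraint is an epigraph condition for `gaussQ` composed with an affine function
of the sensing time. Its arguments are nonnegative, because the value of `gaussQ` there is at most
`beta ≤ 1/2`, so `convexOn_gaussQ` applies. -/
lemma convex_Y (q : Fin Q) : Convex ℝ (G.Y q) := by
  intro y hy z hz a b ha hb hab
  have hp := G.convex_powerSet q hy.2.2.2.1 hz.2.2.2.1 ha hb hab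
  rw [mem_Y_iff] at hy hz ⊢
  have hβ := G.beta_le q
  have hmid : ∀ {u v w : ℝ}, u ≤ w → v ≤ w → a * u + b * v ≤ w := by
    intro u v w hu hv
    calc _ ≤ a * w + b * w :=
          add_le_add (mul_le_mul_of_nonneg_left hu ha) (mul_le_mul_of_nonneg_left hv hb)
      _ = w := by rw [← add_mul, hab, one_mul]
  have hmid' : ∀ {u v w : ℝ}, w ≤ u → w ≤ v → w ≤ a * u + b * v := by
    intro u v w hu hv
    calc w = a * w + b * w := by rw [← add_mul, hab, one_mul]
      _ ≤ _ := add_le_add (mul_le_mul_of_nonneg_left hu ha) (mul_le_mul_of_nonneg_left hv hb)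
  have harg : ∀ {u : ℝ}, gaussQ u ≤ 1 / 2 → u ∈ Set.Ici (0 : ℝ) := by
    intro u hu
    rw [← gaussQ_zero] at hu
    exact strictAnti_gaussQ.le_iff_ge.1 hu
  refine ⟨?_, fun k => ?_, hp, ?_, ?_⟩
  · exact hmid hy.1 hz.1
  · have h1 := convexOn_gaussQ.2 (harg ((hy.2.1 k).trans (hy.1.trans hβ)))
      (harg ((hz.2.1 k).trans (hz.1.trans hβ))) ha hb hab
    have e : G.faArg q k (a • y + b • z).tau =
        a • G.faArg q k y.tau + b • G.faArg q k z.tau := by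
      simp only [faArg, Strat.tau_add, Strat.tau_smul, smul_eq_mul]
      rw [← mul_div_assoc, ← mul_div_assoc, ← add_div]
      congr 1
      linear_combination -(G.sd1 q k * G.alphaHat q k) * hab
    rw [e]
    refine h1.trans ?_
    exact add_le_add (mul_le_mul_of_nonneg_left (hy.2.1 k) ha)
      (mul_le_mul_of_nonneg_left (hz.2.1 k) hb)
  · exact hmid' hy.2.2.2.1 hz.2.2.2.1
  · exact hmid hy.2.2.2.2 hz.2.2.2.2

lemma isClosed_Y (q : Fin Q) : IsClosed (G.Y q) := by
  have e : G.Y q = {y | y.pfa ≤ G.beta q} ∩ ((⋂ k, {y | gaussQ (G.faArg q k y.tau) ≤ y.pfa}) ∩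
      (({y | ∑ k, y.pow k ≤ G.budget q} ∩ ⋂ k, ({y | 0 ≤ y.pow k} ∩ {y | y.pow k ≤ G.pmax q k})) ∩
      ({y | √(G.tauMin q * G.f q) ≤ y.tau} ∩ {y | y.tau ≤ √(G.tauMax q * G.f q)}))) := by
    ext y
    rw [mem_Y_iff]
    simp [powerSet]
  rw [e]
  have h0 := Strat.continuous_tau (N := N)
  have h1 := Strat.continuous_pow (N := N)
  have h2 := Strat.continuous_pfa (N := N)
  have h3 : ∀ k, Continuous fun y : Strat N => gaussQ (G.faArg q k y.tau) := fun k => by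
    refine continuous_gaussQ.comp ?_
    simp only [faArg]
    fun_prop
  refine (isClosed_le h2 continuous_const).inter ((isClosed_iInter fun k => isClosed_le (h3 k) h2).inter
    (IsClosed.inter (IsClosed.inter (isClosed_le (continuous_finsetSum _ fun k _ => h1 k) continuous_const)
      (isClosed_iInter fun k => (isClosed_le continuous_const (h1 k)).inter
        (isClosed_le (h1 k) continuous_const))) ((isClosed_le continuous_const h0).inter
          (isClosed_le h0 continuous_const))))

lemma isCompact_Y (q : Fin Q) : IsCompact (G.Y q) := by
  have hs : 0 ≤ ∑ k, G.pmax q k := Finset.sum_nonneg fun k _ => (G.pmax_pos q k).le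
  -- One upper bound for all coordinates: the three summands bound the sensing time, the powers and
  -- the false alarm rate.
  refine IsCompact.of_isClosed_subset (s := Set.Icc (0 : Strat N)
    (fun _ => √(G.tauMax q * G.f q) + ∑ k, G.pmax q k + 1)) isCompact_Icc (G.isClosed_Y q) ?_
  intro y hy
  have ht := Real.sqrt_nonneg (G.tauMax q * G.f q)
  refine ⟨Strat.forall_coord.2 ⟨tau_nonneg_of_mem hy, pow_nonneg_of_mem hy, (pfa_pos_of_mem hy).le⟩,
    Strat.forall_coord.2 ⟨?_, fun k => ?_, ?_⟩⟩
  · have : y 0 ≤ _ := hy.2.2.2.2.2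
    linarith
  · have h1 : y (pIdx k) ≤ _ := pow_le_of_mem hy k
    have h2 := Finset.single_le_sum (f := fun k => G.pmax q k) (fun k _ => (G.pmax_pos q k).le)
      (Finset.mem_univ k)
    linarith
  · have : y (Fin.last (N + 1)) < _ := pfa_lt_one_of_mem hy
    linarith

/-! ### Missed detection and interference -/

variable {G} in
lemma pmiss_nonneg (q : Fin Q) (k : Fin N) (y : Strat N) : 0 ≤ G.pmiss q k y :=
  sub_nonneg.2 (gaussQ_lt_one _).le

variable {G} in
lemma pmiss_le_half {q : Fin Q} {y : Strat N} (hy : y ∈ G.Y q) (k : Fin N) :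
    G.pmiss q k y ≤ 1 / 2 := by
  have h1 : gaussQ (G.alphaHat q k) ≤ gaussQ (G.detArg q k y) :=
    strictAnti_gaussQ.antitone (hy.2.2.1 k)
  have h2 := G.alpha_pos q k
  have h3 := G.alpha_le q k
  rw [alphaHat, gaussQ_gaussQInv (by linarith) (by linarith)] at h1
  rw [pmiss]
  linarith

lemma detArg_congr {q : Fin Q} {k : Fin N} {y z : Strat N} (h0 : y.tau = z.tau)
    (h2 : y.pfa = z.pfa) : G.detArg q k y = G.detArg q k z := by
  rw [detArg, detArg, h0, h2]

lemma pmiss_ofParts (q : Fin Q) (k : Fin N) (y : Strat N) (p : Fin N → ℝ) :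
    G.pmiss q k (Strat.ofParts y.tau p y.pfa) = G.pmiss q k y := by
  rw [pmiss, pmiss, G.detArg_congr (z := y) (by simp) (by simp)]

/-- The global interference is a sum of terms each depending on one user only. Hence a unilateral
change alters it by an amount independent of the other users, and the price causes no coupling
between best responses. -/
lemma globI_update_sub (q : Fin Q) (x : Profile Q N) (y z : Strat N) :
    G.globI (Function.update x q z) - G.globI (Function.update x q y) =
      G.locI q z - G.locI q y := by
  have h : ∀ z, G.globI (Function.update x q z) = (∑ k, G.pmiss q k z * G.w q k * z.pow k) +
      ((∑ k, ∑ r ∈ Finset.univ.erase q, G.pmiss r k (x r) * G.w r k * (x r).pow k) - G.globLim) := by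
    intro z
    rw [globI, ← add_sub_assoc, ← Finset.sum_add_distrib]
    congr 1
    refine Finset.sum_congr rfl fun k _ => ?_
    rw [← Finset.add_sum_erase _ _ (Finset.mem_univ q)]
    congr 1
    · simp
    · refine Finset.sum_congr rfl fun r hr => ?_
      simp [Finset.ne_of_mem_erase hr]
  rw [h, h, locI, locI]
  ring

/-! ### Rates -/

/-- Noise plus interference at the receiver of user `q`. -/
def intf (q : Fin Q) (k : Fin N) (x : Profile Q N) : ℝ :=
  G.nnoise q k + ∑ r ∈ Finset.univ.erase q, G.gain q r k * (x r).pow k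

/-- Sum rate of user `q` with powers `p` against the interference of the others. -/
def sumRate (q : Fin Q) (x : Profile Q N) (p : Fin N → ℝ) : ℝ :=
  ∑ k, Real.log (1 + p k / G.intf q k x)

lemma intf_congr {q : Fin Q} {k : Fin N} {x x' : Profile Q N}
    (h : ∀ r, r ≠ q → (x r).pow = (x' r).pow) : G.intf q k x = G.intf q k x' := by
  rw [intf, intf]
  congr 1
  refine Finset.sum_congr rfl fun r hr => ?_
  rw [h r (Finset.ne_of_mem_erase hr)]

lemma sumRate_congr {q : Fin Q} {x x' : Profile Q N} (p : Fin N → ℝ)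
    (h : ∀ r, r ≠ q → (x r).pow = (x' r).pow) : G.sumRate q x p = G.sumRate q x' p := by
  rw [sumRate, sumRate]
  exact Finset.sum_congr rfl fun k _ => by rw [G.intf_congr h]

lemma throughput_eq (q : Fin Q) (x : Profile Q N) :
    G.throughput q x = (1 - (x q).tau ^ 2 / (G.f q * G.T q)) *
      ((1 - (x q).pfa) * G.sumRate q x (x q).pow) := by
  rw [throughput, ← Finset.mul_sum]
  rfl

lemma throughput_update (q : Fin Q) (x : Profile Q N) (y : Strat N) :
    G.throughput q (Function.update x q y) = (1 - y.tau ^ 2 / (G.f q * G.T q)) *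
      ((1 - y.pfa) * G.sumRate q x y.pow) := by
  rw [throughput_eq, G.sumRate_congr (x' := x) _ (fun r hr => by simp [hr])]
  simp

variable {G} {q : Fin Q} {x : Profile Q N}

lemma nnoise_le_intf (hx : ∀ r, r ≠ q → x r ∈ G.Y r) (k : Fin N) :
    G.nnoise q k ≤ G.intf q k x :=
  le_add_of_nonneg_right (Finset.sum_nonneg fun r hr =>
    mul_nonneg (G.gain_nonneg q r k) (pow_nonneg_of_mem (hx r (Finset.ne_of_mem_erase hr)) k))

lemma intf_pos (hx : ∀ r, r ≠ q → x r ∈ G.Y r) (k : Fin N) : 0 < G.intf q k x :=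
  (G.nnoise_pos q k).trans_le (nnoise_le_intf hx k)

lemma log_rate_nonneg (hx : ∀ r, r ≠ q → x r ∈ G.Y r) {p : Fin N → ℝ} (hp : ∀ k, 0 ≤ p k)
    (k : Fin N) : 0 ≤ Real.log (1 + p k / G.intf q k x) :=
  Real.log_nonneg (le_add_of_nonneg_right (div_nonneg (hp k) (intf_pos hx k).le))

lemma sumRate_nonneg (hx : ∀ r, r ≠ q → x r ∈ G.Y r) {p : Fin N → ℝ} (hp : ∀ k, 0 ≤ p k) :
    0 ≤ G.sumRate q x p :=
  Finset.sum_nonneg fun k _ => log_rate_nonneg hx hp k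

lemma sumRate_pos (hx : ∀ r, r ≠ q → x r ∈ G.Y r) {p : Fin N → ℝ} (hp : ∀ k, 0 ≤ p k)
    (h : 0 < ∑ k, p k) : 0 < G.sumRate q x p := by
  obtain ⟨k, -, hk⟩ := Finset.exists_ne_zero_of_sum_ne_zero h.ne'
  refine Finset.sum_pos' (fun k _ => log_rate_nonneg hx hp k) ⟨k, Finset.mem_univ k, ?_⟩
  exact Real.log_pos (lt_add_of_pos_right _ (div_pos ((hp k).lt_of_ne' hk) (intf_pos hx k)))

/-- From `log (1 + u) ≤ u`; this turns a lower bound on the rate into the lower bound on the total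
power that defines `Yhat`. -/
lemma sumRate_le (hx : ∀ r, r ≠ q → x r ∈ G.Y r) {p : Fin N → ℝ} (hp : ∀ k, 0 ≤ p k) :
    (⨅ k, G.nnoise q k) * G.sumRate q x p ≤ ∑ k, p k := by
  rw [sumRate, Finset.mul_sum]
  refine Finset.sum_le_sum fun k _ => ?_
  have h0 := intf_pos hx k
  have h1 : Real.log (1 + p k / G.intf q k x) ≤ p k / G.intf q k x := by
    have := Real.log_le_sub_one_of_pos (x := 1 + p k / G.intf q k x)
      (by have := div_nonneg (hp k) h0.le; linarith)
    linarith
  have h2 : ⨅ k, G.nnoise q k ≤ G.intf q k x :=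
    (ciInf_le (Set.finite_range _).bddBelow k).trans (nnoise_le_intf hx k)
  calc _ ≤ G.intf q k x * (p k / G.intf q k x) :=
        mul_le_mul h2 h1 (log_rate_nonneg hx hp k) h0.le
    _ = p k := by field_simp

lemma le_sumRate (hx : ∀ r, r ≠ q → x r ∈ G.Y r) {p : Fin N → ℝ} (hp : ∀ k, 0 ≤ p k) :
    ∑ k, G.rate q k (Function.update G.pmax q p) ≤ G.sumRate q x p := by
  refine Finset.sum_le_sum fun k _ => ?_
  have h0 := intf_pos hx k
  have h1 : G.intf q k x ≤ G.nnoise q k +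
      ∑ r ∈ Finset.univ.erase q, G.gain q r k * Function.update G.pmax q p r k := by
    refine add_le_add_right (Finset.sum_le_sum fun r hr => ?_) _
    have hr' := Finset.ne_of_mem_erase hr
    rw [Function.update_of_ne hr']
    exact mul_le_mul_of_nonneg_left (pow_le_of_mem (hx r hr') k) (G.gain_nonneg q r k)
  rw [rate, Function.update_self]
  have h2 := div_nonneg (hp k) (h0.trans_le h1).le
  exact Real.log_le_log (by linarith)
    (add_le_add_right (div_le_div_of_nonneg_left (hp k) h0 h1) _)

/-- Concavity of the logarithm along the ray to zero power, in the form of Bernoulli's inequality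
`(1 + u) ^ a ≤ 1 + a * u`. -/
lemma le_sumRate_smul (hx : ∀ r, r ≠ q → x r ∈ G.Y r) {p : Fin N → ℝ} (hp : ∀ k, 0 ≤ p k) {a : ℝ}
    (h0 : 0 ≤ a) (h1 : a ≤ 1) : a * G.sumRate q x p ≤ G.sumRate q x (a • p) := by
  rw [sumRate, sumRate, Finset.mul_sum]
  refine Finset.sum_le_sum fun k _ => ?_
  have hd := div_nonneg (hp k) (intf_pos hx k).le
  have h := rpow_one_add_le_one_add_mul_self (s := p k / G.intf q k x) (by linarith) h0 h1
  have hpos : 0 < 1 + p k / G.intf q k x := by linarith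
  rw [← Real.log_rpow hpos]
  refine (Real.log_le_log (Real.rpow_pos_of_pos hpos _) h).trans (le_of_eq ?_)
  rw [Pi.smul_apply, smul_eq_mul, mul_div_assoc]

lemma throughput_pos_iff {y : Strat N} (hy : y ∈ G.Y q) :
    0 < G.throughput q (Function.update x q y) ↔ 0 < G.sumRate q x y.pow := by
  have h1 := timeFactor_pos hy
  have h2 : 0 < 1 - y.pfa := sub_pos.2 (pfa_lt_one_of_mem hy)
  rw [throughput_update, mul_pos_iff_of_pos_left h1, mul_pos_iff_of_pos_left h2]

/-! ### The payoff -/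

variable (G) in
/-- Deviation of the sensing time of user `q` from the average. -/
def dev (q : Fin Q) : Profile Q N →L[ℝ] ℝ :=
  (1 / √(G.f q)) • (ContinuousLinearMap.proj (R := ℝ) (φ := fun _ : Fin (N + 2) => ℝ) 0 ∘L
      ContinuousLinearMap.proj (R := ℝ) (φ := fun _ : Fin Q => Strat N) q) -
    (1 / (Q : ℝ)) • ∑ r, (1 / √(G.f r)) •
      (ContinuousLinearMap.proj (R := ℝ) (φ := fun _ : Fin (N + 2) => ℝ) 0 ∘L
        ContinuousLinearMap.proj (R := ℝ) (φ := fun _ : Fin Q => Strat N) r)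

lemma dev_apply (q : Fin Q) (x : Profile Q N) :
    G.dev q x = (x q).tau / √(G.f q) - 1 / (Q : ℝ) * ∑ r, (x r).tau / √(G.f r) := by
  simp [dev, Strat.tau, div_eq_inv_mul]

lemma theta_eq (c : ℝ) (q : Fin Q) (x : Profile Q N) :
    G.theta c q x = G.theta 0 q x - c / 2 * G.dev q x ^ 2 := by
  rw [dev_apply, theta, theta]
  ring

lemma theta_zero (q : Fin Q) (x : Profile Q N) :
    G.theta 0 q x = Real.log (G.throughput q x) := by
  rw [theta]
  ring

lemma theta_zero_update {y : Strat N} (hy : y ∈ G.Y q)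
    (h : 0 < G.sumRate q x y.pow) :
    G.theta 0 q (Function.update x q y) = Real.log (1 - y.tau ^ 2 / (G.f q * G.T q)) +
      (Real.log (1 - y.pfa) + Real.log (G.sumRate q x y.pow)) := by
  have h1 := timeFactor_pos hy
  have h2 : 0 < 1 - y.pfa := sub_pos.2 (pfa_lt_one_of_mem hy)
  rw [theta_zero, throughput_update, Real.log_mul h1.ne' (by positivity), Real.log_mul h2.ne' h.ne']

/-! ### Smoothness -/

lemma contDiffAt_throughput (hx : ∀ r, x r ∈ G.Y r) : ContDiffAt ℝ 2 (G.throughput q) x := by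
  have h : ∀ k, ContDiffAt ℝ 2 (fun x : Profile Q N => G.rate q k fun r => (x r).pow) x := by
    intro k
    have h1 := intf_pos (G := G) (q := q) (fun r _ => hx r) k
    have h2 := div_nonneg (pow_nonneg_of_mem (hx q) k) h1.le
    simp only [rate, Strat.pow] at *
    refine ContDiffAt.log ?_ (by simp only [intf, Strat.pow] at h2; linarith)
    refine contDiffAt_const.add (ContDiffAt.div (by fun_prop) (by fun_prop) ?_)
    exact h1.ne'
  unfold throughput
  simp only [Strat.tau, Strat.pfa]
  fun_prop

lemma contDiffAt_theta_zero (hx : ∀ r, x r ∈ G.Y r) (ht : 0 < G.throughput q x) :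
    ContDiffAt ℝ 2 (G.theta 0 q) x := by
  rw [show G.theta 0 q = fun x => Real.log (G.throughput q x) from funext fun x => theta_zero q x]
  exact (contDiffAt_throughput hx).log ht.ne'

lemma contDiff_penalty (c : ℝ) : ContDiff ℝ 2 fun x => c / 2 * G.dev q x ^ 2 := by fun_prop

lemma contDiffAt_theta (c : ℝ) (hx : ∀ r, x r ∈ G.Y r) (ht : 0 < G.throughput q x) :
    ContDiffAt ℝ 2 (G.theta c q) x := by
  rw [show G.theta c q = _ from funext fun x => theta_eq c q x]
  exact (contDiffAt_theta_zero hx ht).sub (contDiff_penalty c).contDiffAt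

lemma contDiffAt_pmiss (hx : x q ∈ G.Y q) (k : Fin N) :
    ContDiffAt ℝ 2 (fun x : Profile Q N => G.pmiss q k (x q)) x := by
  have h : ContDiffAt ℝ 2 (fun x : Profile Q N => gaussQInv (x q).pfa) x := by
    have e : ContDiffAt ℝ 2 (fun x : Profile Q N => (x q).pfa) x := by
      simp only [Strat.pfa]
      fun_prop
    exact (contDiffAt_gaussQInv (pfa_pos_of_mem hx) (pfa_lt_one_of_mem hx)).comp x e
  simp only [pmiss, detArg, Strat.tau]
  refine contDiffAt_const.sub (contDiff_gaussQ.contDiffAt.comp x ?_)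
  fun_prop

lemma contDiffAt_locI (hx : x q ∈ G.Y q) :
    ContDiffAt ℝ 2 (fun x : Profile Q N => G.locI q (x q)) x := by
  have h := contDiffAt_pmiss hx
  simp only [locI, Strat.pow]
  fun_prop

lemma contDiffAt_globI (hx : ∀ r, x r ∈ G.Y r) : ContDiffAt ℝ 2 G.globI x := by
  have h := fun r => contDiffAt_pmiss (hx r)
  unfold globI
  simp only [Strat.pow]
  fun_prop

lemma contDiffAt_lagr (c lam price : ℝ) (hx : ∀ r, x r ∈ G.Y r) (ht : 0 < G.throughput q x) :
    ContDiffAt ℝ 2 (G.lagr c q lam price) x := by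
  have h1 := contDiffAt_theta c hx ht
  have h2 := contDiffAt_locI (hx q)
  have h3 := contDiffAt_globI hx
  unfold lagr
  fun_prop

end CRGame

/-! ### One-sided comparison of derivatives. -/

lemma HasDerivAt.eventually_lt_right {φ : ℝ → ℝ} {a : ℝ} (h : HasDerivAt φ a 0) (ha : a < 0) :
    ∀ᶠ s in nhdsWithin 0 (Set.Ioi 0), φ s < φ 0 := by
  have h1 := (hasDerivAt_iff_tendsto_slope.1 h).mono_left
    (nhdsWithin_mono 0 (fun s (hs : (0 : ℝ) < s) => hs.ne'))
  filter_upwards [h1.eventually (gt_mem_nhds ha), self_mem_nhdsWithin] with s hs hs0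
  replace hs0 : 0 < s := hs0
  rw [slope_def_field, sub_zero] at hs
  have := (div_neg_iff.1 hs).resolve_left (fun h => absurd h.2 (not_lt.2 hs0.le))
  linarith [this.1]

lemma HasDerivAt.le_of_eventually_le_right {φ χ : ℝ → ℝ} {a b : ℝ} (h : HasDerivAt φ a 0)
    (h' : HasDerivAt χ b 0) (h0 : φ 0 = χ 0) (hle : ∀ᶠ s in nhdsWithin 0 (Set.Ioi 0), φ s ≤ χ s) :
    a ≤ b := by
  by_contra hab
  have h1 := (h'.sub h).eventually_lt_right (by linarith)
  obtain ⟨s, hs1, hs2⟩ := (h1.and hle).exists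
  simp only [Pi.sub_apply] at hs1
  linarith

namespace CRGame

variable {Q N : ℕ} {G : CRGame Q N} {q : Fin Q} {x : Profile Q N} {c price t : ℝ}
  {pref : Fin Q → Fin N → ℝ}

lemma update_mem_Y (hx : ∀ r, r ≠ q → x r ∈ G.Y r) {y : Strat N} (hy : y ∈ G.Y q) (r : Fin Q) :
    Function.update x q y r ∈ G.Y r := by
  rcases eq_or_ne r q with rfl | h
  · simpa using hy
  · simpa [h] using hx r h

lemma dev_update_congr (x : Profile Q N) {y z : Strat N} (h : y.tau = z.tau) :
    G.dev q (Function.update x q y) = G.dev q (Function.update x q z) := by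
  have : ∀ r, (Function.update x q y r).tau = (Function.update x q z r).tau := by
    intro r
    rcases eq_or_ne r q with rfl | hr
    · simpa using h
    · simp [hr]
  simp only [dev_apply, this]

/-! ### Existence and size of best responses -/

/-- Missed detection has probability at most `1/2` on `Y q`, so the bound `2 * locLim` on the
weighted reference power suffices for the local constraint, whatever the sensing parameters are. -/
lemma ref_mem_X (hpref : G.IsRefPower pref) {y : Strat N} (hy : y ∈ G.Y q) :
    Strat.ofParts y.tau (pref q) y.pfa ∈ G.X q := by
  refine ⟨ofParts_mem_Y hy (hpref q).1, ?_⟩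
  rw [locI]
  have h : ∀ k, G.pmiss q k (Strat.ofParts y.tau (pref q) y.pfa) * G.w q k * pref q k ≤
      1 / 2 * (G.w q k * pref q k) := by
    intro k
    rw [pmiss_ofParts, mul_assoc]
    exact mul_le_mul_of_nonneg_right (pmiss_le_half hy k)
      (mul_nonneg (G.w_pos q k).le ((hpref q).1.2 k).1)
  have h1 := Finset.sum_le_sum fun k (_ : k ∈ Finset.univ) => h k
  rw [← Finset.mul_sum] at h1
  have h2 := (hpref q).2.2
  rw [Strat.pow_ofParts]
  linarith

lemma sum_ref_pos (hpref : G.IsRefPower pref) (q : Fin Q) : 0 < ∑ k, pref q k := by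
  obtain ⟨h1, h2, -⟩ := hpref q
  refine (Finset.sum_nonneg fun k _ => (h1.2 k).1).lt_of_ne' fun h => h2 ?_
  rw [Finset.sum_eq_zero_iff_of_nonneg fun k _ => (h1.2 k).1] at h
  exact funext fun k => h k (Finset.mem_univ k)

lemma sumRate_ref_pos (hpref : G.IsRefPower pref) (hx : ∀ r, r ≠ q → x r ∈ G.Y r) :
    0 < G.sumRate q x (pref q) :=
  sumRate_pos hx (fun k => ((hpref q).1.2 k).1) (sum_ref_pos hpref q)

lemma throughput_ref_pos (hpref : G.IsRefPower pref) (hx : ∀ r, r ≠ q → x r ∈ G.Y r)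
    {y : Strat N} (hy : y ∈ G.Y q) :
    0 < G.throughput q (Function.update x q (Strat.ofParts y.tau (pref q) y.pfa)) := by
  rw [throughput_pos_iff (ofParts_mem_Y hy (hpref q).1), Strat.pow_ofParts]
  exact sumRate_ref_pos hpref hx

lemma IsBestResponse.throughput_pos (hpref : G.IsRefPower pref) (hx : ∀ r, r ≠ q → x r ∈ G.Y r)
    {y : Strat N} (hy : G.IsBestResponse c price q x y) :
    0 < G.throughput q (Function.update x q y) := by
  have h := hy.2 _ (ref_mem_X hpref hy.1.1)
  by_contra hcon
  rw [objective, objective, if_pos (throughput_ref_pos hpref hx hy.1.1), if_neg hcon] at h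
  exact EReal.coe_ne_bot _ (le_bot_iff.1 h)

lemma IsBestResponse.payoff_le (hpref : G.IsRefPower pref) (hx : ∀ r, r ≠ q → x r ∈ G.Y r)
    {y : Strat N} (hy : G.IsBestResponse c price q x y) {z : Strat N} (hz : z ∈ G.X q)
    (hzt : 0 < G.throughput q (Function.update x q z)) :
    G.theta c q (Function.update x q z) - price * G.globI (Function.update x q z) ≤
      G.theta c q (Function.update x q y) - price * G.globI (Function.update x q y) := by
  have h := hy.2 z hz
  rw [objective, objective, if_pos hzt, if_pos (hy.throughput_pos hpref hx)] at h
  exact_mod_cast h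

lemma continuousOn_update {F : Profile Q N → ℝ} {S : Set (Strat N)}
    (h : ∀ z ∈ S, ContinuousAt F (Function.update x q z)) :
    ContinuousOn (fun z => F (Function.update x q z)) S := fun z hz =>
  (ContinuousAt.comp (f := fun z => Function.update x q z) (h z hz)
    (continuous_const.update q continuous_id).continuousAt).continuousWithinAt

lemma isCompact_X (q : Fin Q) : IsCompact (G.X q) := by
  have h : ContinuousOn (G.locI q) (G.Y q) := by
    have := continuousOn_update (x := (fun _ => 0 : Profile Q N)) (q := q) (S := G.Y q)
      (F := fun x => G.locI q (x q))
      (fun z hz => (contDiffAt_locI (by simpa using hz)).continuousAt)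
    simpa using this
  have h2 := h.preimage_isClosed_of_isClosed (G.isClosed_Y q) (isClosed_Iic (a := (0 : ℝ)))
  exact (G.isCompact_Y q).of_isClosed_subset h2 fun y hy => hy.1

/-- The objective takes the value `-∞`, but its exponential `V` is continuous on the compact set `X
q` and vanishes with the throughput. A maximizer of `V` maximizes the objective. -/
lemma exists_isBestResponse (c price : ℝ) (hpref : G.IsRefPower pref)
    (hx : ∀ r, r ≠ q → x r ∈ G.Y r) (hY : (G.Y q).Nonempty) :
    ∃ y, G.IsBestResponse c price q x y := by
  set V : Strat N → ℝ := fun z => G.throughput q (Function.update x q z) *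
    Real.exp (-(c / 2 * G.dev q (Function.update x q z) ^ 2) -
      price * G.globI (Function.update x q z)) with hV
  have hcont : ContinuousOn V (G.X q) := by
    have h : ∀ z ∈ G.X q, ∀ r, Function.update x q z r ∈ G.Y r := fun z hz => update_mem_Y hx hz.1
    refine (continuousOn_update fun z hz => (contDiffAt_throughput (h z hz)).continuousAt).mul
      (Real.continuous_exp.comp_continuousOn (ContinuousOn.sub (ContinuousOn.neg
        (continuousOn_update fun z _ => (contDiff_penalty (G := G) (q := q) c).continuous.continuousAt))
        (continuousOn_const.mul (continuousOn_update fun z hz =>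
          (contDiffAt_globI (h z hz)).continuousAt))))
  obtain ⟨y₀, hy₀⟩ := hY
  obtain ⟨y, hy, hmax⟩ := (isCompact_X (G := G) q).exists_isMaxOn ⟨_, ref_mem_X hpref hy₀⟩ hcont
  have hval : ∀ z, 0 < G.throughput q (Function.update x q z) →
      G.theta c q (Function.update x q z) - price * G.globI (Function.update x q z) =
        Real.log (V z) := by
    intro z hz
    rw [hV, Real.log_mul hz.ne' (Real.exp_pos _).ne', Real.log_exp, theta_eq, theta_zero]
    ring
  refine ⟨y, hy, fun z hz => ?_⟩
  by_cases hzt : 0 < G.throughput q (Function.update x q z)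
  · have hVz : 0 < V z := mul_pos hzt (Real.exp_pos _)
    have hle : V z ≤ V y := hmax hz
    have hyt : 0 < G.throughput q (Function.update x q y) :=
      pos_of_mul_pos_left (hVz.trans_le hle) (Real.exp_pos _).le
    rw [objective, objective, if_pos hzt, if_pos hyt, hval z hzt, hval y hyt]
    exact_mod_cast Real.log_le_log hVz hle
  · rw [objective, if_neg hzt]
    exact bot_le

lemma iInf_nnoise_pos (q : Fin Q) : 0 < ⨅ k, G.nnoise q k := by
  have : Nonempty (Fin N) := ⟨⟨0, G.N_pos⟩⟩
  obtain ⟨k, hk⟩ := exists_eq_ciInf_of_finite (f := fun k => G.nnoise q k)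
  rw [← hk]
  exact G.nnoise_pos q k

lemma pfaRef_mem (q : Fin Q) : 0 < G.pfaRef q ∧ G.pfaRef q < 1 := by
  have : Nonempty (Fin N) := ⟨⟨0, G.N_pos⟩⟩
  obtain ⟨k, hk⟩ := exists_eq_ciSup_of_finite (f := fun k => gaussQ ((G.sd1 q k * G.alphaHat q k +
    (G.mu1 q k - G.mu0 q k) * √(G.f q * G.tauMin q)) / G.sd0 q k))
  rw [pfaRef, ← hk]
  exact ⟨gaussQ_pos _, gaussQ_lt_one _⟩

/-- The first two logarithms in `etaRef` are nonpositive and can be dropped; the rate in the third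
is computed against the largest possible interference. -/
lemma etaRef_le (hpref : G.IsRefPower pref) (hx : ∀ r, r ≠ q → x r ∈ G.Y r) :
    G.etaRef pref t q ≤ Real.log (G.sumRate q x (pref q)) -
      t / 2 * ∑ k, G.w q k * pref q k := by
  have h1 : Real.log (1 - G.tauMin q / G.T q) ≤ 0 := by
    have h1 := G.tauMin_pos q
    have h2 := G.tauMin_lt_tauMax q
    have h3 := G.tauMax_lt_T q
    have h4 : 0 < G.tauMin q / G.T q := div_pos h1 (by linarith)
    have h5 : G.tauMin q / G.T q < 1 := (div_lt_one (by linarith)).2 (by linarith)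
    exact Real.log_nonpos (by linarith) (by linarith)
  have h2 : Real.log (1 - G.pfaRef q) ≤ 0 := by
    have := pfaRef_mem (G := G) q
    exact Real.log_nonpos (by linarith) (by linarith)
  have hp : ∀ k, 0 ≤ pref q k := fun k => ((hpref q).1.2 k).1
  have h3 : Real.log (∑ k, G.rate q k (Function.update G.pmax q (pref q))) ≤
      Real.log (G.sumRate q x (pref q)) := by
    refine Real.log_le_log ?_ (le_sumRate hx hp)
    obtain ⟨k, -, hk⟩ := Finset.exists_ne_zero_of_sum_ne_zero (sum_ref_pos hpref q).ne'
    have hden : ∀ k, 0 < G.nnoise q k +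
        ∑ r ∈ Finset.univ.erase q, G.gain q r k * Function.update G.pmax q (pref q) r k := by
      intro k
      refine add_pos_of_pos_of_nonneg (G.nnoise_pos q k) (Finset.sum_nonneg fun r hr => ?_)
      rw [Function.update_of_ne (Finset.ne_of_mem_erase hr)]
      exact mul_nonneg (G.gain_nonneg q r k) (G.pmax_pos r k).le
    refine Finset.sum_pos' (fun k _ => ?_) ⟨k, Finset.mem_univ k, ?_⟩
    · rw [rate, Function.update_self]
      exact Real.log_nonneg (le_add_of_nonneg_right (div_nonneg (hp k) (hden k).le))
    · rw [rate, Function.update_self]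
      exact Real.log_pos (lt_add_of_pos_right _ (div_pos ((hp k).lt_of_ne' hk) (hden k)))
  rw [etaRef]
  linarith

/-- Compare with the strategy that keeps the sensing time and false alarm rate and uses the
reference powers: the time factor, the false alarm factor and the penalty cancel, leaving only the
log rates and the price term. The latter costs at most `t / 2 * ∑ k, G.w q k * pref q k`. -/
lemma IsBestResponse.mem_Yhat (hpref : G.IsRefPower pref) (hprice : 0 ≤ price) (hpt : price ≤ t)
    (hx : ∀ r, r ≠ q → x r ∈ G.Y r) {y : Strat N} (hy : G.IsBestResponse c price q x y) :
    y ∈ G.Yhat pref t q := by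
  have hyY := hy.1.1
  refine ⟨hyY, ?_⟩
  set z := Strat.ofParts y.tau (pref q) y.pfa with hz
  have hzY : z ∈ G.Y q := ofParts_mem_Y hyY (hpref q).1
  have hyt := hy.throughput_pos hpref hx
  have hle := hy.payoff_le hpref hx (ref_mem_X hpref hyY) (throughput_ref_pos hpref hx hyY)
  rw [← hz] at hle
  have hys := (throughput_pos_iff hyY).1 hyt
  have hzs : 0 < G.sumRate q x z.pow := by
    rw [hz, Strat.pow_ofParts]
    exact sumRate_ref_pos hpref hx
  have hglob := G.globI_update_sub q x y z
  rw [theta_eq, theta_eq c q (Function.update x q y), dev_update_congr x (y := z) (z := y) (by simp [hz]),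
    theta_zero_update hyY hys, theta_zero_update hzY hzs] at hle
  simp only [hz, Strat.tau_ofParts, Strat.pow_ofParts, Strat.pfa_ofParts] at hle hglob
  have hη := etaRef_le (t := t) hpref hx
  have hdiff : price * (G.locI q (Strat.ofParts y.tau (pref q) y.pfa) - G.locI q y) ≤
      t / 2 * ∑ k, G.w q k * pref q k := by
    have h1 : G.locI q (Strat.ofParts y.tau (pref q) y.pfa) - G.locI q y ≤
        1 / 2 * ∑ k, G.w q k * pref q k := by
      rw [locI, locI]
      have h2 : 0 ≤ ∑ k, G.pmiss q k y * G.w q k * y.pow k := Finset.sum_nonneg fun k _ =>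
        mul_nonneg (mul_nonneg (pmiss_nonneg q k y) (G.w_pos q k).le) (pow_nonneg_of_mem hyY k)
      have h3 : ∑ k, G.pmiss q k (Strat.ofParts y.tau (pref q) y.pfa) * G.w q k *
          (Strat.ofParts y.tau (pref q) y.pfa).pow k ≤ 1 / 2 * ∑ k, G.w q k * pref q k := by
        rw [Finset.mul_sum]
        refine Finset.sum_le_sum fun k _ => ?_
        rw [pmiss_ofParts, Strat.pow_ofParts, mul_assoc]
        exact mul_le_mul_of_nonneg_right (pmiss_le_half hyY k)
          (mul_nonneg (G.w_pos q k).le ((hpref q).1.2 k).1)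
      linarith
    have h4 : 0 ≤ ∑ k, G.w q k * pref q k := Finset.sum_nonneg fun k _ =>
      mul_nonneg (G.w_pos q k).le ((hpref q).1.2 k).1
    calc _ ≤ price * (1 / 2 * ∑ k, G.w q k * pref q k) := mul_le_mul_of_nonneg_left h1 hprice
      _ ≤ t * (1 / 2 * ∑ k, G.w q k * pref q k) := mul_le_mul_of_nonneg_right hpt (by positivity)
      _ = _ := by ring
  have hmain : G.etaRef pref t q ≤ Real.log (G.sumRate q x y.pow) := by
    rw [← hglob] at hdiff
    linarith
  have hexp := (Real.le_log_iff_exp_le hys).1 hmain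
  calc _ ≤ (⨅ k, G.nnoise q k) * G.sumRate q x y.pow :=
        mul_le_mul_of_nonneg_left hexp (iInf_nnoise_pos q).le
    _ ≤ _ := sumRate_le hx (pow_nonneg_of_mem hyY)

/-! ### The sets `𝒴̂_q` -/

lemma sum_pow_pos_of_mem_Yhat {y : Strat N} (hy : y ∈ G.Yhat pref t q) : 0 < ∑ k, y.pow k :=
  (mul_pos (iInf_nnoise_pos q) (Real.exp_pos _)).trans_le hy.2

lemma throughput_pos_of_mem_Yhat (hx : ∀ r, r ≠ q → x r ∈ G.Y r) {y : Strat N}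
    (hy : y ∈ G.Yhat pref t q) : 0 < G.throughput q (Function.update x q y) :=
  (throughput_pos_iff hy.1).2
    (sumRate_pos hx (pow_nonneg_of_mem hy.1) (sum_pow_pos_of_mem_Yhat hy))

lemma convex_Yhat (pref : Fin Q → Fin N → ℝ) (t : ℝ) (q : Fin Q) : Convex ℝ (G.Yhat pref t q) := by
  intro y hy z hz a b ha hb hab
  refine ⟨G.convex_Y q hy.1 hz.1 ha hb hab, ?_⟩
  simp only [Strat.pow_add, Strat.pow_smul, Pi.add_apply, Pi.smul_apply, smul_eq_mul,
    Finset.sum_add_distrib, ← Finset.mul_sum]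
  calc _ = a * ((⨅ k, G.nnoise q k) * Real.exp (G.etaRef pref t q)) +
        b * ((⨅ k, G.nnoise q k) * Real.exp (G.etaRef pref t q)) := by rw [← add_mul, hab, one_mul]
    _ ≤ _ := add_le_add (mul_le_mul_of_nonneg_left hy.2 ha) (mul_le_mul_of_nonneg_left hz.2 hb)

lemma isCompact_Yhat (pref : Fin Q → Fin N → ℝ) (t : ℝ) (q : Fin Q) :
    IsCompact (G.Yhat pref t q) :=
  (G.isCompact_Y q).inter_right (isClosed_le continuous_const
    (continuous_finsetSum _ fun k _ => Strat.continuous_pow k))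

lemma mem_Y_of_mem_dom (hx : x ∈ G.dom pref t q) (r : Fin Q) : x r ∈ G.Y r := by
  rcases eq_or_ne r q with rfl | h
  · exact hx.1.1
  · exact hx.2 r h

lemma throughput_pos_of_mem_dom (hx : x ∈ G.dom pref t q) : 0 < G.throughput q x := by
  have := throughput_pos_of_mem_Yhat hx.2 hx.1
  rwa [Function.update_eq_self] at this

lemma isCompact_dom (pref : Fin Q → Fin N → ℝ) (t : ℝ) (q : Fin Q) :
    IsCompact (G.dom pref t q) := by
  have e : G.dom pref t q = Set.univ.pi (Function.update G.Y q (G.Yhat pref t q)) := by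
    ext x
    simp only [Set.mem_univ_pi]
    constructor
    · intro h r
      rcases eq_or_ne r q with rfl | hr
      · simpa using h.1
      · simpa [hr] using h.2 r hr
    · intro h
      exact ⟨by simpa using h q, fun r hr => by simpa [hr] using h r⟩
  rw [e]
  refine isCompact_univ_pi fun r => ?_
  rcases eq_or_ne r q with rfl | hr
  · simpa using isCompact_Yhat pref t r
  · simpa [hr] using G.isCompact_Y r

lemma update_mem_dom (hx : ∀ r, r ≠ q → x r ∈ G.Y r) {y : Strat N} (hy : y ∈ G.Yhat pref t q) :
    Function.update x q y ∈ G.dom pref t q :=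
  ⟨by simpa using hy, fun r hr => by simpa [hr] using hx r hr⟩

/-! ### Multipliers -/

/-- Only the summand of user `q` is needed. Its denominator is at most `1`, since `log (1 + u) ≤ u`
bounds the rate per unit power by the inverse noise. -/
lemma inv_locLim_le_lamMax (q : Fin Q) : 1 / G.locLim q ≤ G.lamMax := by
  have : Nonempty (Fin N) := ⟨⟨0, G.N_pos⟩⟩
  have : Nonempty (Fin Q) := ⟨q⟩
  have hm : 0 < ⨅ q', min (G.locLim q') (⨅ k, G.pmax q' k) := by
    obtain ⟨r, hr⟩ := exists_eq_ciInf_of_finite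
      (f := fun q' => min (G.locLim q') (⨅ k, G.pmax q' k))
    rw [← hr]
    refine lt_min (G.locLim_pos r) ?_
    obtain ⟨k, hk⟩ := exists_eq_ciInf_of_finite (f := fun k => G.pmax r k)
    rw [← hk]
    exact G.pmax_pos r k
  have hmq : ⨅ q', min (G.locLim q') (⨅ k, G.pmax q' k) ≤ G.locLim q :=
    (ciInf_le (Set.finite_range _).bddBelow q).trans (min_le_left _ _)
  have hden : ∀ r k, 0 < G.nnoise r k +
      ∑ r' ∈ Finset.univ.erase r, G.gain r r' k * G.pmax r' k := fun r k =>
    add_pos_of_pos_of_nonneg (G.nnoise_pos r k) (Finset.sum_nonneg fun r' _ =>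
      mul_nonneg (G.gain_nonneg r r' k) (G.pmax_pos r' k).le)
  have hA : ∀ r, 0 < ⨅ k, G.rate r k G.pmax / G.pmax r k := by
    intro r
    obtain ⟨k, hk⟩ := exists_eq_ciInf_of_finite (f := fun k => G.rate r k G.pmax / G.pmax r k)
    rw [← hk]
    exact div_pos (Real.log_pos (lt_add_of_pos_right _ (div_pos (G.pmax_pos r k) (hden r k))))
      (G.pmax_pos r k)
  have hAB : ∀ r, (⨅ k, G.rate r k G.pmax / G.pmax r k) * ⨅ k, G.nnoise r k ≤ 1 := by
    intro r
    let k : Fin N := ⟨0, G.N_pos⟩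
    have h1 : ⨅ k, G.rate r k G.pmax / G.pmax r k ≤ G.rate r k G.pmax / G.pmax r k :=
      ciInf_le (Set.finite_range _).bddBelow k
    have h2 : ⨅ k, G.nnoise r k ≤ G.nnoise r k := ciInf_le (Set.finite_range _).bddBelow k
    have h3 : G.rate r k G.pmax / G.pmax r k ≤ 1 / G.nnoise r k := by
      have hp := G.pmax_pos r k
      have hd := hden r k
      have hn := G.nnoise_pos r k
      have h4 : G.rate r k G.pmax ≤ G.pmax r k / (G.nnoise r k +
          ∑ r' ∈ Finset.univ.erase r, G.gain r r' k * G.pmax r' k) := by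
        have := Real.log_le_sub_one_of_pos (x := 1 + G.pmax r k / (G.nnoise r k +
          ∑ r' ∈ Finset.univ.erase r, G.gain r r' k * G.pmax r' k))
          (by have := div_pos hp hd; linarith)
        rw [rate]
        linarith
      have h5 : G.pmax r k / (G.nnoise r k +
          ∑ r' ∈ Finset.univ.erase r, G.gain r r' k * G.pmax r' k) ≤ G.pmax r k / G.nnoise r k :=
        div_le_div_of_nonneg_left hp.le hn (le_add_of_nonneg_right (Finset.sum_nonneg fun r' _ =>
          mul_nonneg (G.gain_nonneg r r' k) (G.pmax_pos r' k).le))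
      rw [div_le_iff₀ hp, one_div_mul_eq_div]
      exact h4.trans h5
    calc _ ≤ 1 / G.nnoise r k * G.nnoise r k :=
          mul_le_mul (h1.trans h3) h2 (iInf_nnoise_pos r).le
            (one_div_nonneg.2 (G.nnoise_pos r k).le)
      _ = 1 := one_div_mul_cancel (G.nnoise_pos r k).ne'
  have hpos : ∀ r, 0 < (⨅ k, G.rate r k G.pmax / G.pmax r k) * ⨅ k, G.nnoise r k := fun r =>
    mul_pos (hA r) (iInf_nnoise_pos r)
  have hterm : 1 / G.locLim q ≤ (1 / ⨅ q', min (G.locLim q') (⨅ k, G.pmax q' k)) /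
      ((⨅ k, G.rate q k G.pmax / G.pmax q k) * ⨅ k, G.nnoise q k) :=
    (one_div_le_one_div_of_le hm hmq).trans
      (le_div_self (one_div_pos.2 hm).le (hpos q) (hAB q))
  exact hterm.trans (Finset.single_le_sum (f := fun r =>
    (1 / ⨅ q', min (G.locLim q') (⨅ k, G.pmax q' k)) /
      ((⨅ k, G.rate r k G.pmax / G.pmax r k) * ⨅ k, G.nnoise r k))
    (fun r _ => div_nonneg (one_div_pos.2 hm).le (hpos r).le) (Finset.mem_univ q))

lemma lagr_zero_mul (c price : ℝ) (q : Fin Q) (x : Profile Q N) :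
    G.lagr c q 0 price x = -(G.theta c q x - price * G.globI x) := by
  rw [lagr]
  ring

lemma lagr_eq_add (c lam price : ℝ) (q : Fin Q) :
    G.lagr c q lam price = fun x => G.lagr c q 0 price x + lam * G.locI q (x q) := by
  ext x
  rw [lagr, lagr]
  ring

/-- No feasible direction of descent at a best response. -/
lemma IsBestResponse.fderiv_nonneg (hpref : G.IsRefPower pref)
    (hx : ∀ r, r ≠ q → x r ∈ G.Y r) {y : Strat N} (hy : G.IsBestResponse c price q x y)
    {z : Strat N} (hz : z ∈ G.Y q)
    (h : G.locI q y < 0 ∨ fderiv ℝ (fun x : Profile Q N => G.locI q (x q)) (Function.update x q y)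
      (Pi.single q (z - y)) < 0) :
    0 ≤ fderiv ℝ (G.lagr c q 0 price) (Function.update x q y) (Pi.single q (z - y)) := by
  by_contra hneg
  have hyt := hy.throughput_pos hpref hx
  have hX := update_mem_Y hx hy.1.1
  set d := z - y with hd
  set X := Function.update x q y with hXdef
  have hline : ∀ s : ℝ, X + s • (Pi.single q d : Profile Q N) = Function.update x q (y + s • d) :=
    fun s => (update_add_smul_single x q y d s).symm
  have hX0 : X + (0 : ℝ) • (Pi.single q d : Profile Q N) = X := by rw [zero_smul, add_zero]
  have h1 := (show ContDiffAt ℝ 2 (G.lagr c q 0 price) (X + (0 : ℝ) • (Pi.single q d : Profile Q N)) by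
    rw [hX0]; exact contDiffAt_lagr c 0 price hX hyt).hasDerivAt_line
  have h2 := (show ContDiffAt ℝ 2 (fun x : Profile Q N => G.locI q (x q))
    (X + (0 : ℝ) • (Pi.single q d : Profile Q N)) by
      rw [hX0]; exact contDiffAt_locI (hX q)).hasDerivAt_line
  have h3 := (show ContDiffAt ℝ 2 (G.throughput q) (X + (0 : ℝ) • (Pi.single q d : Profile Q N)) by
    rw [hX0]; exact contDiffAt_throughput hX).hasDerivAt_line
  have e3 := (h3.continuousAt.eventually (lt_mem_nhds (by simpa using hyt))).filter_mono
    (nhdsWithin_le_nhds (s := Set.Ioi 0))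
  have e1 := h1.eventually_lt_right (by rw [hX0]; exact not_le.1 hneg)
  have e2 : ∀ᶠ s in nhdsWithin (0 : ℝ) (Set.Ioi 0), G.locI q (y + s • d) ≤ 0 := by
    rcases h with h | h
    · have := (h2.continuousAt.eventually_lt (continuousAt_const (y := (0 : ℝ)))
        (by simpa [hXdef] using h)).filter_mono
        (nhdsWithin_le_nhds (s := Set.Ioi 0))
      filter_upwards [this] with s hs
      rw [hline] at hs
      simpa using hs.le
    · filter_upwards [h2.eventually_lt_right (by rw [hX0]; exact h)] with s hs
      rw [hX0, hline] at hs
      have h0 := hy.1.2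
      simp only [hXdef, Function.update_self] at hs
      linarith
  have e4 : ∀ᶠ s in nhdsWithin (0 : ℝ) (Set.Ioi 0), s ∈ Set.Ioo (0 : ℝ) 1 :=
    Ioo_mem_nhdsGT zero_lt_one
  obtain ⟨s, hs1, hs2, hs3, hs4⟩ := (e1.and (e2.and (e3.and e4))).exists
  have hmem : y + s • d ∈ G.Y q := by
    have := G.convex_Y q hy.1.1 hz (a := 1 - s) (b := s) (by linarith [hs4.2]) hs4.1.le (by ring)
    convert this using 1
    rw [hd]
    module
  rw [hline] at hs1 hs3
  have := hy.payoff_le hpref hx ⟨hmem, hs2⟩ hs3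
  rw [hX0, lagr_zero_mul, lagr_zero_mul] at hs1
  linarith

/-- An inactive constraint needs no multiplier. An active one is handled by the multiplier rule for
linear functionals, with the direction that shrinks all powers to zero as Slater point: there the
constraint has derivative `-locLim` and the Lagrangian has derivative at most `1`, so the multiplier
is at most `1 / locLim`. -/
lemma IsBestResponse.exists_multiplier (hpref : G.IsRefPower pref) (hprice : 0 ≤ price)
    (hx : ∀ r, r ≠ q → x r ∈ G.Y r) {y : Strat N} (hy : G.IsBestResponse c price q x y) :
    ∃ lam ∈ Set.Icc 0 G.lamMax, lam * G.locI q y = 0 ∧ ∀ z ∈ G.Y q,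
      0 ≤ fderiv ℝ (G.lagr c q lam price) (Function.update x q y) (Pi.single q (z - y)) := by
  have hyt := hy.throughput_pos hpref hx
  have hyY := hy.1.1
  have hX := update_mem_Y hx hyY
  have hlam : 0 ≤ G.lamMax := (one_div_pos.2 (G.locLim_pos q)).le.trans (inv_locLim_le_lamMax q)
  rcases hy.1.2.lt_or_eq with hlt | heq
  · exact ⟨0, ⟨le_rfl, hlam⟩, zero_mul _, fun z hz => hy.fderiv_nonneg hpref hx hz (Or.inl hlt)⟩
  set X := Function.update x q y with hXdef
  have hcl := contDiffAt_lagr (G := G) (q := q) c 0 price hX hyt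
  have hcg := contDiffAt_locI (hX q)
  let ι : Strat N →ₗ[ℝ] Profile Q N := LinearMap.single ℝ (fun _ : Fin Q => Strat N) q
  let F : Strat N →ₗ[ℝ] ℝ := (fderiv ℝ (G.lagr c q 0 price) X).toLinearMap ∘ₗ ι
  let g : Strat N →ₗ[ℝ] ℝ :=
    (fderiv ℝ (fun x : Profile Q N => G.locI q (x q)) X).toLinearMap ∘ₗ ι
  have hF : ∀ d, F d = fderiv ℝ (G.lagr c q 0 price) X (Pi.single q d) := fun d => rfl
  have hg : ∀ d, g d = fderiv ℝ (fun x : Profile Q N => G.locI q (x q)) X (Pi.single q d) :=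
    fun d => rfl
  set z₀ := Strat.ofParts y.tau 0 y.pfa with hz₀
  set d := z₀ - y with hd
  have hX0 : X + (0 : ℝ) • (Pi.single q d : Profile Q N) = X := by rw [zero_smul, add_zero]
  have hline : ∀ s : ℝ, X + s • (Pi.single q d : Profile Q N) =
      Function.update x q (Strat.ofParts y.tau ((1 - s) • y.pow) y.pfa) := by
    intro s
    rw [hXdef, ← update_add_smul_single]
    congr 1
    refine Strat.ext_parts ?_ ?_ ?_
    · simp [hd, hz₀]
    · ext k
      simp [hd, hz₀]
      ring
    · simp [hd, hz₀]
  have hloc : ∀ s : ℝ, G.locI q (Strat.ofParts y.tau ((1 - s) • y.pow) y.pfa) = -(s * G.locLim q) := by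
    intro s
    have e : G.locI q y = ∑ k, G.pmiss q k y * G.w q k * y.pow k - G.locLim q := rfl
    rw [heq] at e
    have e2 : ∑ k, G.pmiss q k y * G.w q k * ((1 - s) • y.pow) k =
        (1 - s) * ∑ k, G.pmiss q k y * G.w q k * y.pow k := by
      rw [Finset.mul_sum]
      refine Finset.sum_congr rfl fun k _ => ?_
      rw [Pi.smul_apply, smul_eq_mul]
      ring
    simp only [locI, pmiss_ofParts, Strat.pow_ofParts, e2]
    linear_combination (s - 1) * e
  have hd1 := (show ContDiffAt ℝ 2 (G.lagr c q 0 price)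
    (X + (0 : ℝ) • (Pi.single q d : Profile Q N)) by rw [hX0]; exact hcl).hasDerivAt_line
  have hd2 := (show ContDiffAt ℝ 2 (fun x : Profile Q N => G.locI q (x q))
    (X + (0 : ℝ) • (Pi.single q d : Profile Q N)) by rw [hX0]; exact hcg).hasDerivAt_line
  rw [hX0] at hd1 hd2
  have hg0 : g d = -G.locLim q := by
    rw [hg]
    refine hd2.unique ?_
    have h := ((hasDerivAt_id (0 : ℝ)).mul_const (G.locLim q)).neg
    rw [one_mul] at h
    refine h.congr_of_eventuallyEq (Filter.Eventually.of_forall fun s => ?_)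
    simp only [hline, Function.update_self, hloc]
    rfl
  -- By concavity, scaling the powers by `1 - s` lowers the log rate by at most `-log (1 - s)`,
  -- whose derivative at `0` is `1`. The price term only improves, as interference decreases, and
  -- the penalty does not see the powers.
  have hF0 : F d ≤ 1 := by
    rw [hF]
    have hlog : HasDerivAt (fun s : ℝ => G.lagr c q 0 price X - Real.log (1 - s)) 1 0 := by
      have h := (((hasDerivAt_id (0 : ℝ)).const_sub 1).log (by simp)).const_sub
        (G.lagr c q 0 price X)
      simpa using h
    refine hd1.le_of_eventually_le_right hlog (by simp) ?_
    filter_upwards [Ioo_mem_nhdsGT zero_lt_one] with s hs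
    have hs1 : 0 < 1 - s := sub_pos.2 hs.2
    have hpos := (throughput_pos_iff hyY).1 hyt
    have hge := le_sumRate_smul hx (pow_nonneg_of_mem hyY) hs1.le (by linarith [hs.1])
    set z := Strat.ofParts y.tau ((1 - s) • y.pow) y.pfa with hz
    have hzY : z ∈ G.Y q := by
      refine ofParts_mem_Y hyY ?_
      have := G.convex_powerSet q hyY.2.2.2.1 (G.zero_mem_powerSet q) hs1.le hs.1.le (by ring)
      simpa using this
    have hzp : z.pow = (1 - s) • y.pow := by simp [hz]
    have hzpos : 0 < G.sumRate q x z.pow := by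
      rw [hzp]
      exact (mul_pos hs1 hpos).trans_le hge
    have hlogle : Real.log (1 - s) + Real.log (G.sumRate q x y.pow) ≤
        Real.log (G.sumRate q x z.pow) := by
      rw [← Real.log_mul hs1.ne' hpos.ne', hzp]
      exact Real.log_le_log (mul_pos hs1 hpos) hge
    have hglob := G.globI_update_sub q x y z
    rw [heq, hz, hloc s, ← hz] at hglob
    have hgl : 0 ≤ price * (s * G.locLim q) :=
      mul_nonneg hprice (mul_nonneg hs.1.le (G.locLim_pos q).le)
    have hglob' : price * G.globI (Function.update x q z) - price * G.globI (Function.update x q y) =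
        -(price * (s * G.locLim q)) := by
      linear_combination price * hglob
    rw [hline, ← hz, lagr_zero_mul, lagr_zero_mul, hXdef, theta_eq,
      theta_eq c q (Function.update x q y), theta_zero_update hyY hpos, theta_zero_update hzY hzpos,
      dev_update_congr x (y := z) (z := y) (by simp [hz])]
    have et : z.tau = y.tau := by simp [hz]
    have ep : z.pfa = y.pfa := by simp [hz]
    rw [et, ep]
    linarith
  have hzY : z₀ ∈ G.Y q := ofParts_mem_Y hyY (G.zero_mem_powerSet q)
  have hconv : Convex ℝ ((fun z => z - y) '' G.Y q) := by
    have := (G.convex_Y q).translate (-y)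
    simpa [sub_eq_neg_add] using this
  obtain ⟨l, hl0, hl1, hl⟩ := _root_.exists_multiplier hconv F g (by
    rintro _ ⟨z, hz, rfl⟩ hneg
    exact hy.fderiv_nonneg hpref hx hz (Or.inr hneg)) (z₀ := d) ⟨z₀, hzY, rfl⟩
    (by rw [hg0]; linarith [G.locLim_pos q])
  refine ⟨l, ⟨hl0, hl1.trans ?_⟩, by rw [heq, mul_zero], fun z hz => ?_⟩
  · rw [hg0, neg_neg]
    exact (div_le_div_of_nonneg_right hF0 (G.locLim_pos q).le).trans (inv_locLim_le_lamMax q)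
  · have h := hl _ ⟨z, hz, rfl⟩
    rw [lagr_eq_add, fderiv_fun_add (hcl.differentiableAt (by norm_num))
      ((hcg.differentiableAt (by norm_num)).const_mul l),
      fderiv_const_mul (hcg.differentiableAt (by norm_num))]
    exact h

end CRGame

/-! ### Blocks of second derivatives -/

lemma Profile.single_eq_sum {Q N : ℕ} (q : Fin Q) (d : Strat N) :
    (Pi.single q d : Profile Q N) =
      ∑ i, d i • (Pi.single q (Pi.single i 1) : Profile Q N) := by
  ext r j
  simp only [Finset.sum_apply, Pi.smul_apply, smul_eq_mul]
  rcases eq_or_ne r q with rfl | h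
  · simp [Pi.single_apply]
  · simp [h]

lemma fderiv_fderiv_single {Q N : ℕ} (F : Profile Q N → ℝ) (x : Profile Q N) (q r : Fin Q)
    (d e : Strat N) :
    fderiv ℝ (fderiv ℝ F) x (Pi.single q d) (Pi.single r e) =
      d ⬝ᵥ (hessBlock F x q r).mulVec e := by
  rw [Profile.single_eq_sum q d, Profile.single_eq_sum r e]
  simp only [map_sum, map_smul, sum_apply, smul_apply,
    smul_eq_mul, dotProduct, Matrix.mulVec, hessBlock, Matrix.of_apply]
  simp only [Finset.mul_sum]
  rw [Finset.sum_comm]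
  exact Finset.sum_congr rfl fun i _ => Finset.sum_congr rfl fun j _ => by ring

lemma hessBlock_isSymm {Q N : ℕ} {F : Profile Q N → ℝ} {x : Profile Q N}
    (h : ContDiffAt ℝ 2 F x) (q : Fin Q) : (hessBlock F x q q).IsSymm := by
  ext i j
  exact (h.isSymmSndFDerivAt (by simp)).eq _ _

lemma continuousAt_hessBlock {Q N : ℕ} {F : Profile Q N → ℝ} {x : Profile Q N}
    (h : ContDiffAt ℝ 2 F x) (q r : Fin Q) : ContinuousAt (fun x => hessBlock F x q r) x := by
  have h1 : ContDiffAt ℝ 1 (fderiv ℝ F) x := h.fderiv_right (by norm_num)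
  have h2 : ContDiffAt ℝ 0 (fderiv ℝ (fderiv ℝ F)) x := h1.fderiv_right (by norm_num)
  refine continuousAt_pi.2 fun i => continuousAt_pi.2 fun j => ?_
  exact (h2.continuousAt.clm_apply continuousAt_const).clm_apply continuousAt_const

lemma dotProduct_mulVec_of_pow {N : ℕ} (h : Matrix (Fin (N + 2)) (Fin (N + 2)) ℝ) {d e : Strat N}
    (hd0 : d.tau = 0) (hd1 : d.pfa = 0) (he0 : e.tau = 0) (he1 : e.pfa = 0) :
    d ⬝ᵥ h.mulVec e = d.pow ⬝ᵥ (h.submatrix pIdx pIdx).mulVec e.pow := by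
  change d 0 = 0 at hd0
  change d (Fin.last (N + 1)) = 0 at hd1
  change e 0 = 0 at he0
  change e (Fin.last (N + 1)) = 0 at he1
  simp only [dotProduct, Matrix.mulVec, Strat.sum_coord, hd0, hd1, he0, he1, Matrix.submatrix_apply,
    zero_mul, mul_zero, zero_add, add_zero]
  rfl

namespace CRGame

variable {Q N : ℕ} {G : CRGame Q N} {q : Fin Q} {x : Profile Q N} {c price t : ℝ}
  {pref : Fin Q → Fin N → ℝ}

/-! ### The weighted norms -/

variable (G) in
/-- The first diagonal entry of `D_q²`. -/
def wTau (pref : Fin Q → Fin N → ℝ) (t c : ℝ) (q : Fin Q) : ℝ :=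
  G.rho pref t q + c * ((1 - 1 / (Q : ℝ)) / √(G.f q)) ^ 2

/-- The coordinates other than the sensing time. -/
def _root_.Strat.rest (d : Strat N) : Fin (N + 1) → ℝ := fun i => d i.succ

variable (G) in
/-- The norm on strategies weighted by `D_q`. -/
def wnorm (pref : Fin Q → Fin N → ℝ) (t c : ℝ) (q : Fin Q) (d : Strat N) : ℝ :=
  √(G.wTau pref t c q * d.tau ^ 2 + G.rho pref t q * eNorm d.rest ^ 2)

/-- If `ρ_q` vanished, so would the second diagonal entry of `D_q`. -/
lemma rho_pos (hD : IsUnit (G.Dmat pref t c q).det) : 0 < G.rho pref t q := by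
  have h0 : 0 ≤ G.rho pref t q := le_max_left _ _
  refine h0.lt_of_ne' fun h => ?_
  rw [Dmat, Matrix.det_diagonal, Fin.prod_univ_two] at hD
  simp [h] at hD

lemma rho_le_wTau (hc : 0 ≤ c) : G.rho pref t q ≤ G.wTau pref t c q :=
  le_add_of_nonneg_right (by positivity)

lemma wnorm_nonneg (d : Strat N) : 0 ≤ G.wnorm pref t c q d := Real.sqrt_nonneg _

lemma rho_nonneg : 0 ≤ G.rho pref t q := le_max_left _ _

lemma wnorm_sq (hc : 0 ≤ c) (d : Strat N) : G.wnorm pref t c q d ^ 2 =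
    G.wTau pref t c q * d.tau ^ 2 + G.rho pref t q * eNorm d.rest ^ 2 := by
  have h0 : 0 ≤ G.rho pref t q := rho_nonneg
  have h1 : 0 ≤ G.wTau pref t c q := h0.trans (rho_le_wTau hc)
  exact Real.sq_sqrt (by positivity)

lemma wnorm_neg (d : Strat N) : G.wnorm pref t c q (-d) = G.wnorm pref t c q d := by
  have h1 : (-d).tau = -d.tau := rfl
  have h2 : (-d).rest = -d.rest := rfl
  rw [wnorm, wnorm, h1, h2, eNorm_neg, neg_sq]

lemma wnorm_sub_comm (y z : Strat N) :
    G.wnorm pref t c q (y - z) = G.wnorm pref t c q (z - y) := by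
  rw [← neg_sub, wnorm_neg]

/-- The weighted norm dominates the coordinates. -/
lemma rho_mul_sq_le (hc : 0 ≤ c) (d : Strat N) (i : Fin (N + 2)) :
    G.rho pref t q * d i ^ 2 ≤ G.wnorm pref t c q d ^ 2 := by
  have h0 : 0 ≤ G.rho pref t q := rho_nonneg
  have h1 := rho_le_wTau (G := G) (pref := pref) (t := t) (q := q) hc
  rw [wnorm_sq hc]
  refine Fin.cases ?_ (fun j => ?_) i
  · have : 0 ≤ G.rho pref t q * eNorm d.rest ^ 2 := by positivity
    have := mul_le_mul_of_nonneg_right h1 (sq_nonneg (d 0))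
    change _ ≤ G.wTau pref t c q * d 0 ^ 2 + _
    linarith
  · have h2 : 0 ≤ G.wTau pref t c q * d.tau ^ 2 := mul_nonneg (h0.trans h1) (sq_nonneg _)
    have h3 : d j.succ ^ 2 ≤ eNorm d.rest ^ 2 := by
      rw [eNorm_sq, sq]
      exact Finset.single_le_sum (f := fun j => d.rest j * d.rest j)
        (fun j _ => mul_self_nonneg _) (Finset.mem_univ j)
    have := mul_le_mul_of_nonneg_left h3 h0
    linarith

lemma eq_zero_of_wnorm_eq_zero (hc : 0 ≤ c) (hD : IsUnit (G.Dmat pref t c q).det) {d : Strat N}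
    (h : G.wnorm pref t c q d = 0) : d = 0 := by
  have h0 := rho_pos hD
  ext i
  have := rho_mul_sq_le (G := G) (pref := pref) (t := t) (q := q) hc d i
  rw [h] at this
  have h2 : d i ^ 2 ≤ 0 := by
    by_contra hcon
    have := mul_pos h0 (not_le.1 hcon)
    linarith
  exact pow_eq_zero_iff (two_ne_zero) |>.1 (le_antisymm h2 (sq_nonneg _))

/-! ### Growth of the payoff at a best response -/

lemma rho_le_leastEig (hD : IsUnit (G.Dmat pref t c q).det) (hx : x ∈ G.dom pref t q) {lam : ℝ}
    (hlam : lam ∈ Set.Icc 0 G.lamMax) (hprice : price ∈ Set.Icc 0 t) :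
    G.rho pref t q ≤ leastEig (G.Bmat q x lam price) := by
  have h0 := rho_pos hD
  set S := {e | ∃ x ∈ G.dom pref t q, ∃ lam ∈ Set.Icc 0 G.lamMax, ∃ price ∈ Set.Icc 0 t,
    e = leastEig (G.Bmat q x lam price)} with hS
  have hr : G.rho pref t q = max 0 (sInf S) := rfl
  have hpos : 0 < sInf S := by
    by_contra hcon
    rw [hr, max_eq_left (not_lt.1 hcon)] at h0
    exact lt_irrefl _ h0
  -- The infimum of a set unbounded below is `0` by convention, so its positivity already gives
  -- boundedness; no continuity of the least eigenvalue is needed.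
  have hb : BddBelow S := by
    by_contra hcon
    rw [Real.sInf_of_not_bddBelow hcon] at hpos
    exact lt_irrefl _ hpos
  rw [hr, max_eq_right hpos.le]
  exact csInf_le hb ⟨x, hx, lam, hlam, price, hprice, rfl⟩

lemma le_fderiv_fderiv_lagr (hD : IsUnit (G.Dmat pref t c q).det) (hx : x ∈ G.dom pref t q)
    {lam : ℝ} (hlam : lam ∈ Set.Icc 0 G.lamMax) (hprice : price ∈ Set.Icc 0 t) (d : Strat N) :
    G.rho pref t q * (d.tau ^ 2 + eNorm d.rest ^ 2) ≤
      fderiv ℝ (fderiv ℝ (G.lagr 0 q lam price)) x (Pi.single q d) (Pi.single q d) := by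
  have hs := hessBlock_isSymm (contDiffAt_lagr 0 lam price (mem_Y_of_mem_dom hx)
    (throughput_pos_of_mem_dom hx)) q
  rw [fderiv_fderiv_single]
  exact (mul_le_mul_of_nonneg_right (rho_le_leastEig hD hx hlam hprice) (by positivity)).trans
    (leastEig_block_le hs d)

lemma dev_single (q : Fin Q) (d : Strat N) :
    G.dev q (Pi.single q d) = (1 - 1 / (Q : ℝ)) / √(G.f q) * d.tau := by
  rw [dev_apply, Finset.sum_eq_single q]
  · simp only [Pi.single_eq_same]
    ring
  · intro r _ hr
    simp [Strat.tau, hr]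
  · simp

lemma dev_single_of_ne {r : Fin Q} (hr : r ≠ q) (d : Strat N) :
    G.dev q (Pi.single r d) = -(1 / (Q : ℝ) / √(G.f r) * d.tau) := by
  rw [dev_apply, Finset.sum_eq_single r]
  · rw [Pi.single_eq_of_ne hr.symm]
    simp only [Pi.single_eq_same]
    have : (0 : Strat N).tau = 0 := rfl
    rw [this]
    ring
  · intro r' _ hr'
    simp [Strat.tau, hr']
  · simp

/-- Second order expansion of the Lagrangian along the segment from `y` to `z`. The segment may
leave `X q`, but it stays in the convex set `Yhat`, where the Hessian bound holds; the first order
term is nonnegative by the variational inequality. -/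
lemma IsBestResponse.growth (hpref : G.IsRefPower pref) (hc : 0 ≤ c) (hprice : 0 ≤ price)
    (hpt : price ≤ t) (hD : IsUnit (G.Dmat pref t c q).det)
    (hx : ∀ r, r ≠ q → x r ∈ G.Y r) {y : Strat N} (hy : G.IsBestResponse c price q x y)
    {z : Strat N} (hzX : G.locI q z ≤ 0) (hz : z ∈ G.Yhat pref t q) :
    (G.theta c q (Function.update x q z) - price * G.globI (Function.update x q z)) +
      G.wnorm pref t c q (z - y) ^ 2 / 2 ≤
      G.theta c q (Function.update x q y) - price * G.globI (Function.update x q y) := by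
  obtain ⟨lam, hlam, hcompl, hvi⟩ := hy.exists_multiplier hpref hprice hx
  have hyh := hy.mem_Yhat hpref hprice hpt hx
  set d := z - y with hd
  set X := Function.update x q y with hX
  have hmem : ∀ s ∈ Set.Icc (0 : ℝ) 1, X + s • (Pi.single q d : Profile Q N) ∈ G.dom pref t q := by
    intro s hs
    rw [hX, ← update_add_smul_single]
    refine update_mem_dom hx ?_
    have := convex_Yhat pref t q hyh hz (a := 1 - s) (b := s) (by linarith [hs.2]) hs.1 (by ring)
    convert this using 1
    rw [hd]
    module
  have hcd : ∀ s ∈ Set.Icc (0 : ℝ) 1,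
      ContDiffAt ℝ 2 (G.lagr 0 q lam price) (X + s • (Pi.single q d : Profile Q N)) := fun s hs =>
    contDiffAt_lagr 0 lam price (mem_Y_of_mem_dom (hmem s hs)) (throughput_pos_of_mem_dom (hmem s hs))
  set κ := G.dev q (Pi.single q d) with hκ
  have hlin : ∀ s : ℝ, G.dev q (X + s • (Pi.single q d : Profile Q N)) = G.dev q X + s * κ := by
    intro s
    rw [map_add, map_smul, smul_eq_mul]
  -- The matrix `B_q` controls the Hessian at `c = 0`. The penalty is a quadratic polynomial along
  -- the segment and contributes exactly `c * κ ^ 2`, the extra term of `wTau`.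
  have hlagr : ∀ x, G.lagr c q lam price x = G.lagr 0 q lam price x + c / 2 * G.dev q x ^ 2 := by
    intro x
    rw [lagr, lagr, theta_eq c]
    ring
  have hφ1 : ∀ s ∈ Set.Icc (0 : ℝ) 1, HasDerivAt
      (fun s : ℝ => G.lagr c q lam price (X + s • (Pi.single q d : Profile Q N)))
      (fderiv ℝ (G.lagr 0 q lam price) (X + s • (Pi.single q d : Profile Q N)) (Pi.single q d) +
        c * (G.dev q X + s * κ) * κ) s := by
    intro s hs
    have e : HasDerivAt (fun s : ℝ => c / 2 * (G.dev q X + s * κ) ^ 2)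
        (c * (G.dev q X + s * κ) * κ) s := by
      have := ((((hasDerivAt_id s).mul_const κ).const_add (G.dev q X)).pow 2).const_mul (c / 2)
      exact this.congr_deriv (by simp; ring)
    simp only [hlagr, hlin]
    exact (hcd s hs).hasDerivAt_line.add e
  have hφ2 : ∀ s ∈ Set.Icc (0 : ℝ) 1, HasDerivAt
      (fun s : ℝ => fderiv ℝ (G.lagr 0 q lam price) (X + s • (Pi.single q d : Profile Q N))
        (Pi.single q d) + c * (G.dev q X + s * κ) * κ)
      (fderiv ℝ (fderiv ℝ (G.lagr 0 q lam price)) (X + s • (Pi.single q d : Profile Q N))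
        (Pi.single q d) (Pi.single q d) + c * κ ^ 2) s := by
    intro s hs
    have e : HasDerivAt (fun s : ℝ => c * (G.dev q X + s * κ) * κ) (c * κ ^ 2) s := by
      have := ((((hasDerivAt_id s).mul_const κ).const_add (G.dev q X)).const_mul c).mul_const κ
      exact this.congr_deriv (by ring)
    exact ((hcd s hs).hasDerivAt_fderiv_line _).add e
  have hmain := second_order_lower_bound hφ1 hφ2 (m := G.wnorm pref t c q d ^ 2) (by
    intro s hs
    have h := le_fderiv_fderiv_lagr hD (hmem s hs) hlam ⟨hprice, hpt⟩ d
    rw [wnorm_sq hc, wTau, hκ, dev_single]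
    refine le_trans (le_of_eq ?_) (add_le_add_left h _)
    ring)
  have hφ0 : 0 ≤ fderiv ℝ (G.lagr 0 q lam price) (X + (0 : ℝ) • (Pi.single q d : Profile Q N))
      (Pi.single q d) + c * (G.dev q X + 0 * κ) * κ := by
    have h1 := hvi z hz.1
    have hyt := hy.throughput_pos hpref hx
    have h2 := (show ContDiffAt ℝ 2 (G.lagr c q lam price)
      (X + (0 : ℝ) • (Pi.single q d : Profile Q N)) by
        rw [zero_smul, add_zero]
        exact contDiffAt_lagr c lam price (update_mem_Y hx hy.1.1) hyt).hasDerivAt_line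
    rw [← h2.unique (hφ1 0 (by simp)), zero_smul, add_zero]
    exact h1
  have e1 : X + (1 : ℝ) • (Pi.single q d : Profile Q N) = Function.update x q z := by
    rw [hX, ← update_add_smul_single, hd]
    congr 1
    module
  have e0 : X + (0 : ℝ) • (Pi.single q d : Profile Q N) = X := by rw [zero_smul, add_zero]
  rw [e0] at hφ0
  simp only [e1, e0] at hmain
  -- The multiplier term vanishes at `y` by complementary slackness and is nonpositive at `z`, so
  -- the gap of the Lagrangian carries over to the payoff.
  have h3 : lam * G.locI q z ≤ 0 := mul_nonpos_of_nonneg_of_nonpos hlam.1 hzX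
  rw [lagr, lagr, hX, Function.update_self, Function.update_self, hcompl, ← hX] at hmain
  linarith

end CRGame

namespace CRGame

variable {Q N : ℕ} {G : CRGame Q N} {q : Fin Q} {x : Profile Q N} {c price t : ℝ}
  {pref : Fin Q → Fin N → ℝ}

/-! ### The coupling coefficients -/

variable (G) in
/-- The mixed second derivative of `θ_q` in the sensing times of users `q` and `r`. -/
def tauCoupling (c : ℝ) (q r : Fin Q) : ℝ :=
  c * ((1 - 1 / (Q : ℝ)) / √(G.f q)) * (1 / (Q : ℝ) / √(G.f r))

lemma tau_single_one : Strat.tau (Pi.single 0 1 : Strat N) = 1 := by simp [Strat.tau]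

lemma theta_zero_add_smul_tau {r : Fin Q} (hr : r ≠ q) (y : Profile Q N) (s : ℝ) :
    G.theta 0 q (y + s • (Pi.single r (Pi.single 0 1 : Strat N) : Profile Q N)) =
      G.theta 0 q y := by
  have hp : ∀ r', (y + s • (Pi.single r (Pi.single 0 1 : Strat N) : Profile Q N)) r' = y r' ∨
      (∀ k, ((y + s • (Pi.single r (Pi.single 0 1 : Strat N) : Profile Q N)) r').pow k =
        (y r').pow k) := by
    intro r'
    rcases eq_or_ne r' r with rfl | h
    · right
      intro k
      simp [Strat.pow, pIdx]
    · left
      simp [h]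
  have hpow : ∀ r', ((y + s • (Pi.single r (Pi.single 0 1 : Strat N) : Profile Q N)) r').pow =
      (y r').pow := by
    intro r'
    rcases hp r' with h | h
    · rw [h]
    · exact funext h
  have hq : (y + s • (Pi.single r (Pi.single 0 1 : Strat N) : Profile Q N)) q = y q := by
    simp [hr.symm]
  rw [theta_zero, theta_zero, throughput_eq, throughput_eq, hq,
    G.sumRate_congr (x' := y) _ (fun r' _ => hpow r')]

/-- The throughput of user `q` does not depend on the sensing time of user `r`, so only the penalty
contributes. -/
lemma hessBlock_theta_zero_zero (c : ℝ) {r : Fin Q} (hr : r ≠ q) (hx : ∀ r, x r ∈ G.Y r)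
    (ht : 0 < G.throughput q x) :
    hessBlock (G.theta c q) x q r 0 0 = G.tauCoupling c q r := by
  set u : Profile Q N := Pi.single q (Pi.single 0 1) with hu
  set v : Profile Q N := Pi.single r (Pi.single 0 1) with hv
  have hcd := contDiffAt_theta c hx ht
  -- The first derivative is needed on a neighbourhood, so that it can be differentiated once more.
  have hev : ∀ᶠ y in nhds x, fderiv ℝ (G.theta c q) y v = -(c * G.dev q v) * G.dev q y := by
    filter_upwards [hcd.eventually (by simp)] with y hy
    have h1 := (show ContDiffAt ℝ 2 (G.theta c q) (y + (0 : ℝ) • v) by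
      rw [zero_smul, add_zero]; exact hy).hasDerivAt_line
    rw [zero_smul, add_zero] at h1
    refine h1.unique ?_
    have h2 : ∀ s : ℝ, G.theta c q (y + s • v) =
        G.theta 0 q y - c / 2 * (G.dev q y + s * G.dev q v) ^ 2 := by
      intro s
      rw [theta_eq, theta_zero_add_smul_tau hr, map_add, map_smul, smul_eq_mul]
    simp only [h2]
    have h3 := (((((hasDerivAt_id (0 : ℝ)).mul_const (G.dev q v)).const_add (G.dev q y)).pow
      2).const_mul (c / 2)).const_sub (G.theta 0 q y)
    exact h3.congr_deriv (by simp; ring)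
  have h1 : ContDiffAt ℝ 1 (fderiv ℝ (G.theta c q)) x := hcd.fderiv_right (by norm_num)
  have h2 := (h1.differentiableAt (by norm_num)).hasFDerivAt.clm_apply (hasFDerivAt_const v x)
  have h3 : HasFDerivAt (fun y => -(c * G.dev q v) * G.dev q y) (-(c * G.dev q v) • G.dev q) x :=
    (G.dev q).hasFDerivAt.const_mul _
  have h4 := congrArg (fun L : Profile Q N →L[ℝ] ℝ => L u)
    (h2.unique (h3.congr_of_eventuallyEq hev))
  simp only [add_apply, ContinuousLinearMap.comp_apply, zero_apply, map_zero,
    ContinuousLinearMap.flip_apply, smul_apply, smul_eq_mul, zero_add] at h4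
  change fderiv ℝ (fderiv ℝ (G.theta c q)) x u v = _
  rw [h4, hu, hv, dev_single, dev_single_of_ne hr, tau_single_one, tauCoupling]
  ring

lemma continuous_couplingNorm (A B : Matrix (Fin 2) (Fin 2) ℝ) :
    Continuous fun h : Matrix (Fin (N + 2)) (Fin (N + 2)) ℝ =>
      specNorm (A * Matrix.diagonal ![|h 0 0|, specNorm (h.submatrix pIdx pIdx)] * B) := by
  have h1 : Continuous fun h : Matrix (Fin (N + 2)) (Fin (N + 2)) ℝ =>
      specNorm (h.submatrix pIdx pIdx) :=
    continuous_norm.comp (continuous_id.matrix_submatrix _ _)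
  have h2 : Continuous fun h : Matrix (Fin (N + 2)) (Fin (N + 2)) ℝ => |h 0 0| :=
    (continuous_id.matrix_elem 0 0).abs
  have h3 : Continuous fun h : Matrix (Fin (N + 2)) (Fin (N + 2)) ℝ =>
      (![|h 0 0|, specNorm (h.submatrix pIdx pIdx)] : Fin 2 → ℝ) := by
    refine continuous_pi fun i => ?_
    fin_cases i
    · exact h2
    · exact h1
  exact continuous_norm.comp
    ((continuous_const.matrix_mul h3.matrix_diagonal).matrix_mul continuous_const)

/-- The supremum in `betaCoef` is a genuine upper bound because the domain is compact and second
derivatives are continuous on it; otherwise `sSup` could be the default value `0`. -/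
lemma le_betaCoef {r : Fin Q} (hx : x ∈ G.dom pref t q) :
    specNorm ((G.Dmat pref t c q)⁻¹ * G.Emat c q r x * (G.Dmat pref t c r)⁻¹) ≤
      G.betaCoef pref t c q r := by
  refine le_csSup ?_ ⟨x, hx, rfl⟩
  have hcont : ContinuousOn (fun x => specNorm ((G.Dmat pref t c q)⁻¹ * G.Emat c q r x *
      (G.Dmat pref t c r)⁻¹)) (G.dom pref t q) :=
    (continuous_couplingNorm _ _).comp_continuousOn fun x hx =>
      (continuousAt_hessBlock (contDiffAt_theta c (mem_Y_of_mem_dom hx)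
        (throughput_pos_of_mem_dom hx)) q r).continuousWithinAt
  refine ((isCompact_dom pref t q).bddAbove_image hcont).mono ?_
  rintro e ⟨x, hx, rfl⟩
  exact ⟨x, hx, rfl⟩

lemma betaCoef_nonneg (q r : Fin Q) : 0 ≤ G.betaCoef pref t c q r := by
  refine Real.sSup_nonneg ?_
  rintro e ⟨x, -, rfl⟩
  exact specNorm_nonneg _

/-- All three factors are diagonal, and the norm of a diagonal matrix dominates each entry. -/
lemma Emat_le_betaCoef {r : Fin Q} (hc : 0 ≤ c) (hDq : IsUnit (G.Dmat pref t c q).det)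
    (hDr : IsUnit (G.Dmat pref t c r).det) (hx : x ∈ G.dom pref t q) :
    |hessBlock (G.theta c q) x q r 0 0| ≤
        G.betaCoef pref t c q r * (√(G.wTau pref t c q) * √(G.wTau pref t c r)) ∧
      specNorm ((hessBlock (G.theta c q) x q r).submatrix pIdx pIdx) ≤
        G.betaCoef pref t c q r * (√(G.rho pref t q) * √(G.rho pref t r)) := by
  have hle := le_betaCoef (c := c) (r := r) hx
  have hq := rho_pos hDq
  have hr := rho_pos hDr
  have hq' : 0 < G.wTau pref t c q := hq.trans_le (rho_le_wTau hc)
  have hr' : 0 < G.wTau pref t c r := hr.trans_le (rho_le_wTau hc)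
  have hinv : ∀ q, IsUnit (G.Dmat pref t c q).det → (G.Dmat pref t c q)⁻¹ =
      Matrix.diagonal ![(√(G.wTau pref t c q))⁻¹, (√(G.rho pref t q))⁻¹] := by
    intro q hD
    have h1 := rho_pos hD
    have h2 : 0 < G.wTau pref t c q := h1.trans_le (rho_le_wTau hc)
    refine Matrix.inv_eq_right_inv ?_
    rw [Dmat, Matrix.diagonal_mul_diagonal, ← Matrix.diagonal_one]
    congr 1
    ext i
    fin_cases i
    · exact mul_inv_cancel₀ (Real.sqrt_pos.2 h2).ne'
    · exact mul_inv_cancel₀ (Real.sqrt_pos.2 h1).ne'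
  have hE : G.Emat c q r x = Matrix.diagonal ![|hessBlock (G.theta c q) x q r 0 0|,
      specNorm ((hessBlock (G.theta c q) x q r).submatrix pIdx pIdx)] := rfl
  rw [hinv q hDq, hinv r hDr, hE, Matrix.diagonal_mul_diagonal, Matrix.diagonal_mul_diagonal] at hle
  have h0 := (le_abs_self _).trans ((le_specNorm_diagonal _ 0).trans hle)
  have h1 := (le_abs_self _).trans ((le_specNorm_diagonal _ 1).trans hle)
  simp only [Matrix.cons_val_zero, Matrix.cons_val_one] at h0 h1
  have s1 := Real.sqrt_pos.2 hq
  have s2 := Real.sqrt_pos.2 hr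
  have s3 := Real.sqrt_pos.2 hq'
  have s4 := Real.sqrt_pos.2 hr'
  constructor
  · calc _ = (√(G.wTau pref t c q))⁻¹ * |hessBlock (G.theta c q) x q r 0 0| *
          (√(G.wTau pref t c r))⁻¹ * (√(G.wTau pref t c q) * √(G.wTau pref t c r)) := by
          field_simp
      _ ≤ _ := mul_le_mul_of_nonneg_right h0 (by positivity)
  · calc _ = (√(G.rho pref t q))⁻¹ *
          specNorm ((hessBlock (G.theta c q) x q r).submatrix pIdx pIdx) *
          (√(G.rho pref t r))⁻¹ * (√(G.rho pref t q) * √(G.rho pref t r)) := by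
          field_simp
      _ ≤ _ := mul_le_mul_of_nonneg_right h1 (by positivity)

lemma eNorm_pow_le_rest (d : Strat N) : eNorm d.pow ≤ eNorm d.rest := by
  refine Real.sqrt_le_sqrt ?_
  simp only [dotProduct, Fin.sum_univ_castSucc (n := N)]
  exact le_add_of_nonneg_right (mul_self_nonneg _)

/-- Cauchy-Schwarz for the weighted norms. -/
lemma wnorm_mul_wnorm_ge {r : Fin Q} (hc : 0 ≤ c) (d e : Strat N) :
    √(G.wTau pref t c q) * √(G.wTau pref t c r) * (|d.tau| * |e.tau|) +
      √(G.rho pref t q) * √(G.rho pref t r) * (eNorm d.pow * eNorm e.pow) ≤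
      G.wnorm pref t c q d * G.wnorm pref t c r e := by
  have h0 : ∀ q, 0 ≤ G.rho pref t q := fun q => rho_nonneg
  have h1 : ∀ q, 0 ≤ G.wTau pref t c q := fun q => (h0 q).trans (rho_le_wTau hc)
  have hp : eNorm d.pow * eNorm e.pow ≤ eNorm d.rest * eNorm e.rest :=
    mul_le_mul (eNorm_pow_le_rest d) (eNorm_pow_le_rest e) (eNorm_nonneg _) (eNorm_nonneg _)
  refine (add_le_add_right (mul_le_mul_of_nonneg_left hp (by positivity)) _).trans ?_
  refine abs_le_of_sq_le_sq' ?_ (mul_nonneg (wnorm_nonneg d) (wnorm_nonneg e)) |>.2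
  rw [mul_pow, wnorm_sq hc, wnorm_sq hc]
  have e1 : ∀ {a b : ℝ}, 0 ≤ a → (√a * b) ^ 2 = a * b ^ 2 := fun ha => by
    rw [mul_pow, Real.sq_sqrt ha]
  rw [← sq_abs d.tau, ← sq_abs e.tau, ← e1 (h1 q), ← e1 (h1 r), ← e1 (h0 q), ← e1 (h0 r)]
  -- The square is the remainder in Lagrange's identity for two pairs of numbers.
  nlinarith [sq_nonneg (√(G.wTau pref t c q) * |d.tau| * (√(G.rho pref t r) * eNorm e.rest) -
    √(G.rho pref t q) * eNorm d.rest * (√(G.wTau pref t c r) * |e.tau|))]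

/-! ### The contraction property of best responses -/

/-- The mixed difference of the logarithms of the sum rates, as a mixed derivative of `θ_q`. -/
lemma exists_log_sumRate_mixed_eq (c : ℝ) {x x' : Profile Q N} (hx : ∀ r, r ≠ q → x r ∈ G.Y r)
    (hx' : ∀ r, r ≠ q → x' r ∈ G.Y r) {y y' : Strat N} (hy : y ∈ G.Yhat pref t q)
    (hy' : y' ∈ G.Yhat pref t q) :
    ∃ X ∈ G.dom pref t q,
      Real.log (G.sumRate q x y.pow) - Real.log (G.sumRate q x y'.pow) -
          Real.log (G.sumRate q x' y.pow) + Real.log (G.sumRate q x' y'.pow) =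
        ∑ r ∈ Finset.univ.erase q, (y - y').pow ⬝ᵥ
          ((hessBlock (G.theta c q) X q r).submatrix pIdx pIdx).mulVec (x r - x' r).pow := by
  -- Only the powers are changed, both for user `q` and for the others. The increments `U` and `V`
  -- then have no sensing or false alarm components, and only the power blocks of the Hessian
  -- appear.
  set z := Strat.ofParts y'.tau y.pow y'.pfa with hz
  set m : Profile Q N := fun r => Strat.ofParts (x' r).tau (x r).pow (x' r).pfa with hm
  have hzY : z ∈ G.Yhat pref t q :=
    ⟨ofParts_mem_Y hy'.1 hy.1.2.2.2.1, by rw [hz, Strat.pow_ofParts]; exact hy.2⟩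
  have hmY : ∀ r, r ≠ q → m r ∈ G.Y r := fun r hr => ofParts_mem_Y (hx' r hr) (hx r hr).2.2.2.1
  set b := Function.update x' q y' with hb
  set U : Profile Q N := Pi.single q (z - y') with hU
  set V : Profile Q N := ∑ r ∈ Finset.univ.erase q, Pi.single r (m r - x' r) with hV
  have hVq : V q = 0 := by
    rw [hV, Finset.sum_apply]
    exact Finset.sum_eq_zero fun r hr => Pi.single_eq_of_ne (Finset.ne_of_mem_erase hr).symm _
  have hVr : ∀ r, r ≠ q → V r = m r - x' r := by
    intro r hr
    rw [hV, Finset.sum_apply, Finset.sum_eq_single r]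
    · simp
    · intro r' _ hr'
      exact Pi.single_eq_of_ne hr'.symm _
    · intro h
      exact absurd (Finset.mem_erase.2 ⟨hr, Finset.mem_univ r⟩) h
  have hpt : ∀ s u : ℝ, b + s • U + u • V =
      Function.update (fun r => x' r + u • (m r - x' r)) q (y' + s • (z - y')) := by
    intro s u
    ext r : 1
    rcases eq_or_ne r q with rfl | hr
    · simp [hb, hU, hVq]
    · simp [hb, hU, hVr r hr, hr]
  have hdom : ∀ s ∈ Set.Icc (0 : ℝ) 1, ∀ u ∈ Set.Icc (0 : ℝ) 1,
      b + s • U + u • V ∈ G.dom pref t q := by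
    intro s hs u hu
    rw [hpt]
    refine update_mem_dom (fun r hr => ?_) ?_
    · exact (G.convex_Y r).add_smul_sub_mem (hx' r hr) (hmY r hr) hu
    · exact (convex_Yhat pref t q).add_smul_sub_mem hy' hzY hs
  obtain ⟨s, hs, u, hu, heq⟩ := exists_mixed_difference_eq (F := G.theta c q) (b := b) (U := U)
    (V := V) fun s hs u hu => contDiffAt_theta c (mem_Y_of_mem_dom (hdom s hs u hu))
      (throughput_pos_of_mem_dom (hdom s hs u hu))
  refine ⟨_, hdom s hs u hu, ?_⟩
  have e11 : b + U + V = Function.update m q z := by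
    have := hpt 1 1
    simp only [one_smul, add_sub_cancel] at this
    exact this
  have e01 : b + V = Function.update m q y' := by
    have := hpt 0 1
    simp only [one_smul, zero_smul, add_zero, add_sub_cancel] at this
    exact this
  have e10 : b + U = Function.update x' q z := by
    have := hpt 1 0
    simp only [one_smul, zero_smul, add_zero, add_sub_cancel] at this
    exact this
  have hval : ∀ (w : Profile Q N) (v : Strat N), (∀ r, r ≠ q → w r ∈ G.Y r) → v ∈ G.Yhat pref t q →
      G.theta c q (Function.update w q v) = Real.log (1 - v.tau ^ 2 / (G.f q * G.T q)) +
        (Real.log (1 - v.pfa) + Real.log (G.sumRate q w v.pow)) -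
        c / 2 * G.dev q (Function.update w q v) ^ 2 := by
    intro w v hw hv
    rw [theta_eq, theta_zero_update hv.1
      (sumRate_pos hw (pow_nonneg_of_mem hv.1) (sum_pow_pos_of_mem_Yhat hv))]
  have hdev : G.dev q (Function.update m q y') = G.dev q (Function.update x' q y') := by
    have : ∀ r, (Function.update m q y' r).tau = (Function.update x' q y' r).tau := by
      intro r
      rcases eq_or_ne r q with rfl | hr
      · simp
      · simp [hr, hm]
    simp only [dev_apply, this]
  have htau : z.tau = y'.tau := by simp [hz]
  have hpfa : z.pfa = y'.pfa := by simp [hz]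
  have hpow : z.pow = y.pow := by simp [hz]
  have hsm : ∀ p, G.sumRate q m p = G.sumRate q x p := fun p =>
    G.sumRate_congr p fun r _ => by simp [hm]
  rw [e11, e01, e10, hb, hval m z hmY hzY, hval m y' hmY hy', hval x' z hx' hzY, hval x' y' hx' hy',
    dev_update_congr m htau, dev_update_congr x' htau, hdev, htau, hpfa, hpow, hsm, hsm, ← hb] at heq
  calc _ = fderiv ℝ (fderiv ℝ (G.theta c q)) (b + s • U + u • V) U V := by
        rw [← heq]
        ring
    _ = ∑ r ∈ Finset.univ.erase q, fderiv ℝ (fderiv ℝ (G.theta c q)) (b + s • U + u • V)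
          (Pi.single q (z - y')) (Pi.single r (m r - x' r)) := by
        conv_lhs => rw [hV]
        rw [map_sum]
    _ = _ := by
        refine Finset.sum_congr rfl fun r _ => ?_
        rw [fderiv_fderiv_single, dotProduct_mulVec_of_pow _ (by simp [htau]) (by simp [hpfa])
          (by simp [hm]) (by simp [hm])]
        simp [hpow, hm]

/-- Two best responses differ by at most the weighted differences of the strategies that they
respond to. -/
lemma IsBestResponse.wnorm_sub_le (hpref : G.IsRefPower pref) (hc : 0 ≤ c) (hprice : 0 ≤ price)
    (hpt : price ≤ t) (hD : ∀ q, IsUnit (G.Dmat pref t c q).det) {x x' : Profile Q N}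
    (hx : ∀ r, r ≠ q → x r ∈ G.Y r) (hx' : ∀ r, r ≠ q → x' r ∈ G.Y r) {y y' : Strat N}
    (hy : G.IsBestResponse c price q x y) (hy' : G.IsBestResponse c price q x' y') :
    G.wnorm pref t c q (y - y') ≤ ∑ r ∈ Finset.univ.erase q,
      G.betaCoef pref t c q r * G.wnorm pref t c r (x r - x' r) := by
  have hyh := hy.mem_Yhat hpref hprice hpt hx
  have hyh' := hy'.mem_Yhat hpref hprice hpt hx'
  have g1 := hy.growth hpref hc hprice hpt (hD q) hx hy'.1.2 hyh'
  have g2 := hy'.growth hpref hc hprice hpt (hD q) hx' hy.1.2 hyh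
  rw [wnorm_sub_comm] at g1
  have i1 := G.globI_update_sub q x y y'
  have i2 := G.globI_update_sub q x' y y'
  -- Both sides are the same local difference, so the price terms cancel when `g1` and `g2` are
  -- added.
  have i3 : price * (G.globI (Function.update x q y') - G.globI (Function.update x q y)) =
      price * (G.globI (Function.update x' q y') - G.globI (Function.update x' q y)) := by
    rw [i1, i2]
  obtain ⟨X, hX, hlog⟩ := exists_log_sumRate_mixed_eq c hx hx' hyh hyh'
  have hval : ∀ (w : Profile Q N) (v : Strat N), (∀ r, r ≠ q → w r ∈ G.Y r) → v ∈ G.Yhat pref t q →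
      G.theta c q (Function.update w q v) = Real.log (1 - v.tau ^ 2 / (G.f q * G.T q)) +
        (Real.log (1 - v.pfa) + Real.log (G.sumRate q w v.pow)) -
        c / 2 * G.dev q (Function.update w q v) ^ 2 := by
    intro w v hw hv
    rw [theta_eq, theta_zero_update hv.1
      (sumRate_pos hw (pow_nonneg_of_mem hv.1) (sum_pow_pos_of_mem_Yhat hv))]
  rw [hval x y hx hyh, hval x y' hx hyh'] at g1
  rw [hval x' y hx' hyh, hval x' y' hx' hyh'] at g2
  have hdy : ∀ w : Profile Q N, G.dev q (Function.update w q y) - G.dev q (Function.update w q y') =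
      (1 - 1 / (Q : ℝ)) / √(G.f q) * (y - y').tau := by
    intro w
    rw [← dev_single, ← map_sub]
    congr 1
    have := update_add_smul_single w q y' (y - y') 1
    rw [one_smul, one_smul, add_sub_cancel] at this
    rw [this, add_sub_cancel_left]
  have hdx : G.dev q (Function.update x q y') - G.dev q (Function.update x' q y') =
      -∑ r ∈ Finset.univ.erase q, 1 / (Q : ℝ) / √(G.f r) * (x r - x' r).tau := by
    rw [← Finset.sum_neg_distrib, ← map_sub]
    have : Function.update x q y' - Function.update x' q y' =
        ∑ r ∈ Finset.univ.erase q, (Pi.single r (x r - x' r) : Profile Q N) := by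
      ext r : 1
      rw [Finset.sum_apply]
      rcases eq_or_ne r q with rfl | hr
      · rw [Finset.sum_eq_zero fun r' hr' => Pi.single_eq_of_ne (Finset.ne_of_mem_erase hr').symm _]
        simp
      · rw [Finset.sum_eq_single r (fun r' _ hr' => Pi.single_eq_of_ne hr'.symm _)
          (fun h => absurd (Finset.mem_erase.2 ⟨hr, Finset.mem_univ r⟩) h)]
        simp [hr]
    rw [this, map_sum]
    exact Finset.sum_congr rfl fun r hr => dev_single_of_ne (Finset.ne_of_mem_erase hr) _
  -- The mixed second difference of the square of a linear function is twice the product of its two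
  -- increments, so the penalty is treated exactly.
  have hpen : -(c / 2 * (G.dev q (Function.update x q y) ^ 2 - G.dev q (Function.update x q y') ^ 2 -
      G.dev q (Function.update x' q y) ^ 2 + G.dev q (Function.update x' q y') ^ 2)) =
      ∑ r ∈ Finset.univ.erase q, G.tauCoupling c q r * ((y - y').tau * (x r - x' r).tau) := by
    have h1 := hdy x
    have h2 := hdy x'
    set κ := (1 - 1 / (Q : ℝ)) / √(G.f q) * (y - y').tau with hκ
    have e : ∑ r ∈ Finset.univ.erase q, G.tauCoupling c q r * ((y - y').tau * (x r - x' r).tau) =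
        c * κ * ∑ r ∈ Finset.univ.erase q, 1 / (Q : ℝ) / √(G.f r) * (x r - x' r).tau := by
      rw [Finset.mul_sum]
      refine Finset.sum_congr rfl fun r _ => ?_
      rw [tauCoupling, hκ]
      ring
    rw [e, ← neg_eq_iff_eq_neg.2 hdx, sub_eq_iff_eq_add.1 h1, sub_eq_iff_eq_add.1 h2]
    ring
  have hsq : G.wnorm pref t c q (y - y') ^ 2 ≤ ∑ r ∈ Finset.univ.erase q,
      (G.tauCoupling c q r * ((y - y').tau * (x r - x' r).tau) + (y - y').pow ⬝ᵥ
        ((hessBlock (G.theta c q) X q r).submatrix pIdx pIdx).mulVec (x r - x' r).pow) := by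
    rw [Finset.sum_add_distrib, ← hlog, ← hpen]
    linarith
  have hterm : ∀ r ∈ Finset.univ.erase q,
      G.tauCoupling c q r * ((y - y').tau * (x r - x' r).tau) + (y - y').pow ⬝ᵥ
        ((hessBlock (G.theta c q) X q r).submatrix pIdx pIdx).mulVec (x r - x' r).pow ≤
      G.wnorm pref t c q (y - y') *
        (G.betaCoef pref t c q r * G.wnorm pref t c r (x r - x' r)) := by
    intro r hr
    have hr' := Finset.ne_of_mem_erase hr
    obtain ⟨b1, b2⟩ := Emat_le_betaCoef hc (hD q) (hD r) hX
    rw [hessBlock_theta_zero_zero c hr' (mem_Y_of_mem_dom hX) (throughput_pos_of_mem_dom hX)] at b1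
    have hβ := betaCoef_nonneg (G := G) (pref := pref) (t := t) (c := c) q r
    have t1 : G.tauCoupling c q r * ((y - y').tau * (x r - x' r).tau) ≤
        G.betaCoef pref t c q r * (√(G.wTau pref t c q) * √(G.wTau pref t c r)) *
          (|(y - y').tau| * |(x r - x' r).tau|) := by
      refine (le_abs_self _).trans ?_
      rw [abs_mul, abs_mul]
      exact mul_le_mul_of_nonneg_right b1 (by positivity)
    have t2 := (le_abs_self _).trans (abs_dotProduct_mulVec_le
      ((hessBlock (G.theta c q) X q r).submatrix pIdx pIdx) (y - y').pow (x r - x' r).pow)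
    rw [mul_assoc] at t2
    have t3 := mul_le_mul_of_nonneg_right b2
      (mul_nonneg (eNorm_nonneg (y - y').pow) (eNorm_nonneg (x r - x' r).pow))
    have t4 := mul_le_mul_of_nonneg_left
      (wnorm_mul_wnorm_ge (G := G) (pref := pref) (t := t) (q := q) (r := r) hc (y - y') (x r - x' r)) hβ
    calc _ ≤ G.betaCoef pref t c q r * (√(G.wTau pref t c q) * √(G.wTau pref t c r)) *
          (|(y - y').tau| * |(x r - x' r).tau|) +
          G.betaCoef pref t c q r * (√(G.rho pref t q) * √(G.rho pref t r)) *
          (eNorm (y - y').pow * eNorm (x r - x' r).pow) := add_le_add t1 (t2.trans t3)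
      _ ≤ _ := by
        refine (le_of_eq ?_).trans (t4.trans (le_of_eq ?_))
        · ring
        · ring
  have hfin := hsq.trans (Finset.sum_le_sum hterm)
  rw [← Finset.mul_sum, sq] at hfin
  have hnn := wnorm_nonneg (G := G) (pref := pref) (t := t) (c := c) (q := q) (y - y')
  -- One factor of the norm is cancelled; if it is zero the claim is trivial.
  rcases hnn.eq_or_lt with h0 | h0
  · rw [← h0]
    exact Finset.sum_nonneg fun r _ => mul_nonneg (betaCoef_nonneg q r) (wnorm_nonneg _)
  · exact le_of_mul_le_mul_left hfin h0

end CRGame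

/-! ### Totally asynchronous contractions -/

/-- The box argument for asynchronous iterations: once all components stay below `κ ^ j * M`, old
information is eventually purged, every user then updates at least once, and from there on all
components stay below `κ ^ (j + 1) * M`. -/
lemma AsyncSchedule.tendsto_zero {Q : ℕ} (s : AsyncSchedule Q) {a : ℕ → Fin Q → ℝ} {κ : ℝ}
    (ha : ∀ n q, 0 ≤ a n q) (h0 : 0 ≤ κ) (h1 : κ < 1)
    (hup : ∀ n q, n ∈ s.updates q → ∀ M, 0 ≤ M → (∀ r, r ≠ q → a (s.readTime q r n) r ≤ M) →
      a (n + 1) q ≤ κ * M)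
    (hst : ∀ n q, n ∉ s.updates q → a (n + 1) q = a n q) (q : Fin Q) :
    Filter.Tendsto (fun n => a n q) Filter.atTop (nhds 0) := by
  set M := ∑ q, a 0 q with hM
  have hM0 : 0 ≤ M := Finset.sum_nonneg fun q _ => ha 0 q
  have hbase : ∀ n, ∀ m ≤ n, ∀ q, a m q ≤ M := by
    intro n
    induction n with
    | zero =>
      intro m hm q
      rw [Nat.le_zero.1 hm]
      exact Finset.single_le_sum (f := fun q => a 0 q) (fun q _ => ha 0 q) (Finset.mem_univ q)
    | succ n ih =>
      intro m hm q
      rcases Nat.le_succ_iff.1 hm with hm | rfl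
      · exact ih m hm q
      · by_cases hn : n ∈ s.updates q
        · refine (hup n q hn M hM0 fun r hr => ih _ (s.readTime_le q r n hn hr) r).trans ?_
          exact mul_le_of_le_one_left hM0 h1.le
        · rw [hst n q hn]
          exact ih n le_rfl q
  have hstep : ∀ j : ℕ, ∃ n₀, ∀ n, n₀ ≤ n → ∀ q, a n q ≤ κ ^ j * M := by
    intro j
    induction j with
    | zero => exact ⟨0, fun n _ q => by simpa using hbase n n le_rfl q⟩
    | succ j ih =>
      obtain ⟨n₁, hn₁⟩ := ih
      have hread : ∀ q r : Fin Q, ∃ n₀, r ≠ q → ∀ n ∈ s.updates q, n₀ ≤ n →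
          n₁ ≤ s.readTime q r n := by
        intro q r
        by_cases hr : r ≠ q
        · obtain ⟨n₀, h⟩ := s.readTime_large q r hr n₁
          exact ⟨n₀, fun _ => h⟩
        · exact ⟨0, fun h => absurd h hr⟩
      choose m hm using hread
      -- An update time past all the thresholds `m q r`, with their sum in place of their maximum;
      -- from then on the user reads only values inside the current box.
      have hupd : ∀ q, ∃ n ∈ s.updates q, ∀ r, m q r ≤ n := by
        intro q
        obtain ⟨n, hn, hlt⟩ := (s.updates_infinite q).exists_gt (∑ r, m q r)
        exact ⟨n, hn, fun r => (Finset.single_le_sum (f := fun r => m q r)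
          (fun r _ => Nat.zero_le _) (Finset.mem_univ r)).trans hlt.le⟩
      choose k hk hkm using hupd
      have hgood : ∀ q n, n ∈ s.updates q → k q ≤ n → a (n + 1) q ≤ κ ^ (j + 1) * M := by
        intro q n hn hkn
        rw [pow_succ', mul_assoc]
        exact hup n q hn _ (by positivity) fun r hr =>
          hn₁ _ (hm q r hr n hn ((hkm q r).trans hkn)) r
      have hall : ∀ q n, k q + 1 ≤ n → a n q ≤ κ ^ (j + 1) * M := by
        intro q n hn
        induction n, hn using Nat.le_induction with
        | base => exact hgood q _ (hk q) le_rfl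
        | succ n hn ih =>
          by_cases hu : n ∈ s.updates q
          · exact hgood q n hu (by omega)
          · rw [hst n q hu]
            exact ih
      refine ⟨∑ q, (k q + 1), fun n hn q => hall q n (le_trans ?_ hn)⟩
      exact Finset.single_le_sum (f := fun q => k q + 1) (fun q _ => Nat.zero_le _)
        (Finset.mem_univ q)
  have hlim : Filter.Tendsto (fun j : ℕ => κ ^ j * M) Filter.atTop (nhds 0) := by
    simpa using (tendsto_pow_atTop_nhds_zero_of_lt_one h0 h1).mul_const M
  rw [Metric.tendsto_atTop]
  intro ε hε
  obtain ⟨j, hj⟩ := (hlim.eventually (gt_mem_nhds hε)).exists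
  obtain ⟨n₀, hn₀⟩ := hstep j
  refine ⟨n₀, fun n hn => ?_⟩
  rw [Real.dist_eq, sub_zero, abs_of_nonneg (ha n q)]
  exact (hn₀ n hn q).trans_lt hj

/-- All users update at all times, with current information. -/
def AsyncSchedule.jacobi (Q : ℕ) : AsyncSchedule Q where
  updates _ := Set.univ
  readTime _ _ n := n
  updates_infinite _ := Set.infinite_univ
  readTime_le _ _ _ _ _ := le_rfl
  readTime_large _ _ _ M := ⟨M, fun _ _ h => h⟩

/-- The users update in cyclic order, with current information. -/
def AsyncSchedule.gaussSeidel (Q : ℕ) : AsyncSchedule Q where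
  updates q := {n | (q : ℕ) = n % Q}
  readTime _ _ n := n
  updates_infinite q := Set.infinite_of_forall_exists_gt fun n =>
    -- A number congruent to `q` modulo `Q` that exceeds `n`, because `Q ≥ 1`.
    ⟨q + Q * (n + 1), by simp [Nat.mod_eq_of_lt q.2], by
      have := Nat.le_mul_of_pos_left (n + 1) (Fin.pos q)
      omega⟩
  readTime_le _ _ _ _ _ := le_rfl
  readTime_large _ _ _ M := ⟨M, fun _ _ h => h⟩

/-! ### Equilibria and convergence of the best-response iterations. -/

namespace CRGame

variable {Q N : ℕ} {G : CRGame Q N} {q : Fin Q} {c price t : ℝ} {pref : Fin Q → Fin N → ℝ}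

lemma IsJacobiSeq.isAsyncSeq {x : ℕ → Profile Q N} (h : G.IsJacobiSeq c price x) :
    G.IsAsyncSeq c price (AsyncSchedule.jacobi Q) x :=
  fun n q => ⟨fun _ => h n q, fun hn => absurd (Set.mem_univ n) hn⟩

lemma IsGaussSeidelSeq.isAsyncSeq {x : ℕ → Profile Q N} (h : G.IsGaussSeidelSeq c price x) :
    G.IsAsyncSeq c price (AsyncSchedule.gaussSeidel Q) x :=
  fun n q => ⟨fun hn => (h n q).1 hn, fun hn => (h n q).2 hn⟩

lemma IsAsyncSeq.mem_Y {s : AsyncSchedule Q} {x : ℕ → Profile Q N} (hx : ∀ q, x 0 q ∈ G.Y q)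
    (h : G.IsAsyncSeq c price s x) (n : ℕ) : ∀ q, x n q ∈ G.Y q := by
  induction n with
  | zero => exact hx
  | succ n ih =>
    intro q
    by_cases hn : n ∈ s.updates q
    · exact ((h n q).1 hn).1.1
    · rw [(h n q).2 hn]
      exact ih q

lemma abs_le_wnorm_div (hc : 0 ≤ c) (hD : IsUnit (G.Dmat pref t c q).det) (d : Strat N)
    (i : Fin (N + 2)) : |d i| ≤ G.wnorm pref t c q d / √(G.rho pref t q) := by
  have h0 := rho_pos hD
  rw [le_div_iff₀ (Real.sqrt_pos.2 h0)]
  refine abs_le_of_sq_le_sq' ?_ (wnorm_nonneg d) |>.2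
  rw [mul_pow, sq_abs, Real.sq_sqrt h0.le, mul_comm]
  exact rho_mul_sq_le hc d i

lemma continuous_wnorm : Continuous (G.wnorm pref t c q) := by
  unfold wnorm eNorm Strat.rest dotProduct Strat.tau
  fun_prop

lemma wnorm_zero : G.wnorm pref t c q 0 = 0 := by
  have h1 : (0 : Strat N).tau = 0 := rfl
  have h2 : (0 : Strat N).rest = 0 := rfl
  rw [wnorm, h1, h2]
  simp [eNorm]

lemma tendsto_of_tendsto_wnorm (hc : 0 ≤ c) (hD : ∀ q, IsUnit (G.Dmat pref t c q).det)
    {x : ℕ → Profile Q N} {xs : Profile Q N}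
    (h : ∀ q, Filter.Tendsto (fun n => G.wnorm pref t c q (x n q - xs q)) Filter.atTop (nhds 0)) :
    Filter.Tendsto x Filter.atTop (nhds xs) := by
  refine tendsto_pi_nhds.2 fun q => tendsto_pi_nhds.2 fun i => ?_
  rw [tendsto_iff_norm_sub_tendsto_zero]
  refine squeeze_zero (fun n => norm_nonneg _)
    (fun n => abs_le_wnorm_div hc (hD q) (x n q - xs q) i) ?_
  simpa using (h q).div_const (√(G.rho pref t q))

lemma IsBestResponse.unique (hpref : G.IsRefPower pref) (hc : 0 ≤ c) (hprice : 0 ≤ price)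
    (hpt : price ≤ t) (hD : ∀ q, IsUnit (G.Dmat pref t c q).det) {x : Profile Q N}
    (hx : ∀ r, r ≠ q → x r ∈ G.Y r) {y y' : Strat N}
    (hy : G.IsBestResponse c price q x y) (hy' : G.IsBestResponse c price q x y') : y = y' := by
  have h := hy.wnorm_sub_le hpref hc hprice hpt hD hx hx hy'
  simp only [sub_self, wnorm_zero, mul_zero, Finset.sum_const_zero] at h
  exact sub_eq_zero.1 (eq_zero_of_wnorm_eq_zero hc (hD q) (le_antisymm h (wnorm_nonneg _)))

/-- Weights for which the coupling coefficients form a contraction in the weighted maximum norm. -/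
lemma exists_contraction_weights (hΓ : IsPMatrix (G.Gam pref t c)) :
    ∃ (v : Fin Q → ℝ) (κ : ℝ), (∀ q, 0 < v q) ∧ 0 ≤ κ ∧ κ < 1 ∧
      ∀ q, ∑ r ∈ Finset.univ.erase q, G.betaCoef pref t c q r * v r ≤ κ * v q := by
  obtain ⟨v, hv, hpos⟩ := hΓ.exists_pos_mulVec_pos (by
    intro q r hqr
    simp only [Gam, Matrix.of_apply, if_neg hqr.symm]
    exact neg_nonpos.2 (betaCoef_nonneg q r))
  have hlt : ∀ q, ∑ r ∈ Finset.univ.erase q, G.betaCoef pref t c q r * v r < v q := by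
    intro q
    have h := hpos q
    rw [← Finset.add_sum_erase _ _ (Finset.mem_univ q)] at h
    have e : ∑ r ∈ Finset.univ.erase q, G.Gam pref t c q r * v r =
        -∑ r ∈ Finset.univ.erase q, G.betaCoef pref t c q r * v r := by
      rw [← Finset.sum_neg_distrib]
      refine Finset.sum_congr rfl fun r hr => ?_
      simp [Gam, Finset.ne_of_mem_erase hr]
    rw [e] at h
    simp only [Gam, Matrix.of_apply, if_true, one_mul] at h
    linarith
  -- The contraction factor is the largest of finitely many ratios below `1`; it exists because
  -- there is at least one user.
  have hQ : Nonempty (Fin Q) := ⟨⟨0, G.Q_pos⟩⟩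
  set g : Fin Q → ℝ := fun q =>
    (∑ r ∈ Finset.univ.erase q, G.betaCoef pref t c q r * v r) / v q with hg
  obtain ⟨q₀, hq₀⟩ := Finite.exists_max g
  refine ⟨v, g q₀, hv, div_nonneg (Finset.sum_nonneg fun r _ =>
    mul_nonneg (betaCoef_nonneg q₀ r) (hv r).le) (hv q₀).le, (div_lt_one (hv q₀)).2 (hlt q₀),
    fun q => ?_⟩
  exact (div_le_iff₀ (hv q)).1 (hq₀ q)

lemma sum_betaCoef_mul_le {v : Fin Q → ℝ} {κ : ℝ}
    (hκ : ∀ q, ∑ r ∈ Finset.univ.erase q, G.betaCoef pref t c q r * v r ≤ κ * v q)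
    {q : Fin Q} {a : Fin Q → ℝ} {M : ℝ} (hM : 0 ≤ M) (ha : ∀ r, r ≠ q → a r ≤ M * v r) :
    ∑ r ∈ Finset.univ.erase q, G.betaCoef pref t c q r * a r ≤ κ * M * v q := by
  calc _ ≤ ∑ r ∈ Finset.univ.erase q, G.betaCoef pref t c q r * (M * v r) :=
        Finset.sum_le_sum fun r hr => mul_le_mul_of_nonneg_left (ha r (Finset.ne_of_mem_erase hr))
          (betaCoef_nonneg q r)
    _ = M * ∑ r ∈ Finset.univ.erase q, G.betaCoef pref t c q r * v r := by
        rw [Finset.mul_sum]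
        exact Finset.sum_congr rfl fun r _ => by ring
    _ ≤ M * (κ * v q) := mul_le_mul_of_nonneg_left (hκ q) hM
    _ = _ := by ring

/-- Banach iteration for simultaneous best responses: successive differences decay geometrically,
the limit lies in the closed sets `Y q`, and the contraction estimate passes to the limit and
identifies it with its own best response. -/
lemma exists_isNash (hpref : G.IsRefPower pref) (hc : 0 ≤ c) (hprice : 0 ≤ price)
    (hpt : price ≤ t) (hD : ∀ q, IsUnit (G.Dmat pref t c q).det) (hY : ∀ q, (G.Y q).Nonempty)
    {v : Fin Q → ℝ} {κ : ℝ} (hv : ∀ q, 0 < v q) (hκ0 : 0 ≤ κ) (hκ1 : κ < 1)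
    (hκ : ∀ q, ∑ r ∈ Finset.univ.erase q, G.betaCoef pref t c q r * v r ≤ κ * v q) :
    ∃ xs, G.IsNash c price xs := by
  -- Best responses are known to exist only against profiles in the sets `Y r`; elsewhere the chosen
  -- map is the identity, which is never used.
  have hex : ∀ (x : Profile Q N), ∃ y : Profile Q N, (∀ r, x r ∈ G.Y r) →
      ∀ q, G.IsBestResponse c price q x (y q) := by
    intro x
    by_cases hx : ∀ r, x r ∈ G.Y r
    · choose y hy using fun q => exists_isBestResponse c price hpref (fun r _ => hx r) (hY q)
      exact ⟨y, fun _ => hy⟩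
    · exact ⟨x, fun h => absurd h hx⟩
  choose B hB using hex
  choose x₀ hx₀ using hY
  set x : ℕ → Profile Q N := fun n => B^[n] x₀ with hx
  have hsucc : ∀ n, x (n + 1) = B (x n) := fun n => Function.iterate_succ_apply' B n x₀
  have hmem : ∀ n q, x n q ∈ G.Y q := by
    intro n
    induction n with
    | zero => exact hx₀
    | succ n ih =>
      rw [hsucc]
      exact fun q => (hB (x n) ih q).1.1
  have hBR : ∀ n q, G.IsBestResponse c price q (x n) (x (n + 1) q) := by
    intro n q
    rw [hsucc]
    exact hB (x n) (hmem n) q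
  set M := ∑ q, G.wnorm pref t c q (x 1 q - x 0 q) / v q with hM
  have hMterm : ∀ q, 0 ≤ G.wnorm pref t c q (x 1 q - x 0 q) / v q := fun q =>
    div_nonneg (wnorm_nonneg _) (hv q).le
  have hM0 : 0 ≤ M := Finset.sum_nonneg fun q _ => hMterm q
  have hgeo : ∀ n q, G.wnorm pref t c q (x (n + 1) q - x n q) ≤ κ ^ n * M * v q := by
    intro n
    induction n with
    | zero =>
      intro q
      rw [pow_zero, one_mul, ← div_le_iff₀ (hv q)]
      exact Finset.single_le_sum (f := fun q => G.wnorm pref t c q (x 1 q - x 0 q) / v q)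
        (fun q _ => hMterm q) (Finset.mem_univ q)
    | succ n ih =>
      intro q
      refine ((hBR (n + 1) q).wnorm_sub_le hpref hc hprice hpt hD (fun r _ => hmem _ r)
        (fun r _ => hmem _ r) (hBR n q)).trans ?_
      rw [pow_succ', mul_assoc κ]
      exact sum_betaCoef_mul_le hκ (by positivity) fun r _ => ih r
  set C := M * ∑ q, v q / √(G.rho pref t q) with hC
  have hterm : ∀ q, 0 ≤ v q / √(G.rho pref t q) := fun q =>
    div_nonneg (hv q).le (Real.sqrt_nonneg _)
  have hC0 : 0 ≤ C := mul_nonneg hM0 (Finset.sum_nonneg fun q _ => hterm q)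
  have hcauchy : CauchySeq x := by
    refine cauchySeq_of_le_geometric κ C hκ1 fun n => ?_
    rw [dist_comm, dist_eq_norm]
    refine (pi_norm_le_iff_of_nonneg (by positivity)).2 fun q =>
      (pi_norm_le_iff_of_nonneg (by positivity)).2 fun i => ?_
    refine (abs_le_wnorm_div hc (hD q) (x (n + 1) q - x n q) i).trans ?_
    refine (div_le_div_of_nonneg_right (hgeo n q) (Real.sqrt_nonneg _)).trans ?_
    have h1 : v q / √(G.rho pref t q) ≤ ∑ q, v q / √(G.rho pref t q) :=
      Finset.single_le_sum (f := fun q => v q / √(G.rho pref t q)) (fun q _ => hterm q)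
        (Finset.mem_univ q)
    have h2 := mul_le_mul_of_nonneg_left h1 (show 0 ≤ κ ^ n * M by positivity)
    rw [hC]
    calc _ = κ ^ n * M * (v q / √(G.rho pref t q)) := by ring
      _ ≤ _ := h2
      _ = _ := by ring
  obtain ⟨xs, hxs⟩ := cauchySeq_tendsto_of_complete hcauchy
  have hxsq : ∀ q, Filter.Tendsto (fun n => x n q) Filter.atTop (nhds (xs q)) :=
    tendsto_pi_nhds.1 hxs
  have hxsY : ∀ q, xs q ∈ G.Y q := fun q =>
    (G.isClosed_Y q).mem_of_tendsto (hxsq q) (Filter.Eventually.of_forall fun n => hmem n q)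
  refine ⟨xs, fun q => ?_⟩
  have hBs := hB xs hxsY q
  have hle : ∀ n, G.wnorm pref t c q (x (n + 1) q - B xs q) ≤ ∑ r ∈ Finset.univ.erase q,
      G.betaCoef pref t c q r * G.wnorm pref t c r (x n r - xs r) := fun n =>
    (hBR n q).wnorm_sub_le hpref hc hprice hpt hD (fun r _ => hmem _ r) (fun r _ => hxsY r) hBs
  have hl : Filter.Tendsto (fun n => G.wnorm pref t c q (x (n + 1) q - B xs q)) Filter.atTop
      (nhds (G.wnorm pref t c q (xs q - B xs q))) :=
    (continuous_wnorm.tendsto _).comp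
      (((hxsq q).comp (Filter.tendsto_add_atTop_nat 1)).sub_const (B xs q))
  have hr : Filter.Tendsto (fun n => ∑ r ∈ Finset.univ.erase q,
      G.betaCoef pref t c q r * G.wnorm pref t c r (x n r - xs r)) Filter.atTop (nhds 0) := by
    have : Filter.Tendsto (fun n => ∑ r ∈ Finset.univ.erase q,
        G.betaCoef pref t c q r * G.wnorm pref t c r (x n r - xs r)) Filter.atTop
        (nhds (∑ r ∈ Finset.univ.erase q,
          G.betaCoef pref t c q r * G.wnorm pref t c r (xs r - xs r))) :=
      tendsto_finsetSum _ fun r _ =>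
        ((continuous_wnorm.tendsto _).comp ((hxsq r).sub_const (xs r))).const_mul _
    simpa [wnorm_zero] using this
  have h0 := le_of_tendsto_of_tendsto' hl hr hle
  have := sub_eq_zero.1 (eq_zero_of_wnorm_eq_zero hc (hD q) (le_antisymm h0 (wnorm_nonneg _)))
  rw [this]
  exact hBs

/-- Each component of the equilibrium is a best response to the equilibrium, so the distances to it,
divided by the weights `v`, satisfy the hypotheses of the box argument. -/
lemma IsAsyncSeq.tendsto (hpref : G.IsRefPower pref) (hc : 0 ≤ c) (hprice : 0 ≤ price)
    (hpt : price ≤ t) (hD : ∀ q, IsUnit (G.Dmat pref t c q).det)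
    {v : Fin Q → ℝ} {κ : ℝ} (hv : ∀ q, 0 < v q) (hκ0 : 0 ≤ κ) (hκ1 : κ < 1)
    (hκ : ∀ q, ∑ r ∈ Finset.univ.erase q, G.betaCoef pref t c q r * v r ≤ κ * v q)
    {xs : Profile Q N} (hxs : G.IsNash c price xs) {s : AsyncSchedule Q} {x : ℕ → Profile Q N}
    (hx : ∀ q, x 0 q ∈ G.Y q) (h : G.IsAsyncSeq c price s x) :
    Filter.Tendsto x Filter.atTop (nhds xs) := by
  have hmem := h.mem_Y hx
  refine tendsto_of_tendsto_wnorm hc hD fun q => ?_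
  have hz := s.tendsto_zero (a := fun n q => G.wnorm pref t c q (x n q - xs q) / v q)
    (fun n q => div_nonneg (wnorm_nonneg _) (hv q).le) hκ0 hκ1 (by
      intro n q hn M hM hle
      rw [div_le_iff₀ (hv q)]
      refine (((h n q).1 hn).wnorm_sub_le hpref hc hprice hpt hD (fun r _ => hmem _ r)
        (fun r _ => (hxs r).1.1) (hxs q)).trans ?_
      exact sum_betaCoef_mul_le hκ hM fun r hr => (div_le_iff₀ (hv r)).1 (hle r hr)) (by
      intro n q hn
      simp only [(h n q).2 hn]) q
  have := hz.mul_const (v q)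
  simp only [zero_mul, div_mul_cancel₀ _ (hv q).ne'] at this
  exact this

/-- An equilibrium repeated forever is a Jacobi sequence, hence converges to any other equilibrium.
-/
lemma IsNash.unique (hpref : G.IsRefPower pref) (hc : 0 ≤ c) (hprice : 0 ≤ price)
    (hpt : price ≤ t) (hD : ∀ q, IsUnit (G.Dmat pref t c q).det)
    {v : Fin Q → ℝ} {κ : ℝ} (hv : ∀ q, 0 < v q) (hκ0 : 0 ≤ κ) (hκ1 : κ < 1)
    (hκ : ∀ q, ∑ r ∈ Finset.univ.erase q, G.betaCoef pref t c q r * v r ≤ κ * v q)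
    {xs z : Profile Q N} (hxs : G.IsNash c price xs) (hz : G.IsNash c price z) : z = xs := by
  have hconst : G.IsAsyncSeq c price (AsyncSchedule.jacobi Q) fun _ => z :=
    IsJacobiSeq.isAsyncSeq fun _ q => hz q
  exact tendsto_nhds_unique tendsto_const_nhds
    (hconst.tendsto hpref hc hprice hpt hD hv hκ0 hκ1 hκ hxs fun q => (hz q).1.1)

end CRGame

end

theorem theorem4 {Q N : ℕ} (G : CRGame Q N) (c price t : ℝ)
    (hc : 0 ≤ c) (hprice : 0 ≤ price) (ht : 0 < t) (hpt : price ≤ t)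
    (hY : ∀ q, (G.Y q).Nonempty)
    (pref : Fin Q → Fin N → ℝ) (hpref : G.IsRefPower pref)
    (hD : ∀ q, IsUnit (G.Dmat pref t c q).det)
    (hΓ : IsPMatrix (G.Gam pref t c)) :
    (∀ (q : Fin Q) (x : Profile Q N), (∀ r, r ≠ q → x r ∈ G.Y r) →
      ∃! y, G.IsBestResponse c price q x y) ∧
    ∃ xs : Profile Q N,
      (∀ z : Profile Q N, G.IsNash c price z ↔ z = xs) ∧
      (∀ (s : AsyncSchedule Q) (x : ℕ → Profile Q N), (∀ q, x 0 q ∈ G.Y q) →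
        G.IsAsyncSeq c price s x → Filter.Tendsto x Filter.atTop (nhds xs)) ∧
      (∀ x : ℕ → Profile Q N, (∀ q, x 0 q ∈ G.Y q) →
        G.IsJacobiSeq c price x → Filter.Tendsto x Filter.atTop (nhds xs)) ∧
      (∀ x : ℕ → Profile Q N, (∀ q, x 0 q ∈ G.Y q) →
        G.IsGaussSeidelSeq c price x → Filter.Tendsto x Filter.atTop (nhds xs)) := by
  obtain ⟨v, κ, hv, hκ0, hκ1, hκ⟩ := CRGame.exists_contraction_weights hΓ
  obtain ⟨xs, hxs⟩ := CRGame.exists_isNash hpref hc hprice hpt hD hY hv hκ0 hκ1 hκ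
  refine ⟨fun q x hx => ?_, xs, fun z => ⟨fun hz => ?_, fun hz => hz ▸ hxs⟩, ?_, ?_, ?_⟩
  · obtain ⟨y, hy⟩ := CRGame.exists_isBestResponse c price hpref hx (hY q)
    exact ⟨y, hy, fun z hz => hz.unique hpref hc hprice hpt hD hx hy⟩
  · exact hxs.unique hpref hc hprice hpt hD hv hκ0 hκ1 hκ hz
  · exact fun s x hx h => h.tendsto hpref hc hprice hpt hD hv hκ0 hκ1 hκ hxs hx
  · exact fun x hx h => h.isAsyncSeq.tendsto hpref hc hprice hpt hD hv hκ0 hκ1 hκ hxs hx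
  · exact fun x hx h => h.isAsyncSeq.tendsto hpref hc hprice hpt hD hv hκ0 hκ1 hκ hxs hx
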